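/- Let $p\ge 0$ be a fixed integer, $\beta^\star\in\mathbb R^p$ and $\tau>0$. Consider i.i.d. data points $Z_0,Z_1',Z_1,Z_2,\dots$ with the law of $(X,Y)\in\mathbb R^p\times\mathbb R$, where $X\sim N(0,I_p)$, $\varepsilon\sim N(0,\tau^2)$ is independent of $X$, and $Y=X^\top\beta^\star+\varepsilon$. Write $\mathbf Z=(Z_1,\dots,Z_n)$, $\mathbf Z'=(Z_1',Z_2,\dots,Z_n)$ and $\|\beta^\star\|_0=\#\{i:\beta^\star_i\ne 0\}$. For a loss $h_n(Z_0,\mathbf Z)$ put $$\sigma^2(h_n)=\operatorname{Var}\big(\mathbb E[h_n(Z_0,\mathbf Z)\mid Z_0]\big),$$ $$\gamma(h_n)=\mathbb E\Big[\big(h_n(Z_0,\mathbf Z)-\mathbb E[h_n(Z_0,\mathbf Z)\mid \mathbf Z]-(h_n(Z_0,\mathbf Z')-\mathbb E[h_n(Z_0,\mathbf Z')\mid \mathbf Z'])\big)^2\Big],\qquad r(h_n)=\frac{n\,\gamma(h_n)}{\sigma^2(h_n)};$$ the relative loss stability condition is $r(h_n)=o(1)$. Let $\hat\beta_{\mathrm{OLS}}=(\mathbf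 X^\top\mathbf X)^{-1}\mathbf X^\top\mathbf Y$ be the least squares estimator fitted to $\mathbf Z$, where $\mathbf X\in\mathbb R^{n\times p}$ has rows $X_1^\top,\dots,X_n^\top$ and $\mathbf Y=(Y_1,\dots,Y_n)^\top$, let $\mathrm{ST}(\lambda)$ be the soft-thresholding estimator $$\hat\beta_{\lambda,i}=\operatorname{sign}(\hat\beta_{\mathrm{OLS},i})\Big(|\hat\beta_{\mathrm{OLS},i}|-\frac{\lambda}{n}\Big)_+,\qquad i=1,\dots,p,$$ and, for deterministic real sequences $\lambda_n,\delta_n$, let $$h_n^{\mathrm{diff}}(Z_0,\mathbf Z)=(Y_0-X_0^\top\hat\beta_{\lambda_n})^2-(Y_0-X_0^\top\hat\beta_{\lambda_n+\delta_n})^2$$ be the loss of the comparison of $\mathrm{ST}(\lambda_n)$ with $\mathrm{ST}(\lambda_n+\delta_n)$. All asymptotics are as $n\to\infty$; $f_n=\Omega(g_n)$ means $g_n=O(f_n)$ and $f_n=\omega(g_n)$ means $g_n=o(f_n)$. (0) For all large $n$, $h_n^{\mathrm{diff}}(Z_0,\mathbf Z)$ is square integrable (so that $\sigma^2$ and $\gamma$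 are well defined and finite). (1) If $\lambda_n=o(n)$, $\delta_n=o(n)$ and $\delta_n\neq 0$ for all large $n$, then $$\frac{n^2}{\delta_n^2}\,\sigma^2(h_n^{\mathrm{diff}})\to 4\tau^2\|\beta^\star\|_0 .$$ (2) If $\|\beta^\star\|_0<p$, $\lambda_n=O(\sqrt n)$, $\lambda_n=\omega(1)$ and $\delta_n=\Theta(1)$, then $$\frac{n^2}{\delta_n^2}\,\sigma^2(h_n^{\mathrm{diff}})\to 4\tau^2\|\beta^\star\|_0,\qquad \gamma(h_n^{\mathrm{diff}})=\Omega\Big(\frac1{n^2\sqrt n}\Big),\qquad r(h_n^{\mathrm{diff}})=\Omega(\sqrt n),$$ and consequently the relative loss stability condition $r(h_n^{\mathrm{diff}})=o(1)$ fails. -/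

import Mathlib

open MeasureTheory ProbabilityTheory Asymptotics Filter
open scoped Matrix Topology

noncomputable section

/-! Loss stability of a loss function `h (Z₀, Z)` for i.i.d. data with common law `P` on `𝒵`. -/

/-- The training set obtained from `z = (z₁, …, zₙ)` on replacing its first point by `z'`. -/
def replaceFirst {𝒵 : Type*} {n : ℕ} (z' : 𝒵) (z : Fin n → 𝒵) : Fin n → 𝒵 :=
  fun i => if (i : ℕ) = 0 then z' else z i

/-- The joint law of i.i.d. points `(Z₀, Z₁', (Z₁, …, Zₙ))` with common law `P`.
On the space `𝒵 × 𝒵 × (Fin n → 𝒵)` with this measure, these points are the coordinates. -/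
def iidLaw {𝒵 : Type*} [MeasurableSpace 𝒵] (P : Measure 𝒵) (n : ℕ) :
    Measure (𝒵 × 𝒵 × (Fin n → 𝒵)) :=
  P.prod (P.prod (Measure.pi fun _ : Fin n => P))

/-- The test point `Z₀`. -/
def testPoint {𝒵 : Type*} {n : ℕ} (ω : 𝒵 × 𝒵 × (Fin n → 𝒵)) : 𝒵 := ω.1

/-- The training set `Z = (Z₁, …, Zₙ)`. -/
def trainSet {𝒵 : Type*} {n : ℕ} (ω : 𝒵 × 𝒵 × (Fin n → 𝒵)) : Fin n → 𝒵 := ω.2.2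

/-- The perturbed training set `Z' = (Z₁', Z₂, …, Zₙ)`. -/
def trainSet' {𝒵 : Type*} {n : ℕ} (ω : 𝒵 × 𝒵 × (Fin n → 𝒵)) : Fin n → 𝒵 :=
  replaceFirst ω.2.1 ω.2.2

/-- `h (Z₀, T) - E[h (Z₀, T) | T]`, for a training set `T` that is a function of the sample. -/
def centeredLoss {𝒵 : Type*} [MeasurableSpace 𝒵] (P : Measure 𝒵) {n : ℕ}
    (h : 𝒵 → (Fin n → 𝒵) → ℝ) (T : 𝒵 × 𝒵 × (Fin n → 𝒵) → (Fin n → 𝒵)) :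
    𝒵 × 𝒵 × (Fin n → 𝒵) → ℝ :=
  fun ω => h (testPoint ω) (T ω) -
    ((iidLaw P n)[fun ω' => h (testPoint ω') (T ω') | MeasurableSpace.comap T inferInstance]) ω

/-- The loss stability
`γ(h) = E[(h(Z₀,Z) - E[h(Z₀,Z) | Z] - (h(Z₀,Z') - E[h(Z₀,Z') | Z']))²]`. -/
def lossStability {𝒵 : Type*} [MeasurableSpace 𝒵] (P : Measure 𝒵) {n : ℕ}
    (h : 𝒵 → (Fin n → 𝒵) → ℝ) : ℝ :=
  ∫ ω, (centeredLoss P h trainSet ω - centeredLoss P h trainSet' ω) ^ 2 ∂(iidLaw P n)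

/-- `σ²(h) = Var(E[h(Z₀,Z) | Z₀])`. -/
def lossVariance {𝒵 : Type*} [MeasurableSpace 𝒵] (P : Measure 𝒵) {n : ℕ}
    (h : 𝒵 → (Fin n → 𝒵) → ℝ) : ℝ :=
  variance ((iidLaw P n)[fun ω => h (testPoint ω) (trainSet ω) |
    MeasurableSpace.comap testPoint inferInstance]) (iidLaw P n)

/-- The relative loss stability `r(h) = n γ(h) / σ²(h)`. -/
def relLossStability {𝒵 : Type*} [MeasurableSpace 𝒵] (P : Measure 𝒵) {n : ℕ}
    (h : 𝒵 → (Fin n → 𝒵) → ℝ) : ℝ :=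
  n * lossStability P h / lossVariance P h

/-- The relative loss stability condition `r(hₙ) = o(1)` for a sequence of losses. -/
def RelLossStabilityCondition {𝒵 : Type*} [MeasurableSpace 𝒵] (P : Measure 𝒵)
    (h : (n : ℕ) → 𝒵 → (Fin n → 𝒵) → ℝ) : Prop :=
  (fun n => relLossStability P (h n)) =o[atTop] (fun _ => (1 : ℝ))

/-! The Gaussian linear model and soft-thresholded least squares. -/

/-- A data point `(x, y) ∈ ℝᵖ × ℝ`. -/
abbrev DataPoint (p : ℕ) : Type := (Fin p → ℝ) × ℝ

/-- The law of `(X, Y)` where `X ∼ N(0, I)` on `ℝᵖ` (independent standard normal coordinates),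
`ε ∼ N(0, τ²)` is independent of `X`, and `Y = Xᵀ β + ε`. -/
def linearModelLaw {p : ℕ} (β : Fin p → ℝ) (τ : ℝ) : Measure (DataPoint p) :=
  ((Measure.pi fun _ : Fin p => gaussianReal 0 1).prod (gaussianReal 0 (τ ^ 2).toNNReal)).map
    (fun q => (q.1, q.1 ⬝ᵥ β + q.2))

/-- The `n × p` matrix of regressors, with rows `X₁, …, Xₙ`. -/
def designMatrix {p n : ℕ} (z : Fin n → DataPoint p) : Matrix (Fin n) (Fin p) ℝ :=
  Matrix.of fun i => (z i).1

/-- The vector of responses. -/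
def responses {p n : ℕ} (z : Fin n → DataPoint p) : Fin n → ℝ := fun i => (z i).2

/-- Ordinary least squares, `(Xᵀ X)⁻¹ Xᵀ Y`. -/
def olsEstimator {p n : ℕ} (z : Fin n → DataPoint p) : Fin p → ℝ :=
  ((designMatrix z)ᵀ * designMatrix z)⁻¹ *ᵥ ((designMatrix z)ᵀ *ᵥ responses z)

/-- The soft-thresholding estimator `ST(l)`:
its `i`-th coordinate is `sign(b i) (|b i| - l / n)₊` with `b` the OLS estimator. -/
def stEstimator {p n : ℕ} (l : ℝ) (z : Fin n → DataPoint p) : Fin p → ℝ :=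
  fun i => Real.sign (olsEstimator z i) * max (|olsEstimator z i| - l / n) 0

/-- The squared error loss of the linear prediction rule with parameter `b`. -/
def sqLoss {p : ℕ} (b : Fin p → ℝ) (z₀ : DataPoint p) : ℝ := (z₀.2 - z₀.1 ⬝ᵥ b) ^ 2

/-- The loss of the comparison of `ST(l₁)` with `ST(l₂)`. -/
def stDiffLoss {p n : ℕ} (l₁ l₂ : ℝ) (z₀ : DataPoint p) (z : Fin n → DataPoint p) : ℝ :=
  sqLoss (stEstimator l₁ z) z₀ - sqLoss (stEstimator l₂ z) z₀

end

/-! ### Gaussian vectors -/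

/-! The loss has finite rank: it is a finite sum `∑ a, φ a Z₀ * ψ a Z`, where the `φ a` are the
monomials `2 y xᵢ` and `xᵢ xⱼ` in the test point and the `ψ a` are increments of the thresholded
estimator and of its products (`sqLoss_sub_sqLoss`). Hence `σ²` is a fixed quadratic form, the
covariance of the `φ a`, evaluated at the means of the `ψ a` (`lossVariance_sum_mul`), and `γ` is
the mean of that form at the change of the `ψ a` when one data point is replaced
(`lossStability_sum_mul`).

For `σ²`, least squares is mean square consistent at rate `1/n`. Given the design, its error is
Gaussian with variance `τ²` times a diagonal entry of `(XᵀX)⁻¹`, and this entry is at most an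
inverse chi-squared variable. So `n/δ` times the mean increment of a coordinate tends to `sign βᵢ`:
for `βᵢ ≠ 0` both thresholds eventually lie far below `|βᵢ|`, and for `βᵢ = 0` the mean vanishes by
symmetry. With `s = sign β`, the limiting combination is `-2 y (x·s) + 2 (x·β)(x·s) = -2 ε (x·s)`,
of variance `4τ²‖s‖² = 4τ²‖β‖₀`.

For `γ`, the part of the variance due to the noise of the test point bounds it below by `4τ²` times
the mean squared change of the increment at a coordinate with `βᵢ = 0`. This change is at least
`|δ|/n` when the coordinate crosses a window of length `|δ|/n` at height `O(1/√n)`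
(`sq_le_sq_softThreshold_sub`). The crossing has probability of order `1/√n` at least: the estimator
on the `n - 1` common points has density of order `√n`, so it falls into the window with probability
of order `1/√n`; given this, the first point pushes it below the window and its replacement pushes
it above, independently and each with probability bounded below
(`exists_le_measure_olsEstimator_replaceFirst`). Thus `γ` is at least of order `n⁻² n^(-1/2)`, while
`σ² = O(n⁻²)`, and `r` is at least of order `√n`. If `β = 0` the limit of `n²σ²/δ²` is `0`, and `σ²
> 0` needs a separate argument (`lossVariance_stDiffLoss_pos_of_zero`). -/

theorem lintegral_inv_sq_rpow_gaussianReal_lt_top :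
    ∫⁻ x, ‖(x ^ 2)⁻¹‖ₑ ^ (1 / 3 : ℝ) ∂(gaussianReal 0 1) < ⊤ := by
  -- The singularity `|x| ^ (-2/m)` at the origin is integrable exactly for `m > 2`; this is the
  -- case `m = 3`.
  have h1 : IntegrableOn (fun x : ℝ => x ^ (-(2 / 3) : ℝ) * Real.exp (-(1 / 2) * x ^ 2))
      (Set.Ioi 0) :=
    integrableOn_rpow_mul_exp_neg_mul_sq (by norm_num) (by norm_num)
  have h2 : Integrable fun x : ℝ => |x| ^ (-(2 / 3) : ℝ) * Real.exp (-(1 / 2) * |x| ^ 2) := by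
    have h1' : IntegrableOn (fun x : ℝ => |x| ^ (-(2 / 3) : ℝ) * Real.exp (-(1 / 2) * |x| ^ 2))
        (Set.Ioi 0) :=
      h1.congr_fun (fun x hx => by simp only [abs_of_pos (Set.mem_Ioi.1 hx)]) measurableSet_Ioi
    have h1'' : IntegrableOn (fun x : ℝ => |x| ^ (-(2 / 3) : ℝ) * Real.exp (-(1 / 2) * |x| ^ 2))
        (Set.Iic 0) := by
      rw [← integrableOn_Ici_iff_integrableOn_Ioi] at h1'
      rw [← (Measure.measurePreserving_neg (volume : Measure ℝ)).integrableOn_comp_preimage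
        (Homeomorph.neg ℝ).measurableEmbedding]
      simpa [Function.comp_def] using h1'
    rw [← integrableOn_univ, ← Set.Iic_union_Ioi (a := (0 : ℝ))]
    exact h1''.union h1'
  have h3 := h2.const_mul (√(2 * Real.pi))⁻¹
  rw [gaussianReal_of_var_ne_zero _ one_ne_zero,
    lintegral_withDensity_eq_lintegral_mul _ (measurable_gaussianPDF _ _) (by fun_prop)]
  refine lt_of_le_of_lt (lintegral_mono fun x => ?_) h3.hasFiniteIntegral
  have h4 : ((x ^ 2)⁻¹ : ℝ) ^ (1 / 3 : ℝ) = |x| ^ (-(2 / 3) : ℝ) := by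
    rw [← sq_abs, ← Real.rpow_natCast, ← Real.rpow_neg (abs_nonneg x),
      ← Real.rpow_mul (abs_nonneg x)]
    norm_num
  have h5 : ‖(x ^ 2)⁻¹‖ₑ ^ (1 / 3 : ℝ) = ENNReal.ofReal (|x| ^ (-(2 / 3) : ℝ)) := by
    rw [Real.enorm_of_nonneg (by positivity), ENNReal.ofReal_rpow_of_nonneg (by positivity)
      (by norm_num), h4]
  rw [Pi.mul_apply, h5, gaussianPDF, ← ENNReal.ofReal_mul (gaussianPDFReal_nonneg _ _ _),
    Real.enorm_of_nonneg (by positivity)]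
  refine ENNReal.ofReal_le_ofReal (le_of_eq ?_)
  rw [gaussianPDFReal]
  simp only [NNReal.coe_one, mul_one, sub_zero, sq_abs]
  rw [show -(x ^ 2) / 2 = -(1 / 2) * x ^ 2 by ring]
  ring

/-- AM-GM for the squares, inverted. The bound is a product over the coordinates, so independence
factors its expectation and no chi-squared density is needed. -/
theorem inv_sum_sq_le_prod {ι : Type*} [Fintype ι] [Nonempty ι] (x : ι → ℝ) (hx : ∀ i, x i ≠ 0) :
    ENNReal.ofReal (∑ i, x i ^ 2)⁻¹ ≤
      (Fintype.card ι : ENNReal)⁻¹ * ∏ i, ‖(x i ^ 2)⁻¹‖ₑ ^ (1 / (Fintype.card ι : ℝ)) := by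
  have hm : (0 : ℝ) < Fintype.card ι := by exact_mod_cast Fintype.card_pos
  have hx2 : ∀ i, 0 < x i ^ 2 := fun i => by have := hx i; positivity
  have h := Real.geom_mean_le_arith_mean Finset.univ (fun _ => (1 : ℝ)) (fun i => x i ^ 2)
    (by simp) (by simpa using Fintype.card_pos) (fun i _ => (hx2 i).le)
  simp only [Real.rpow_one, Finset.sum_const, Finset.card_univ, nsmul_eq_mul, mul_one,
    one_mul] at h
  have hP : 0 < (∏ i, x i ^ 2) ^ ((Fintype.card ι : ℝ)⁻¹) :=
    Real.rpow_pos_of_pos (Finset.prod_pos fun i _ => hx2 i) _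
  have h2 : (∑ i, x i ^ 2)⁻¹ ≤
      (Fintype.card ι : ℝ)⁻¹ * ∏ i, ((x i ^ 2)⁻¹) ^ (1 / (Fintype.card ι : ℝ)) := by
    rw [Real.finsetProd_rpow _ _ (fun i _ => (inv_pos.2 (hx2 i)).le), Finset.prod_inv_distrib,
      Real.inv_rpow (Finset.prod_nonneg fun i _ => (hx2 i).le), ← mul_inv, one_div]
    refine inv_anti₀ (by positivity) ?_
    rw [le_div_iff₀ hm] at h
    linarith
  have h3 : ∀ i, ‖(x i ^ 2)⁻¹‖ₑ ^ (1 / (Fintype.card ι : ℝ)) =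
      ENNReal.ofReal (((x i ^ 2)⁻¹) ^ (1 / (Fintype.card ι : ℝ))) := fun i => by
    rw [Real.enorm_of_nonneg (inv_pos.2 (hx2 i)).le,
      ENNReal.ofReal_rpow_of_nonneg (inv_pos.2 (hx2 i)).le (by positivity)]
  simp_rw [h3]
  rw [← ENNReal.ofReal_prod_of_nonneg (fun i _ => by have := hx2 i; positivity),
    show (Fintype.card ι : ENNReal)⁻¹ = ENNReal.ofReal (Fintype.card ι : ℝ)⁻¹ by
      rw [ENNReal.ofReal_inv_of_pos hm, ENNReal.ofReal_natCast],
    ← ENNReal.ofReal_mul (by positivity)]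
  exact ENNReal.ofReal_le_ofReal h2

/-- The inverse of a chi-squared variable with `m ≥ 3` degrees of freedom has mean `O(1 / m)`. -/
theorem lintegral_inv_sum_sq_le {Ω ι : Type*} [MeasurableSpace Ω] {P : Measure Ω} [Fintype ι]
    (hι : 3 ≤ Fintype.card ι) {X : ι → Ω → ℝ} (hX : ∀ i, Measurable (X i))
    (hind : iIndepFun X P) (hlaw : ∀ i, P.map (X i) = gaussianReal 0 1) :
    ∫⁻ ω, ENNReal.ofReal (∑ i, X i ω ^ 2)⁻¹ ∂P ≤
      (∫⁻ x, ‖(x ^ 2)⁻¹‖ₑ ^ (1 / 3 : ℝ) ∂(gaussianReal 0 1)) ^ 3 / Fintype.card ι := by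
  have : Nonempty ι := Fintype.card_pos_iff.1 (by omega)
  have hm : (0 : ℝ) < Fintype.card ι := by exact_mod_cast Fintype.card_pos
  have := nullSingletonClass_gaussianReal (μ := 0) (one_ne_zero : (1 : NNReal) ≠ 0)
  have hne : ∀ᵐ ω ∂P, ∀ i, X i ω ≠ 0 := by
    rw [ae_all_iff]
    intro i
    have h : ∀ᵐ x ∂(P.map (X i)), x ≠ 0 := by
      rw [hlaw i]
      exact compl_mem_ae_iff.2 (measure_singleton 0)
    exact ae_of_ae_map (hX i).aemeasurable h
  have hle : ∫⁻ ω, ENNReal.ofReal (∑ i, X i ω ^ 2)⁻¹ ∂P ≤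
      ∫⁻ ω, (Fintype.card ι : ENNReal)⁻¹ *
        ∏ i, ‖(X i ω ^ 2)⁻¹‖ₑ ^ (1 / (Fintype.card ι : ℝ)) ∂P := by
    refine lintegral_mono_ae ?_
    filter_upwards [hne] with ω hω
    exact inv_sum_sq_le_prod _ hω
  refine hle.trans ?_
  have hmeas : Measurable fun x : ℝ => ‖(x ^ 2)⁻¹‖ₑ ^ (1 / (Fintype.card ι : ℝ)) := by fun_prop
  have hmeas2 : ∀ i, Measurable fun ω => ‖(X i ω ^ 2)⁻¹‖ₑ ^ (1 / (Fintype.card ι : ℝ)) :=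
    fun i => hmeas.comp (hX i)
  rw [lintegral_const_mul _ (Finset.measurable_fun_prod _ fun i _ => hmeas2 i),
    lintegral_prod_eq_prod_lintegral_of_indepFun Finset.univ
      (fun i ω => ‖(X i ω ^ 2)⁻¹‖ₑ ^ (1 / (Fintype.card ι : ℝ)))
      (hind.comp (fun _ x => ‖(x ^ 2)⁻¹‖ₑ ^ (1 / (Fintype.card ι : ℝ))) fun _ => hmeas)
      hmeas2]
  have h1 : ∀ i, ∫⁻ ω, ‖(X i ω ^ 2)⁻¹‖ₑ ^ (1 / (Fintype.card ι : ℝ)) ∂P =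
      ∫⁻ x, ‖(x ^ 2)⁻¹‖ₑ ^ (1 / (Fintype.card ι : ℝ)) ∂(gaussianReal 0 1) := fun i => by
    rw [← hlaw i, lintegral_map hmeas (hX i)]
  simp_rw [h1]
  rw [Finset.prod_const, Finset.card_univ, mul_comm, ← ENNReal.div_eq_inv_mul.trans (mul_comm _ _)]
  refine ENNReal.div_le_div_right ?_ _
  -- With `m` coordinates the product of the integrals is the `L^(1/m)` norm of `x⁻²`. Under a
  -- probability measure this norm decreases in `m`, so the case `m = 3` bounds all of them.
  have h2 := eLpNorm'_le_eLpNorm'_of_exponent_le (f := fun x : ℝ => (x ^ 2)⁻¹)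
    (p := 1 / (Fintype.card ι : ℝ)) (q := 1 / 3) (by positivity)
    (one_div_le_one_div_of_le (by norm_num) (by exact_mod_cast hι)) (gaussianReal 0 1)
    (by fun_prop)
  rw [eLpNorm', eLpNorm', one_div_one_div, one_div_one_div, ENNReal.rpow_natCast] at h2
  refine h2.trans (le_of_eq ?_)
  rw [← ENNReal.rpow_natCast]
  norm_num

/-- The law of a linear form in independent centered Gaussians. -/
theorem map_sum_mul_pi_gaussianReal {ι : Type*} [Fintype ι] (c : ι → ℝ) (v : NNReal) :
    (Measure.pi fun _ : ι => gaussianReal 0 v).map (fun x => ∑ k, c k * x k) =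
      gaussianReal 0 (v * ∑ k, (c k ^ 2).toNNReal) := by
  have hg : HasGaussianLaw (fun x : ι → ℝ => ∑ k, c k * x k)
      (Measure.pi fun _ : ι => gaussianReal 0 v) := by
    refine iIndepFun.hasGaussianLaw_fun_sum (X := fun k (x : ι → ℝ) => c k * x k) (fun k => ?_)
      (iIndepFun_pi (X := fun k (x : ℝ) => c k * x) fun k => by fun_prop)
    have : HasLaw (fun x : ι → ℝ => x k) (gaussianReal 0 v)
        (Measure.pi fun _ : ι => gaussianReal 0 v) :=
      ⟨(measurable_pi_apply k).aemeasurable, (measurePreserving_eval (fun _ : ι => gaussianReal 0 v) k).map_eq⟩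
    exact this.hasGaussianLaw.fun_smul (c k)
  rw [hg.map_eq_gaussianReal]
  congr 1
  · rw [integral_finsetSum]
    · simp_rw [integral_const_mul]
      refine Finset.sum_eq_zero fun k _ => ?_
      rw [integral_comp_eval (μ := fun _ : ι => gaussianReal 0 v) (i := k) (f := fun x => x)
        (by fun_prop), integral_id_gaussianReal, mul_zero]
    · intro k _
      exact (integrable_comp_eval (μ := fun _ : ι => gaussianReal 0 v) (i := k) (f := fun x => x)
        ((memLp_id_gaussianReal 1).integrable (by norm_num))).const_mul _
  · have h := variance_sum_pi (μ := fun _ : ι => gaussianReal 0 v) (X := fun k x => c k * x)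
      fun k => (memLp_id_gaussianReal 2).const_mul (c k)
    have h2 : (fun x : ι → ℝ => ∑ k, c k * x k) = ∑ k, fun x : ι → ℝ => c k * x k := by
      ext x; simp
    rw [h2, h]
    have hv : ∀ k, Var[fun x => c k * x; gaussianReal 0 v] = c k ^ 2 * v := fun k => by
      rw [variance_const_mul, variance_fun_id_gaussianReal]
    simp_rw [hv]
    rw [← Finset.sum_mul, Real.toNNReal_mul (Finset.sum_nonneg fun k _ => sq_nonneg _),
      Real.toNNReal_sum_of_nonneg (fun k _ => sq_nonneg _), mul_comm]
    simp

/-- Coordinates of a standard Gaussian vector along an orthonormal family are independent. -/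
theorem iIndepFun_inner_stdGaussian {E ι : Type*} [NormedAddCommGroup E] [InnerProductSpace ℝ E]
    [FiniteDimensional ℝ E] [MeasurableSpace E] [BorelSpace E] [Fintype ι] {e : ι → E}
    (he : Orthonormal ℝ e) : iIndepFun (fun k (x : E) => inner ℝ (e k) x) (stdGaussian E) := by
  refine HasGaussianLaw.iIndepFun_of_covariance_eq_zero ?_ fun i j hij => ?_
  · exact (IsGaussian.hasGaussianLaw_id (μ := stdGaussian E)).map_fun
      (ContinuousLinearMap.pi fun k => innerSL ℝ (e k))
  · have h := covarianceBilin_apply (μ := stdGaussian E) IsGaussian.memLp_two_id (e i) (e j)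
    rw [covarianceBilin_stdGaussian] at h
    simp only [id, integral_id_stdGaussian, sub_zero] at h
    have hm : ∀ k, ∫ x, inner ℝ (e k) x ∂(stdGaussian E) = 0 := fun k => by
      simpa using integral_strongDual_stdGaussian (innerSL ℝ (e k))
    rw [covariance, hm, hm]
    simp only [sub_zero]
    rw [← h]
    rw [innerSL_apply_apply]
    exact he.2 hij

theorem map_inner_stdGaussian {E : Type*} [NormedAddCommGroup E] [InnerProductSpace ℝ E]
    [FiniteDimensional ℝ E] [MeasurableSpace E] [BorelSpace E] {e : E} (he : ‖e‖ = 1) :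
    (stdGaussian E).map (fun x => inner ℝ e x) = gaussianReal 0 1 := by
  have hg := (IsGaussian.hasGaussianLaw_id (μ := stdGaussian E)).map_fun (innerSL ℝ e)
  have h := hg.map_eq_gaussianReal
  simp only [id, integral_strongDual_stdGaussian] at h
  have h2 : (fun ω => (innerSL ℝ e) ω) = ⇑(innerSL ℝ e) := rfl
  rw [h2, variance_dual_stdGaussian, innerSL_apply_norm, he] at h
  simpa using h

/-- A square matrix with independent standard Gaussian entries is almost surely invertible. -/
theorem ae_det_ne_zero_pi_gaussianReal (p : ℕ) :
    ∀ᵐ X : Fin p → Fin p → ℝ ∂(Measure.pi fun _ => Measure.pi fun _ => gaussianReal 0 1),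
      (Matrix.of X).det ≠ 0 := by
  induction p with
  | zero => simp
  | succ p ih =>
    have hmp := measurePreserving_piFinSuccAbove
      (fun _ : Fin (p + 1) => Measure.pi fun _ : Fin (p + 1) => gaussianReal 0 1) 0
    have htail : MeasurePreserving (fun (Y : Fin p → Fin (p + 1) → ℝ) i j => Y i (Fin.succ j))
        (Measure.pi fun _ => Measure.pi fun _ => gaussianReal 0 1)
        (Measure.pi fun _ => Measure.pi fun _ => gaussianReal 0 1) := by
      have h1 : MeasurePreserving (fun (r : Fin (p + 1) → ℝ) (j : Fin p) => r j.succ)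
          (Measure.pi fun _ => gaussianReal 0 1) (Measure.pi fun _ => gaussianReal 0 1) :=
        measurePreserving_snd.comp
          (measurePreserving_piFinSuccAbove (α := fun _ => ℝ) (fun _ => gaussianReal 0 1) 0)
      exact measurePreserving_pi (fun _ => Measure.pi fun _ => gaussianReal 0 1)
        (fun _ => Measure.pi fun _ => gaussianReal 0 1) fun _ => h1
    have hmeas : MeasurableSet {q : (Fin (p + 1) → ℝ) × (Fin p → Fin (p + 1) → ℝ) |
        (Matrix.of (Fin.cons q.1 q.2 : Fin (p + 1) → Fin (p + 1) → ℝ)).det ≠ 0} := by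
      have : Measurable fun q : (Fin (p + 1) → ℝ) × (Fin p → Fin (p + 1) → ℝ) =>
          (Matrix.of (Fin.cons q.1 q.2 : Fin (p + 1) → Fin (p + 1) → ℝ)).det := by
        simp_rw [Matrix.det_apply]
        refine Finset.measurable_sum _ fun σ _ => Measurable.const_smul
          (Finset.measurable_prod _ fun i _ => ?_) _
        refine Fin.cases ?_ (fun k => ?_) (σ i) <;> simp <;> fun_prop
      exact (this (measurableSet_singleton 0)).compl
    have hcm : ∀ c : Fin (p + 1) → ℝ, Measurable fun x : Fin (p + 1) → ℝ => ∑ k, c k * x k :=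
      fun c => by fun_prop
    have key : ∀ᵐ q : (Fin (p + 1) → ℝ) × (Fin p → Fin (p + 1) → ℝ)
        ∂((Measure.pi fun _ => gaussianReal 0 1).prod
          (Measure.pi fun _ => Measure.pi fun _ => gaussianReal 0 1)),
        (Matrix.of (Fin.cons q.1 q.2 : Fin (p + 1) → Fin (p + 1) → ℝ)).det ≠ 0 := by
      rw [Measure.ae_prod_iff_ae_ae hmeas]
      refine (Measure.ae_ae_comm hmeas).2 ?_
      filter_upwards [htail.quasiMeasurePreserving.ae ih] with Y hY
      -- The cofactors of the first row: given the other rows, the determinant is a linear form in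
      -- the first row. Its leading coefficient is a smaller Gaussian determinant, nonzero by
      -- induction, so the form has a nondegenerate Gaussian law, which has no atom at `0`.
      set c : Fin (p + 1) → ℝ := fun j =>
        (-1) ^ (j : ℕ) * (Matrix.of fun i k => Y i (j.succAbove k)).det with hc
      have hc0 : c 0 ≠ 0 := by simpa [hc, Fin.succAbove_zero] using hY
      have hlaw := map_sum_mul_pi_gaussianReal c 1
      have hvar : (1 : NNReal) * ∑ k, (c k ^ 2).toNNReal ≠ 0 := by
        rw [one_mul]
        refine (Finset.sum_pos' (fun _ _ => zero_le) ⟨0, Finset.mem_univ _, ?_⟩).ne'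
        exact Real.toNNReal_pos.2 (by positivity)
      have := nullSingletonClass_gaussianReal (μ := 0) hvar
      have h0 : ∀ᵐ x ∂((Measure.pi fun _ : Fin (p + 1) => gaussianReal 0 1).map
          (fun x => ∑ k, c k * x k)), x ≠ 0 := by
        rw [hlaw]
        exact compl_mem_ae_iff.2 (measure_singleton 0)
      filter_upwards [ae_of_ae_map (hcm c).aemeasurable h0] with x hx
      rw [Matrix.det_succ_row_zero]
      convert hx using 1
      refine Finset.sum_congr rfl fun j _ => ?_
      simp only [hc, Matrix.of_apply, Fin.cons_zero]
      rw [show (Matrix.of (Fin.cons x Y : Fin (p + 1) → Fin (p + 1) → ℝ)).submatrix Fin.succ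
        j.succAbove = Matrix.of fun i k => Y i (j.succAbove k) by ext i k; simp]
      ring
    filter_upwards [hmp.quasiMeasurePreserving.ae key] with X hX
    convert hX using 3
    exact congrArg Matrix.of (Fin.cons_self_tail X).symm

noncomputable section

/-! ### Gram matrices of Gaussian designs -/

/-- The Gram matrix `Xᵀ X` of a design matrix with rows `X k`. -/
def designGram {n p : ℕ} (X : Fin n → Fin p → ℝ) : Matrix (Fin p) (Fin p) ℝ :=
  (Matrix.of X)ᵀ * Matrix.of X

/-- The matrix `(Xᵀ X)⁻¹ Xᵀ` that maps the responses to the least squares estimator. -/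
def olsMap {n p : ℕ} (X : Fin n → Fin p → ℝ) : Matrix (Fin p) (Fin n) ℝ :=
  (designGram X)⁻¹ * (Matrix.of X)ᵀ

/-- The law of a design with independent standard Gaussian entries. -/
abbrev gaussianDesign (n p : ℕ) : Measure (Fin n → Fin p → ℝ) :=
  Measure.pi fun _ => Measure.pi fun _ => gaussianReal 0 1

section LinearAlgebra

variable {n p : ℕ} (X : Fin n → Fin p → ℝ)

theorem designGram_apply (i j : Fin p) : designGram X i j = ∑ k, X k i * X k j := by
  simp [designGram, Matrix.mul_apply]

theorem designGram_transpose : (designGram X)ᵀ = designGram X := by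
  simp [designGram, Matrix.transpose_mul]

theorem dotProduct_designGram_mulVec (u v : Fin p → ℝ) :
    u ⬝ᵥ designGram X *ᵥ v = (Matrix.of X *ᵥ u) ⬝ᵥ (Matrix.of X *ᵥ v) := by
  rw [designGram, ← Matrix.mulVec_mulVec, Matrix.dotProduct_mulVec, Matrix.vecMul_transpose]

theorem designGram_inv_transpose : ((designGram X)⁻¹)ᵀ = (designGram X)⁻¹ := by
  rw [Matrix.transpose_nonsing_inv, designGram_transpose]

/-- Up to the factor `τ²` this is the covariance of least squares given the design. It also holds
for a singular Gram matrix, whose `⁻¹` is `0`. -/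
theorem olsMap_mul_transpose : olsMap X * (olsMap X)ᵀ = (designGram X)⁻¹ := by
  rw [olsMap, Matrix.transpose_mul, Matrix.transpose_transpose, designGram_inv_transpose,
    ← Matrix.mul_assoc, Matrix.mul_assoc _ _ (Matrix.of X)]
  by_cases h : IsUnit (designGram X).det
  · rw [← designGram, Matrix.nonsing_inv_mul _ h, Matrix.one_mul]
  · rw [Matrix.nonsing_inv_apply_not_isUnit _ h, Matrix.mul_zero]

theorem sum_sq_olsMap (i : Fin p) : ∑ k, olsMap X i k ^ 2 = (designGram X)⁻¹ i i := by
  rw [← olsMap_mul_transpose, Matrix.mul_apply]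
  simp [sq]

theorem designGram_inv_diag_nonneg (i : Fin p) : 0 ≤ (designGram X)⁻¹ i i := by
  rw [← sum_sq_olsMap]
  positivity

theorem inv_mulVec_single_apply (i j : Fin p) :
    ((designGram X)⁻¹ *ᵥ Pi.single i 1) j = (designGram X)⁻¹ j i := by
  simp

/-- For `v` the `i`-th column of the inverse Gram matrix, `X v` has squared length `v i`, and a
vector orthogonal to the other columns of `X` sees only the term `v i • Xᵢ` of it. Bessel's
inequality for `X v` gives the claim after division by `v i`. -/
theorem designGram_inv_diag_mul_le_one {κ : Type*} [Fintype κ] (i : Fin p)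
    {e : κ → EuclideanSpace ℝ (Fin n)} (he : Orthonormal ℝ e)
    (hX : ∀ k, ∀ j, j ≠ i → inner ℝ (e k) (WithLp.toLp 2 fun l => X l j) = 0) :
    (designGram X)⁻¹ i i * ∑ k, inner ℝ (e k) (WithLp.toLp 2 fun l => X l i) ^ 2 ≤ 1 := by
  by_cases hdet : IsUnit (designGram X).det
  · set v := (designGram X)⁻¹ *ᵥ Pi.single i 1 with hv
    have hvi : v i = (designGram X)⁻¹ i i := inv_mulVec_single_apply X i i
    have hGv : designGram X *ᵥ v = Pi.single i 1 := by
      rw [hv, Matrix.mulVec_mulVec, Matrix.mul_nonsing_inv _ hdet, Matrix.one_mulVec]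
    have hnorm : (Matrix.of X *ᵥ v) ⬝ᵥ (Matrix.of X *ᵥ v) = v i := by
      rw [← dotProduct_designGram_mulVec, hGv]
      simp
    have hw : WithLp.toLp 2 (Matrix.of X *ᵥ v) =
        ∑ j, v j • (WithLp.toLp 2 fun l => X l j : EuclideanSpace ℝ (Fin n)) := by
      ext l
      simp [Matrix.mulVec, dotProduct, mul_comm]
    have hin : ∀ k, inner ℝ (e k) (WithLp.toLp 2 (Matrix.of X *ᵥ v)) =
        v i * inner ℝ (e k) (WithLp.toLp 2 fun l => X l i) := fun k => by
      rw [hw, inner_sum, Finset.sum_eq_single i]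
      · rw [real_inner_smul_right]
      · intro j _ hj
        rw [real_inner_smul_right, hX k j hj, mul_zero]
      · simp
    have hB := he.sum_inner_products_le (s := Finset.univ)
      (WithLp.toLp 2 (Matrix.of X *ᵥ v))
    simp_rw [hin] at hB
    rw [EuclideanSpace.norm_sq_eq] at hB
    have hB' : v i ^ 2 * ∑ k, inner ℝ (e k) (WithLp.toLp 2 fun l => X l i) ^ 2 ≤ v i := by
      have h1 : ∑ l, ‖(WithLp.toLp 2 (Matrix.of X *ᵥ v) : EuclideanSpace ℝ (Fin n)) l‖ ^ 2 =
          v i := by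
        rw [← hnorm, dotProduct]
        exact Finset.sum_congr rfl fun l _ => by rw [Real.norm_eq_abs, sq_abs, sq]
      rw [h1] at hB
      rw [Finset.mul_sum]
      refine le_trans (le_of_eq (Finset.sum_congr rfl fun k _ => ?_)) hB
      rw [Real.norm_eq_abs, sq_abs, mul_pow]
    rw [← hvi]
    have h0 : 0 ≤ v i := hvi ▸ designGram_inv_diag_nonneg X i
    rcases h0.eq_or_lt with h | h
    · rw [← h]; simp
    · refine le_of_mul_le_mul_left ?_ h
      linarith
  · rw [Matrix.nonsing_inv_apply_not_isUnit _ hdet]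
    simp

/-- Cauchy-Schwarz for `X eᵢ` and `X G⁻¹ eᵢ`, whose inner product is `1`. It bounds the variance of
a least squares coordinate from below. -/
theorem one_le_designGram_diag_mul_inv_diag (hdet : (designGram X).det ≠ 0) (i : Fin p) :
    1 ≤ designGram X i i * (designGram X)⁻¹ i i := by
  have h1 : (designGram X * (designGram X)⁻¹) i i = 1 := by
    rw [Matrix.mul_nonsing_inv _ hdet.isUnit, Matrix.one_apply_eq]
  have h2 : (Matrix.of X *ᵥ Pi.single i 1) ⬝ᵥ
      (Matrix.of X *ᵥ ((designGram X)⁻¹ *ᵥ Pi.single i 1)) = 1 := by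
    rw [← dotProduct_designGram_mulVec, Matrix.mulVec_mulVec, Matrix.mul_nonsing_inv _ hdet.isUnit]
    simp
  have h3 : (Matrix.of X *ᵥ Pi.single i 1) ⬝ᵥ (Matrix.of X *ᵥ Pi.single i 1) =
      designGram X i i := by
    rw [← dotProduct_designGram_mulVec]; simp
  have h4 : (Matrix.of X *ᵥ ((designGram X)⁻¹ *ᵥ Pi.single i 1)) ⬝ᵥ
      (Matrix.of X *ᵥ ((designGram X)⁻¹ *ᵥ Pi.single i 1)) = (designGram X)⁻¹ i i := by
    rw [← dotProduct_designGram_mulVec, Matrix.mulVec_mulVec (v := Pi.single i (1 : ℝ)),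
      Matrix.mul_nonsing_inv _ hdet.isUnit, Matrix.one_mulVec, dotProduct_single, mul_one,
      inv_mulVec_single_apply]
  have h5 := Finset.sum_mul_sq_le_sq_mul_sq Finset.univ (Matrix.of X *ᵥ Pi.single i 1)
    (Matrix.of X *ᵥ ((designGram X)⁻¹ *ᵥ Pi.single i 1))
  simp only [dotProduct] at h2 h3 h4
  simp only [sq] at h5
  rw [h2, h3, h4] at h5
  simpa using h5

theorem dotProduct_inv_mulVec_nonneg (x : Fin p → ℝ) : 0 ≤ x ⬝ᵥ (designGram X)⁻¹ *ᵥ x := by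
  rw [← olsMap_mul_transpose, ← Matrix.mulVec_mulVec, Matrix.dotProduct_mulVec,
    ← Matrix.mulVec_transpose]
  exact Finset.sum_nonneg fun k _ => mul_self_nonneg _

/-- The form is the squared length of `(olsMap X)ᵀ x`; Cauchy-Schwarz in each component leaves the
trace. It controls the denominator in the recursive least squares update. -/
theorem dotProduct_inv_mulVec_le (x : Fin p → ℝ) :
    x ⬝ᵥ (designGram X)⁻¹ *ᵥ x ≤ (∑ i, x i ^ 2) * ∑ i, (designGram X)⁻¹ i i := by
  have h : x ⬝ᵥ (designGram X)⁻¹ *ᵥ x = ∑ k, (∑ i, x i * olsMap X i k) ^ 2 := by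
    rw [← olsMap_mul_transpose, ← Matrix.mulVec_mulVec, Matrix.dotProduct_mulVec,
      ← Matrix.mulVec_transpose]
    simp [dotProduct, Matrix.mulVec, sq, mul_comm]
  rw [h]
  simp_rw [← sum_sq_olsMap]
  rw [Finset.sum_comm, Finset.mul_sum]
  exact Finset.sum_le_sum fun k _ => Finset.sum_mul_sq_le_sq_mul_sq _ _ _

theorem mulVec_eq_zero_of_designGram_mulVec_eq_zero {v : Fin p → ℝ} (h : designGram X *ᵥ v = 0) :
    Matrix.of X *ᵥ v = 0 := by
  have h1 := dotProduct_designGram_mulVec X v v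
  rw [h, dotProduct_zero] at h1
  exact dotProduct_self_eq_zero.1 h1.symm

end LinearAlgebra

/-! ### Measurability, resampling of a column, and moments of the inverse Gram matrix. -/

theorem measurable_matrix_det {α ι : Type*} [MeasurableSpace α] [Fintype ι] [DecidableEq ι]
    {M : α → Matrix ι ι ℝ} (hM : ∀ i j, Measurable fun a => M a i j) :
    Measurable fun a => (M a).det := by
  simp_rw [Matrix.det_apply]
  exact Finset.measurable_fun_sum _ fun σ _ => Measurable.const_smul
    (Finset.measurable_fun_prod _ fun i _ => hM _ _) _

theorem measurable_matrix_inv_apply {α ι : Type*} [MeasurableSpace α] [Fintype ι] [DecidableEq ι]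
    {M : α → Matrix ι ι ℝ} (hM : ∀ i j, Measurable fun a => M a i j) (i j : ι) :
    Measurable fun a => (M a)⁻¹ i j := by
  simp_rw [Matrix.inv_def, Ring.inverse_eq_inv', Matrix.smul_apply, Matrix.adjugate_apply,
    smul_eq_mul]
  refine (measurable_matrix_det hM).inv.mul (measurable_matrix_det fun k l => ?_)
  by_cases hk : k = j
  · subst hk; simp
  · simp [Matrix.updateRow_ne hk, hM]

theorem measurable_designGram_apply {n p : ℕ} (i j : Fin p) :
    Measurable fun X : Fin n → Fin p → ℝ => designGram X i j := by
  simp_rw [designGram_apply]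
  fun_prop

theorem measurable_designGram_inv_apply {n p : ℕ} (i j : Fin p) :
    Measurable fun X : Fin n → Fin p → ℝ => (designGram X)⁻¹ i j :=
  measurable_matrix_inv_apply measurable_designGram_apply i j

theorem measurable_olsMap_apply {n p : ℕ} (i : Fin p) (k : Fin n) :
    Measurable fun X : Fin n → Fin p → ℝ => olsMap X i k := by
  simp_rw [olsMap, Matrix.mul_apply]
  refine Finset.measurable_fun_sum _ fun j _ => (measurable_designGram_inv_apply i j).mul ?_
  simp only [Matrix.transpose_apply, Matrix.of_apply]
  fun_prop

/-- Resampling a coordinate of a vector with independent coordinates preserves its law. -/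
theorem measurePreserving_update_pi {ι α : Type*} [Fintype ι] [DecidableEq ι] [MeasurableSpace α]
    (μ : Measure α) [IsProbabilityMeasure μ] (i : ι) :
    MeasurePreserving (fun q : α × (ι → α) => Function.update q.2 i q.1)
      (μ.prod (Measure.pi fun _ => μ)) (Measure.pi fun _ => μ) := by
  have hm : Measurable fun q : α × (ι → α) => Function.update q.2 i q.1 := by
    refine measurable_pi_lambda _ fun j => ?_
    by_cases hj : j = i
    · subst hj; simp; fun_prop
    · simp [Function.update_of_ne hj]; fun_prop
  refine ⟨hm, (Measure.pi_eq fun s hs => ?_).symm⟩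
  rw [Measure.map_apply hm (MeasurableSet.univ_pi hs)]
  have : (fun q : α × (ι → α) => Function.update q.2 i q.1) ⁻¹' (Set.univ.pi s) =
      s i ×ˢ Set.univ.pi (fun j => if j = i then Set.univ else s j) := by
    ext ⟨x, f⟩
    simp only [Set.mem_preimage, Set.mem_pi, Set.mem_univ, true_imp_iff, Set.mem_prod]
    constructor
    · intro h
      refine ⟨by simpa using h i, fun j => ?_⟩
      by_cases hj : j = i
      · simp [hj]
      · simpa [hj] using h j
    · rintro ⟨h1, h2⟩ j
      by_cases hj : j = i
      · subst hj; simpa using h1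
      · simpa [hj] using h2 j
  rw [this, Measure.prod_prod, Measure.pi_pi, ← Finset.mul_prod_erase _ _ (Finset.mem_univ i),
    ← Finset.mul_prod_erase Finset.univ (fun j => μ (s j)) (Finset.mem_univ i)]
  simp only [if_true, measure_univ, one_mul]
  congr 1
  refine Finset.prod_congr rfl fun j hj => ?_
  rw [if_neg (Finset.ne_of_mem_erase hj)]

/-- This allows integrating over the `i`-th column first, with the other columns frozen. -/
theorem measurePreserving_update_column (n : ℕ) {p : ℕ} (i : Fin p) :
    MeasurePreserving
      (fun q : (Fin n → ℝ) × (Fin n → Fin p → ℝ) => fun k => Function.update (q.2 k) i (q.1 k))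
      ((Measure.pi fun _ => gaussianReal 0 1).prod (gaussianDesign n p)) (gaussianDesign n p) := by
  have h1 := measurePreserving_arrowProdEquivProdArrow ℝ (Fin p → ℝ) (Fin n)
    (fun _ => gaussianReal 0 1) (fun _ => Measure.pi fun _ => gaussianReal 0 1)
  have h2 := measurePreserving_pi (fun _ : Fin n => (gaussianReal 0 1).prod
      (Measure.pi fun _ : Fin p => gaussianReal 0 1))
    (fun _ => Measure.pi fun _ => gaussianReal 0 1)
    fun _ => measurePreserving_update_pi (gaussianReal 0 1) i
  exact h2.comp h1.symm

/-- The diagonal entries of the inverse Gram matrix of a Gaussian design have mean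
`O(1 / (n - p))`. -/
theorem lintegral_designGram_inv_diag_le {n p : ℕ} (hnp : p + 3 ≤ n) (i : Fin p) :
    ∫⁻ X, ENNReal.ofReal ((designGram X)⁻¹ i i) ∂(gaussianDesign n p) ≤
      (∫⁻ x, ‖(x ^ 2)⁻¹‖ₑ ^ (1 / 3 : ℝ) ∂(gaussianReal 0 1)) ^ 3 / ((n - p : ℕ) : ENNReal) := by
  set A := (∫⁻ x, ‖(x ^ 2)⁻¹‖ₑ ^ (1 / 3 : ℝ) ∂(gaussianReal 0 1)) with hA
  have hmeas : Measurable fun X : Fin n → Fin p → ℝ => ENNReal.ofReal ((designGram X)⁻¹ i i) :=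
    (measurable_designGram_inv_apply i i).ennreal_ofReal
  have hmp := measurePreserving_update_column n i
  have key : ∀ Y : Fin n → Fin p → ℝ, ∫⁻ x, ENNReal.ofReal
      ((designGram fun k => Function.update (Y k) i (x k))⁻¹ i i)
      ∂(Measure.pi fun _ : Fin n => gaussianReal 0 1) ≤ A ^ 3 / ((n - p : ℕ) : ENNReal) := by
    intro Y
    let c : {j : Fin p // j ≠ i} → EuclideanSpace ℝ (Fin n) := fun j => WithLp.toLp 2 fun l => Y l j
    -- The orthogonal complement of the other columns does not depend on the column being
    -- integrated. The coordinates of that column in an orthonormal basis of `K` are at least `n -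
    -- p` independent standard Gaussians.
    let K := (Submodule.span ℝ (Set.range c))ᗮ
    have hK : n - p ≤ Module.finrank ℝ K := by
      have h1 := Submodule.finrank_add_finrank_orthogonal (Submodule.span ℝ (Set.range c))
      have h2 := finrank_range_le_card (R := ℝ) c
      have h3 : Fintype.card {j : Fin p // j ≠ i} ≤ p := by
        simp
      rw [Set.finrank] at h2
      rw [finrank_euclideanSpace_fin] at h1
      change n - p ≤ Module.finrank ℝ (Submodule.span ℝ (Set.range c))ᗮ
      omega
    let e : Fin (Module.finrank ℝ K) → EuclideanSpace ℝ (Fin n) :=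
      fun k => (stdOrthonormalBasis ℝ K k : EuclideanSpace ℝ (Fin n))
    have he : Orthonormal ℝ e := (stdOrthonormalBasis ℝ K).orthonormal.comp_linearIsometry
      K.subtypeₗᵢ
    have hperp : ∀ k, ∀ j, j ≠ i → inner ℝ (e k) (WithLp.toLp 2 fun l => Y l j) = 0 := by
      intro k j hj
      rw [real_inner_comm]
      exact (stdOrthonormalBasis ℝ K k).2 _ (Submodule.subset_span ⟨⟨j, hj⟩, rfl⟩)
    have hL : MeasurePreserving (WithLp.toLp 2 : (Fin n → ℝ) → EuclideanSpace ℝ (Fin n))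
        (Measure.pi fun _ : Fin n => gaussianReal 0 1) (stdGaussian (EuclideanSpace ℝ (Fin n))) :=
      ⟨by fun_prop, map_pi_eq_stdGaussian⟩
    have hF : Measurable fun x : EuclideanSpace ℝ (Fin n) => ENNReal.ofReal
        ((designGram fun k => Function.update (Y k) i (x k))⁻¹ i i) := by
      refine hmeas.comp (measurable_pi_lambda _ fun k => measurable_pi_lambda _ fun j => ?_)
      by_cases hj : j = i
      · subst hj; simp; fun_prop
      · simp [Function.update_of_ne hj]
    refine (hL.lintegral_comp hF).le.trans ?_
    have hind := iIndepFun_inner_stdGaussian he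
    have hlaw := fun k => map_inner_stdGaussian (he.1 k)
    have hne : ∀ᵐ x ∂(stdGaussian (EuclideanSpace ℝ (Fin n))),
        inner ℝ (e ⟨0, by omega⟩) x ≠ 0 := by
      have := nullSingletonClass_gaussianReal (μ := 0) (one_ne_zero : (1 : NNReal) ≠ 0)
      have h0 : ∀ᵐ y ∂((stdGaussian (EuclideanSpace ℝ (Fin n))).map
          fun x => inner ℝ (e ⟨0, by omega⟩) x), y ≠ 0 := by
        rw [hlaw]
        exact compl_mem_ae_iff.2 (measure_singleton 0)
      exact ae_of_ae_map (f := fun x => inner ℝ (e ⟨0, by omega⟩) x) (by fun_prop) h0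
    have hpt : ∀ᵐ x ∂(stdGaussian (EuclideanSpace ℝ (Fin n))), ENNReal.ofReal
        ((designGram fun k => Function.update (Y k) i (x k))⁻¹ i i) ≤
          ENNReal.ofReal (∑ k, inner ℝ (e k) x ^ 2)⁻¹ := by
      filter_upwards [hne] with x hx
      refine ENNReal.ofReal_le_ofReal ?_
      have h := designGram_inv_diag_mul_le_one (fun k => Function.update (Y k) i (x k)) i he
        (fun k j hj => by simpa [hj] using hperp k j hj)
      simp only [Function.update_self] at h
      have hpos : 0 < ∑ k, inner ℝ (e k) x ^ 2 :=
        Finset.sum_pos' (fun _ _ => sq_nonneg _) ⟨_, Finset.mem_univ _, by positivity⟩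
      exact (le_div_iff₀ hpos).2 h |>.trans_eq (one_div _)
    refine (lintegral_mono_ae hpt).trans ((lintegral_inv_sum_sq_le (by simp; omega)
      (fun k => by fun_prop) hind hlaw).trans ?_)
    rw [Fintype.card_fin]
    gcongr
  calc ∫⁻ X, ENNReal.ofReal ((designGram X)⁻¹ i i) ∂(gaussianDesign n p)
      = ∫⁻ q, ENNReal.ofReal ((designGram fun k => Function.update (q.2 k) i (q.1 k))⁻¹ i i)
          ∂((Measure.pi fun _ : Fin n => gaussianReal 0 1).prod (gaussianDesign n p)) :=
        (hmp.lintegral_comp hmeas).symm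
    _ = ∫⁻ Y, ∫⁻ x, ENNReal.ofReal ((designGram fun k => Function.update (Y k) i (x k))⁻¹ i i)
          ∂(Measure.pi fun _ : Fin n => gaussianReal 0 1) ∂(gaussianDesign n p) :=
        lintegral_prod_symm _ (hmeas.comp hmp.measurable).aemeasurable
    _ ≤ ∫⁻ _, A ^ 3 / ((n - p : ℕ) : ENNReal) ∂(gaussianDesign n p) := lintegral_mono key
    _ = A ^ 3 / ((n - p : ℕ) : ENNReal) := by simp

/-- The Gram matrix of a Gaussian design with at least as many rows as columns is almost surely
invertible. -/
theorem ae_designGram_det_ne_zero {n p : ℕ} (hnp : p ≤ n) :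
    ∀ᵐ X ∂(gaussianDesign n p), (designGram X).det ≠ 0 := by
  -- The first `p` rows form a square Gaussian matrix, almost surely invertible; a kernel vector of
  -- the Gram matrix is annihilated by every row, in particular by these.
  have hmp : MeasurePreserving (fun (X : Fin n → Fin p → ℝ) (k : Fin p) => X (Fin.castLE hnp k))
      (gaussianDesign n p) (gaussianDesign p p) := by
    refine ⟨by fun_prop, ?_⟩
    have h1 : iIndepFun (fun (k : Fin n) (X : Fin n → Fin p → ℝ) => X k) (gaussianDesign n p) :=
      iIndepFun_pi (X := fun _ x => x) fun _ => aemeasurable_id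
    have h2 := h1.precomp (Fin.castLE_injective hnp)
    rw [iIndepFun_iff_map_fun_eq_pi_map (fun k => (measurable_pi_apply _).aemeasurable)] at h2
    rw [h2]
    congr 1
    ext1 k
    exact (measurePreserving_eval _ _).map_eq
  filter_upwards [hmp.quasiMeasurePreserving.ae (ae_det_ne_zero_pi_gaussianReal p)] with X hX h0
  obtain ⟨v, hv, hGv⟩ := Matrix.exists_mulVec_eq_zero_iff.2 h0
  refine hX (Matrix.exists_mulVec_eq_zero_iff.1 ⟨v, hv, ?_⟩)
  have h := mulVec_eq_zero_of_designGram_mulVec_eq_zero X hGv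
  ext k
  exact congrFun h (Fin.castLE hnp k)

end

noncomputable section

/-! ### The least squares estimator in the Gaussian linear model -/

section Law

variable {p : ℕ} (β : Fin p → ℝ) (τ : ℝ)

theorem measurePreserving_linearModel :
    MeasurePreserving (fun q : (Fin p → ℝ) × ℝ => ((q.1, q.1 ⬝ᵥ β + q.2) : DataPoint p))
      ((Measure.pi fun _ : Fin p => gaussianReal 0 1).prod (gaussianReal 0 (τ ^ 2).toNNReal))
      (linearModelLaw β τ) :=
  ⟨by simp only [dotProduct]; fun_prop, rfl⟩

instance isProbabilityMeasure_linearModelLaw : IsProbabilityMeasure (linearModelLaw β τ) :=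
  Measure.isProbabilityMeasure_map (measurePreserving_linearModel β τ).aemeasurable

instance sFinite_pi_linearModelLaw {n : ℕ} :
    SFinite (Measure.pi fun _ : Fin n => linearModelLaw β τ) := by
  have key : ∀ (μ : Measure (Fin n → DataPoint p)) [IsProbabilityMeasure μ], SFinite μ :=
    fun μ _ => inferInstance
  exact key _

/-- The training set with regressors `X` and noise `e`. -/
def linearModelData {n p : ℕ} (β : Fin p → ℝ) (q : (Fin n → Fin p → ℝ) × (Fin n → ℝ)) :
    Fin n → DataPoint p :=
  fun k => (q.1 k, q.1 k ⬝ᵥ β + q.2 k)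

theorem measurePreserving_linearModelData (n : ℕ) :
    MeasurePreserving (linearModelData (n := n) β)
      ((gaussianDesign n p).prod (Measure.pi fun _ => gaussianReal 0 (τ ^ 2).toNNReal))
      (Measure.pi fun _ => linearModelLaw β τ) := by
  have h1 := measurePreserving_arrowProdEquivProdArrow (Fin p → ℝ) ℝ (Fin n)
    (fun _ => Measure.pi fun _ => gaussianReal 0 1) (fun _ => gaussianReal 0 (τ ^ 2).toNNReal)
  have h2 := measurePreserving_pi (fun _ : Fin n =>
      (Measure.pi fun _ : Fin p => gaussianReal 0 1).prod (gaussianReal 0 (τ ^ 2).toNNReal))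
    (fun _ => linearModelLaw β τ) fun _ => measurePreserving_linearModel β τ
  exact h2.comp h1.symm

end Law

section Algebra

variable {n p : ℕ}

theorem olsEstimator_eq_olsMap_mulVec (z : Fin n → DataPoint p) :
    olsEstimator z = olsMap (fun k => (z k).1) *ᵥ fun k => (z k).2 := by
  rw [olsEstimator, olsMap, ← Matrix.mulVec_mulVec]
  rfl

theorem olsEstimator_apply (z : Fin n → DataPoint p) (i : Fin p) :
    olsEstimator z i = ∑ k, olsMap (fun k => (z k).1) i k * (z k).2 := by
  rw [olsEstimator_eq_olsMap_mulVec]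
  rfl

theorem measurable_olsEstimator_apply (i : Fin p) :
    Measurable fun z : Fin n → DataPoint p => olsEstimator z i := by
  simp_rw [olsEstimator_apply]
  refine Finset.measurable_fun_sum _ fun k _ => Measurable.mul ?_ (by fun_prop)
  exact (measurable_olsMap_apply i k).comp (by fun_prop)

theorem olsEstimator_eq_of_normal_equation {z : Fin n → DataPoint p}
    (hdet : (designGram fun k => (z k).1).det ≠ 0) {b : Fin p → ℝ}
    (hb : designGram (fun k => (z k).1) *ᵥ b = (designMatrix z)ᵀ *ᵥ responses z) :
    olsEstimator z = b := by
  rw [olsEstimator, ← hb, Matrix.mulVec_mulVec]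
  change ((designGram fun k => (z k).1)⁻¹ * _) *ᵥ b = b
  rw [Matrix.nonsing_inv_mul _ hdet.isUnit, Matrix.one_mulVec]

theorem designGram_mulVec_olsEstimator {z : Fin n → DataPoint p}
    (hdet : (designGram fun k => (z k).1).det ≠ 0) :
    designGram (fun k => (z k).1) *ᵥ olsEstimator z = (designMatrix z)ᵀ *ᵥ responses z := by
  rw [olsEstimator, Matrix.mulVec_mulVec]
  change (_ * (designGram fun k => (z k).1)⁻¹) *ᵥ _ = _
  rw [Matrix.mul_nonsing_inv _ hdet.isUnit, Matrix.one_mulVec]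

theorem olsEstimator_linearModelData (β : Fin p → ℝ) {X : Fin n → Fin p → ℝ}
    (hdet : (designGram X).det ≠ 0) (e : Fin n → ℝ) (i : Fin p) :
    olsEstimator (linearModelData β (X, e)) i - β i = ∑ k, olsMap X i k * e k := by
  rw [sub_eq_iff_eq_add']
  have h : olsEstimator (linearModelData β (X, e)) = β + olsMap X *ᵥ e := by
    rw [olsEstimator_eq_olsMap_mulVec]
    have h1 : (fun k => (linearModelData β (X, e) k).2) = Matrix.of X *ᵥ β + e := rfl
    have h2 : (fun k => (linearModelData β (X, e) k).1) = X := rfl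
    rw [h1, h2, Matrix.mulVec_add, Matrix.mulVec_mulVec, olsMap, Matrix.mul_assoc, ← designGram,
      Matrix.nonsing_inv_mul _ hdet.isUnit, Matrix.one_mulVec]
  rw [h]
  rfl

theorem designGram_cons_mulVec (x : Fin p → ℝ) (X : Fin n → Fin p → ℝ) (u : Fin p → ℝ) :
    designGram (Fin.cons x X : Fin (n + 1) → Fin p → ℝ) *ᵥ u =
      designGram X *ᵥ u + (x ⬝ᵥ u) • x := by
  ext i
  simp only [Matrix.mulVec, dotProduct, designGram_apply, Fin.sum_univ_succ, Fin.cons_zero,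
    Fin.cons_succ, Pi.add_apply, Pi.smul_apply, smul_eq_mul, add_mul, Finset.sum_add_distrib]
  rw [add_comm, Finset.sum_mul]
  congr 1
  exact Finset.sum_congr rfl fun j _ => by ring

theorem designGram_cons_det_ne_zero (x : Fin p → ℝ) {X : Fin n → Fin p → ℝ}
    (hdet : (designGram X).det ≠ 0) :
    (designGram (Fin.cons x X : Fin (n + 1) → Fin p → ℝ)).det ≠ 0 := by
  intro h0
  obtain ⟨v, hv, hGv⟩ := Matrix.exists_mulVec_eq_zero_iff.2 h0
  have h := mulVec_eq_zero_of_designGram_mulVec_eq_zero _ hGv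
  refine hdet (Matrix.exists_mulVec_eq_zero_iff.1 ⟨v, hv, ?_⟩)
  have h2 : Matrix.of X *ᵥ v = 0 := by
    ext k
    exact congrFun h k.succ
  rw [designGram, ← Matrix.mulVec_mulVec, h2, Matrix.mulVec_zero]

/-- The recursive least squares update. -/
theorem olsEstimator_cons (z₀ : DataPoint p) {z : Fin n → DataPoint p}
    (hdet : (designGram fun k => (z k).1).det ≠ 0) (i : Fin p) :
    olsEstimator (Fin.cons z₀ z : Fin (n + 1) → DataPoint p) i = olsEstimator z i +
      ((designGram fun k => (z k).1)⁻¹ *ᵥ z₀.1) i * (z₀.2 - z₀.1 ⬝ᵥ olsEstimator z) /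
        (1 + z₀.1 ⬝ᵥ (designGram fun k => (z k).1)⁻¹ *ᵥ z₀.1) := by
  set X := fun k => (z k).1 with hX
  set q := z₀.1 ⬝ᵥ (designGram X)⁻¹ *ᵥ z₀.1 with hq
  set r := z₀.2 - z₀.1 ⬝ᵥ olsEstimator z with hr
  have hq0 : 0 ≤ q := dotProduct_inv_mulVec_nonneg X z₀.1
  have hcons : (fun k => ((Fin.cons z₀ z : Fin (n + 1) → DataPoint p) k).1) =
      (Fin.cons z₀.1 X : Fin (n + 1) → Fin p → ℝ) := by
    ext k
    refine Fin.cases ?_ (fun k => ?_) k <;> simp [hX]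
  have hresp : (designMatrix (Fin.cons z₀ z : Fin (n + 1) → DataPoint p))ᵀ *ᵥ
      responses (Fin.cons z₀ z : Fin (n + 1) → DataPoint p) =
      (designMatrix z)ᵀ *ᵥ responses z + z₀.2 • z₀.1 := by
    ext j
    simp only [Matrix.mulVec, dotProduct, designMatrix, responses, Matrix.transpose_apply,
      Matrix.of_apply, Fin.sum_univ_succ, Fin.cons_zero, Fin.cons_succ, Pi.add_apply,
      Pi.smul_apply, smul_eq_mul]
    ring
  -- The Sherman-Morrison form is verified rather than derived: the candidate solves the normal
  -- equations of the enlarged data set, and `q ≥ 0` keeps `1 + q` away from zero.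
  have hmain : olsEstimator (Fin.cons z₀ z : Fin (n + 1) → DataPoint p) =
      olsEstimator z + (r / (1 + q)) • ((designGram X)⁻¹ *ᵥ z₀.1) := by
    refine olsEstimator_eq_of_normal_equation ?_ ?_
    · rw [hcons]; exact designGram_cons_det_ne_zero _ hdet
    · rw [hcons, designGram_cons_mulVec, hresp, Matrix.mulVec_add, Matrix.mulVec_smul,
        Matrix.mulVec_mulVec, Matrix.mul_nonsing_inv _ hdet.isUnit, Matrix.one_mulVec,
        designGram_mulVec_olsEstimator hdet, dotProduct_add, dotProduct_smul, ← hq, add_assoc,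
        ← add_smul]
      congr 2
      rw [smul_eq_mul, hr]
      field_simp
      ring
  rw [hmain]
  simp only [Pi.add_apply, Pi.smul_apply, smul_eq_mul]
  ring

end Algebra

/-! ### Mean square error and symmetry of the least squares estimator. -/

section Moments

theorem lintegral_sq_gaussianReal (v : NNReal) :
    ∫⁻ x, ENNReal.ofReal (x ^ 2) ∂(gaussianReal 0 v) = v := by
  have hint : Integrable (fun x : ℝ => x ^ 2) (gaussianReal 0 v) :=
    (memLp_id_gaussianReal 2).integrable_sq
  rw [← ofReal_integral_eq_lintegral_ofReal hint (Eventually.of_forall fun x => sq_nonneg x)]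
  have h := variance_fun_id_gaussianReal (μ := 0) (v := v)
  rw [variance_eq_integral (by fun_prop), integral_id_gaussianReal] at h
  simp only [sub_zero] at h
  rw [h, ENNReal.ofReal_coe_nnreal]

theorem exists_lintegral_designGram_inv_diag_le (p : ℕ) :
    ∃ C : ℝ, 0 < C ∧ ∀ n : ℕ, 2 * p + 3 ≤ n → ∀ i : Fin p,
      ∫⁻ X, ENNReal.ofReal ((designGram X)⁻¹ i i) ∂(gaussianDesign n p) ≤
        ENNReal.ofReal (C / n) := by
  set A := ∫⁻ x, ‖(x ^ 2)⁻¹‖ₑ ^ (1 / 3 : ℝ) ∂(gaussianReal 0 1) with hA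
  have hAt : A ^ 3 ≠ ⊤ := ENNReal.pow_ne_top lintegral_inv_sq_rpow_gaussianReal_lt_top.ne
  -- The factor `2` comes from `n ≤ 2 (n - p)`; the summand `1` only makes the constant positive.
  refine ⟨2 * (A ^ 3).toReal + 1, by positivity, fun n hn i => ?_⟩
  refine (lintegral_designGram_inv_diag_le (by omega) i).trans ?_
  have hnp : (0 : ℝ) < ((n - p : ℕ) : ℝ) := by
    have : 0 < n - p := by omega
    exact_mod_cast this
  have hnp2 : (n : ℝ) ≤ 2 * ((n - p : ℕ) : ℝ) := by
    have : n ≤ 2 * (n - p) := by omega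
    exact_mod_cast this
  have hn0 : (0 : ℝ) < n := by
    have : 0 < n := by omega
    exact_mod_cast this
  rw [← hA, ← ENNReal.ofReal_toReal hAt, ← ENNReal.ofReal_natCast,
    ← ENNReal.ofReal_div_of_pos hnp]
  refine ENNReal.ofReal_le_ofReal ?_
  rw [ENNReal.toReal_ofReal ENNReal.toReal_nonneg, div_le_div_iff₀ hnp hn0]
  have : 0 ≤ (A ^ 3).toReal := ENNReal.toReal_nonneg
  nlinarith

variable {p : ℕ} (β : Fin p → ℝ) (τ : ℝ)

theorem map_olsMap_gaussianReal {n : ℕ} (v : NNReal) (X : Fin n → Fin p → ℝ) (i : Fin p) :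
    (Measure.pi fun _ : Fin n => gaussianReal 0 v).map (fun e => ∑ k, olsMap X i k * e k) =
      gaussianReal 0 (v * ((designGram X)⁻¹ i i).toNNReal) := by
  rw [map_sum_mul_pi_gaussianReal, ← Real.toNNReal_sum_of_nonneg fun k _ => sq_nonneg _,
    sum_sq_olsMap]

/-- Given the design, the error is a linear form in the noise, hence centered Gaussian with variance
`τ²` times the diagonal entry. -/
theorem lintegral_sq_olsEstimator_sub {n : ℕ} (hn : p ≤ n) (i : Fin p) :
    ∫⁻ z, ENNReal.ofReal ((olsEstimator z i - β i) ^ 2)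
        ∂(Measure.pi fun _ : Fin n => linearModelLaw β τ) =
      ENNReal.ofReal (τ ^ 2) *
        ∫⁻ X, ENNReal.ofReal ((designGram X)⁻¹ i i) ∂(gaussianDesign n p) := by
  have hmeas : Measurable fun z : Fin n → DataPoint p =>
      ENNReal.ofReal ((olsEstimator z i - β i) ^ 2) :=
    (((measurable_olsEstimator_apply i).sub_const _).pow_const 2).ennreal_ofReal
  have hmp := measurePreserving_linearModelData β τ n
  rw [← hmp.lintegral_comp hmeas,
    lintegral_prod (fun q => ENNReal.ofReal ((olsEstimator (linearModelData β q) i - β i) ^ 2))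
      (hmeas.comp hmp.measurable).aemeasurable,
    ← lintegral_const_mul _ (measurable_designGram_inv_apply i i).ennreal_ofReal]
  refine lintegral_congr_ae ?_
  filter_upwards [ae_designGram_det_ne_zero hn] with X hX
  simp_rw [olsEstimator_linearModelData β hX]
  have h := lintegral_map (μ := Measure.pi fun _ : Fin n => gaussianReal 0 (τ ^ 2).toNNReal)
    (f := fun x : ℝ => ENNReal.ofReal (x ^ 2)) (g := fun e => ∑ k, olsMap X i k * e k)
    (by fun_prop) (by fun_prop)
  rw [← h, map_olsMap_gaussianReal, lintegral_sq_gaussianReal, ENNReal.coe_mul]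
  rfl

/-- Mean square consistency of the least squares estimator, at the rate `1 / n`. -/
theorem exists_integral_sq_olsEstimator_sub_le :
    ∃ C : ℝ, 0 < C ∧ ∀ n : ℕ, 2 * p + 3 ≤ n → ∀ i : Fin p,
      MemLp (fun z => olsEstimator z i - β i) 2 (Measure.pi fun _ : Fin n => linearModelLaw β τ) ∧
      ∫ z, (olsEstimator z i - β i) ^ 2 ∂(Measure.pi fun _ : Fin n => linearModelLaw β τ) ≤
        C / n := by
  obtain ⟨C, hC, h⟩ := exists_lintegral_designGram_inv_diag_le p
  refine ⟨(τ ^ 2 + 1) * C, by positivity, fun n hn i => ?_⟩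
  have hm : Measurable fun z : Fin n → DataPoint p => olsEstimator z i - β i :=
    (measurable_olsEstimator_apply i).sub_const _
  have hle : ∫⁻ z, ENNReal.ofReal ((olsEstimator z i - β i) ^ 2)
      ∂(Measure.pi fun _ : Fin n => linearModelLaw β τ) ≤
      ENNReal.ofReal ((τ ^ 2 + 1) * C / n) := by
    rw [lintegral_sq_olsEstimator_sub β τ (by omega) i]
    refine (mul_le_mul_right (h n hn i) _).trans ?_
    rw [← ENNReal.ofReal_mul (sq_nonneg τ), mul_div_assoc]
    refine ENNReal.ofReal_le_ofReal ?_
    have : 0 ≤ C / n := by positivity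
    nlinarith
  have hint : Integrable (fun z : Fin n → DataPoint p => (olsEstimator z i - β i) ^ 2)
      (Measure.pi fun _ : Fin n => linearModelLaw β τ) := by
    refine ⟨(hm.pow_const 2).aestronglyMeasurable, ?_⟩
    rw [hasFiniteIntegral_iff_ofReal (Eventually.of_forall fun z => sq_nonneg _)]
    exact hle.trans_lt ENNReal.ofReal_lt_top
  refine ⟨(memLp_two_iff_integrable_sq hm.aestronglyMeasurable).2 hint, ?_⟩
  rw [← ofReal_integral_eq_lintegral_ofReal hint (Eventually.of_forall fun z => sq_nonneg _)] at hle
  exact (ENNReal.ofReal_le_ofReal_iff (by positivity)).1 hle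

/-- For a vanishing coefficient, the law of the least squares estimator is symmetric. -/
theorem integral_odd_olsEstimator_eq_zero {n : ℕ} {i : Fin p} (hi : β i = 0) {f : ℝ → ℝ}
    (hf : ∀ x, f (-x) = -f x) :
    ∫ z, f (olsEstimator z i) ∂(Measure.pi fun _ : Fin n => linearModelLaw β τ) = 0 := by
  -- Flipping the sign of the `i`-th regressor leaves the response unchanged because `β i = 0`. The
  -- law of the data is therefore preserved, while the `i`-th least squares coordinate changes sign,
  -- also for a singular Gram matrix.
  let d : Fin p → ℝ := fun j => if j = i then -1 else 1
  have hd : ∀ j, d j * d j = 1 := fun j => by by_cases h : j = i <;> simp [d, h]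
  have hdβ : ∀ x : Fin p → ℝ, (fun j => d j * x j) ⬝ᵥ β = x ⬝ᵥ β := fun x => by
    refine Finset.sum_congr rfl fun j _ => ?_
    by_cases h : j = i
    · subst h; simp [hi]
    · simp [d, h]
  let F : DataPoint p → DataPoint p := fun q => (fun j => d j * q.1 j, q.2)
  have hFm : Measurable F := by fun_prop
  have hFF : ∀ q, F (F q) = q := fun q => by
    ext j
    · change d j * (d j * q.1 j) = q.1 j
      rw [← mul_assoc, hd, one_mul]
    · rfl
  have hF : MeasurePreserving F (linearModelLaw β τ) (linearModelLaw β τ) := by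
    refine ⟨hFm, ?_⟩
    have h1 : MeasurePreserving (fun (x : Fin p → ℝ) j => d j * x j)
        (Measure.pi fun _ => gaussianReal 0 1) (Measure.pi fun _ => gaussianReal 0 1) := by
      refine measurePreserving_pi (fun _ => gaussianReal 0 1) (fun _ => gaussianReal 0 1)
        fun j => ⟨by fun_prop, ?_⟩
      rw [gaussianReal_map_const_mul, mul_zero]
      congr 1
      ext
      simp [sq, hd]
    have h2 := (measurePreserving_linearModel β τ).comp
      (h1.prod (MeasurePreserving.id (gaussianReal 0 (τ ^ 2).toNNReal)))
    rw [← (measurePreserving_linearModel β τ).map_eq,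
      Measure.map_map hFm (measurePreserving_linearModel β τ).measurable]
    rw [(measurePreserving_linearModel β τ).map_eq, ← h2.map_eq]
    congr 1
    ext q j
    · rfl
    · simp [F, Prod.map, hdβ]
  have hFn := measurePreserving_pi (fun _ : Fin n => linearModelLaw β τ)
    (fun _ => linearModelLaw β τ) fun _ => hF
  -- As the flip is a measurable equivalence, the change of variables needs neither measurability
  -- nor integrability of `f`.
  let Fe : (Fin n → DataPoint p) ≃ᵐ (Fin n → DataPoint p) :=
    { toFun := fun z k => F (z k)
      invFun := fun z k => F (z k)
      left_inv := fun z => funext fun k => hFF _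
      right_inv := fun z => funext fun k => hFF _
      measurable_toFun := hFn.measurable
      measurable_invFun := hFn.measurable }
  have hols : ∀ z : Fin n → DataPoint p, olsEstimator (Fe z) i = -olsEstimator z i := by
    intro z
    have hD : (Matrix.diagonal d)⁻¹ = Matrix.diagonal d := by
      refine Matrix.inv_eq_right_inv ?_
      rw [Matrix.diagonal_mul_diagonal, ← Matrix.diagonal_one]
      congr 1
      ext j; exact hd j
    have hX : designMatrix (Fe z) = designMatrix z * Matrix.diagonal d := by
      ext k j
      rw [Matrix.mul_diagonal]
      exact mul_comm _ _
    have hY : responses (Fe z) = responses z := rfl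
    have h : olsEstimator (Fe z) = Matrix.diagonal d *ᵥ olsEstimator z := by
      rw [olsEstimator, hX, hY, Matrix.transpose_mul, Matrix.diagonal_transpose, olsEstimator,
        Matrix.mul_assoc (Matrix.diagonal d), ← Matrix.mul_assoc _ (designMatrix z),
        Matrix.mul_inv_rev, Matrix.mul_inv_rev, hD, Matrix.mulVec_mulVec, Matrix.mulVec_mulVec,
        Matrix.mulVec_mulVec]
      congr 1
      rw [Matrix.mul_assoc, Matrix.mul_assoc,
        ← Matrix.mul_assoc (Matrix.diagonal d) (Matrix.diagonal d), Matrix.diagonal_mul_diagonal]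
      simp [hd, Matrix.mul_assoc]
    rw [h, Matrix.mulVec_diagonal]
    simp [d]
  have h := hFn.integral_comp Fe.measurableEmbedding (fun z => f (olsEstimator z i))
  have h2 : (fun z : Fin n → DataPoint p => f (olsEstimator (fun k => F (z k)) i)) =
      fun z => -f (olsEstimator z i) := by
    ext z
    rw [← hf, ← hols]
    rfl
  rw [h2, integral_neg] at h
  linarith

end Moments

end

noncomputable section

/-! ### Losses of finite rank -/

/-- Factors in `V` come out of the conditional expectation, and those in `U` are replaced by their
means. It is applied both with `V` the test point and with `V` a training set. -/
theorem condExp_sum_mul_of_indepFun {Ω α γ κ : Type*} [Fintype κ] [MeasurableSpace Ω]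
    [MeasurableSpace α] [MeasurableSpace γ] {μ : Measure Ω} [IsProbabilityMeasure μ]
    {U : Ω → α} {V : Ω → γ} (hU : Measurable U) (hV : Measurable V) (hind : IndepFun U V μ)
    {φ : κ → α → ℝ} {ψ : κ → γ → ℝ} (hφ : ∀ a, Measurable (φ a)) (hψ : ∀ a, Measurable (ψ a))
    (hφi : ∀ a, Integrable (fun ω => φ a (U ω)) μ) (hψi : ∀ a, Integrable (fun ω => ψ a (V ω)) μ) :
    μ[fun ω => ∑ a, φ a (U ω) * ψ a (V ω) | MeasurableSpace.comap V inferInstance] =ᵐ[μ]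
      fun ω => ∑ a, (∫ ω', φ a (U ω') ∂μ) * ψ a (V ω) := by
  have hint : ∀ a, Integrable ((fun ω => φ a (U ω)) * fun ω => ψ a (V ω)) μ := fun a =>
    (hind.comp (hφ a) (hψ a)).integrable_mul (hφi a) (hψi a)
  have hsum : (fun ω => ∑ a, φ a (U ω) * ψ a (V ω)) =
      ∑ a, ((fun ω => φ a (U ω)) * fun ω => ψ a (V ω)) := by
    ext ω; simp
  rw [hsum]
  refine (condExp_finsetSum (fun a _ => hint a) _).trans ?_
  have hterm : ∀ a, μ[(fun ω => φ a (U ω)) * fun ω => ψ a (V ω) |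
      MeasurableSpace.comap V inferInstance] =ᵐ[μ]
      fun ω => (∫ ω', φ a (U ω') ∂μ) * ψ a (V ω) := fun a => by
    refine (condExp_mul_of_stronglyMeasurable_right
      ((hψ a).comp (comap_measurable V)).stronglyMeasurable (hint a) (hφi a)).trans ?_
    have h1 := condExp_indep_eq (μ := μ) hU.comap_le hV.comap_le
      ((hφ a).comp (comap_measurable U)).stronglyMeasurable hind
    filter_upwards [h1] with ω hω
    rw [Pi.mul_apply]
    exact congrArg (· * _) hω
  filter_upwards [ae_all_iff.2 hterm] with ω hω
  rw [Finset.sum_apply]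
  exact Finset.sum_congr rfl fun a _ => hω a

section FiniteRank

variable {𝒵 κ : Type*} [MeasurableSpace 𝒵] (P : Measure 𝒵) [Fintype κ] {n : ℕ}

variable {φ : κ → 𝒵 → ℝ} {ψ : κ → (Fin n → 𝒵) → ℝ}

theorem memLp_sum_mul_comp (hφ : ∀ a, MemLp (φ a) 2 P)
    (hψ : ∀ a, MemLp (ψ a) 2 (Measure.pi fun _ => P)) {T : 𝒵 × (Fin n → 𝒵) → (Fin n → 𝒵)}
    (hT : MeasurePreserving T (P.prod (Measure.pi fun _ => P)) (Measure.pi fun _ => P)) :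
    MemLp (fun ω => ∑ a, φ a (testPoint ω) * ψ a (T ω.2)) 2 (iidLaw P n) := by
  refine memLp_finsetSum _ fun a _ => ?_
  have h1 : MemLp (fun q => ψ a (T q)) 2 (P.prod (Measure.pi fun _ => P)) :=
    (hψ a).comp_measurePreserving hT
  have h2 : AEStronglyMeasurable (fun ω => φ a (testPoint ω) * ψ a (T ω.2)) (iidLaw P n) :=
    (hφ a).1.comp_fst.mul h1.1.comp_snd
  rw [memLp_two_iff_integrable_sq h2]
  simp_rw [mul_pow]
  exact (hφ a).integrable_sq.mul_prod h1.integrable_sq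

variable [IsProbabilityMeasure P]

instance isProbabilityMeasure_iidLaw : IsProbabilityMeasure (iidLaw P n) := by
  unfold iidLaw; infer_instance

theorem measurePreserving_testPoint :
    MeasurePreserving (testPoint (𝒵 := 𝒵) (n := n)) (iidLaw P n) P :=
  measurePreserving_fst

theorem measurePreserving_replaceFirst :
    MeasurePreserving (fun q : 𝒵 × (Fin n → 𝒵) => replaceFirst q.1 q.2)
      (P.prod (Measure.pi fun _ => P)) (Measure.pi fun _ => P) := by
  cases n with
  | zero =>
    have h : (fun q : 𝒵 × (Fin 0 → 𝒵) => replaceFirst q.1 q.2) = Prod.snd := by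
      ext q k; exact k.elim0
    rw [h]
    exact measurePreserving_snd
  | succ m =>
    have h : (fun q : 𝒵 × (Fin (m + 1) → 𝒵) => replaceFirst q.1 q.2) =
        fun q => Function.update q.2 0 q.1 := by
      ext1 q; ext1 k
      simp only [replaceFirst, Function.update_apply, Fin.ext_iff, Fin.val_zero]
    rw [h]
    exact measurePreserving_update_pi P 0

theorem measurePreserving_trainSet :
    MeasurePreserving (trainSet (𝒵 := 𝒵) (n := n)) (iidLaw P n) (Measure.pi fun _ => P) :=
  (measurePreserving_snd (μ := P) (ν := Measure.pi fun _ : Fin n => P)).comp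
    (measurePreserving_snd (μ := P) (ν := P.prod (Measure.pi fun _ : Fin n => P)))

/-- Conditioning on the test point averages out the training set, so only the means of the `ψ a`
remain. -/
theorem lossVariance_sum_mul (hφm : ∀ a, Measurable (φ a)) (hψm : ∀ a, Measurable (ψ a))
    (hφ : ∀ a, Integrable (φ a) P) (hψ : ∀ a, Integrable (ψ a) (Measure.pi fun _ => P)) :
    lossVariance P (fun z₀ z => ∑ a, φ a z₀ * ψ a z) =
      Var[fun z₀ => ∑ a, (∫ z, ψ a z ∂(Measure.pi fun _ => P)) * φ a z₀; P] := by
  have hind : IndepFun (trainSet (𝒵 := 𝒵) (n := n)) testPoint (iidLaw P n) :=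
    (indepFun_prod (μ := P) (ν := P.prod (Measure.pi fun _ : Fin n => P)) measurable_id
      measurable_snd).symm
  have h := condExp_sum_mul_of_indepFun (measurePreserving_trainSet P).measurable
    (measurePreserving_testPoint P).measurable hind hψm hφm
    (fun a => (measurePreserving_trainSet P).integrable_comp_of_integrable (hψ a))
    (fun a => (measurePreserving_testPoint P).integrable_comp_of_integrable (hφ a))
  simp_rw [mul_comm (ψ _ _)] at h
  rw [lossVariance, variance_congr h]
  have h1 : ∀ a, ∫ ω, ψ a (trainSet ω) ∂(iidLaw P n) = ∫ z, ψ a z ∂(Measure.pi fun _ => P) :=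
    fun a => by
      rw [← (measurePreserving_trainSet P).map_eq, integral_map
        (measurePreserving_trainSet P).aemeasurable (hψm a).aestronglyMeasurable]
  simp_rw [h1]
  have h2 := variance_map (μ := iidLaw P n) (Y := testPoint)
    (X := fun z₀ => ∑ a, (∫ z, ψ a z ∂(Measure.pi fun _ => P)) * φ a z₀)
    (Finset.measurable_fun_sum _ fun a _ => (hφm a).const_mul _).aemeasurable
    (measurePreserving_testPoint P).aemeasurable
  rw [(measurePreserving_testPoint P).map_eq] at h2
  exact h2.symm

theorem centeredLoss_sum_mul (hφm : ∀ a, Measurable (φ a)) (hψm : ∀ a, Measurable (ψ a))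
    (hφ : ∀ a, Integrable (φ a) P) (hψ : ∀ a, Integrable (ψ a) (Measure.pi fun _ => P))
    {T : 𝒵 × (Fin n → 𝒵) → (Fin n → 𝒵)}
    (hT : MeasurePreserving T (P.prod (Measure.pi fun _ => P)) (Measure.pi fun _ => P)) :
    centeredLoss P (fun z₀ z => ∑ a, φ a z₀ * ψ a z) (fun ω => T ω.2) =ᵐ[iidLaw P n]
      fun ω => ∑ a, (φ a ω.1 - ∫ z₀, φ a z₀ ∂P) * ψ a (T ω.2) := by
  have hind : IndepFun (testPoint (𝒵 := 𝒵) (n := n)) (fun ω => T ω.2) (iidLaw P n) :=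
    indepFun_prod (μ := P) (ν := P.prod (Measure.pi fun _ : Fin n => P)) measurable_id
      hT.measurable
  have hT2 : MeasurePreserving (fun ω : 𝒵 × 𝒵 × (Fin n → 𝒵) => T ω.2) (iidLaw P n)
      (Measure.pi fun _ => P) := hT.comp measurePreserving_snd
  have h := condExp_sum_mul_of_indepFun (measurePreserving_testPoint P).measurable
    hT2.measurable hind hφm hψm
    (fun a => (measurePreserving_testPoint P).integrable_comp_of_integrable (hφ a))
    (fun a => hT2.integrable_comp_of_integrable (hψ a))
  have h1 : ∀ a, ∫ ω, φ a (testPoint ω) ∂(iidLaw P n) = ∫ z, φ a z ∂P :=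
    fun a => by
      have h := integral_map (measurePreserving_testPoint P (n := n)).aemeasurable
        (hφm a).aestronglyMeasurable
      rw [(measurePreserving_testPoint P).map_eq] at h
      exact h.symm
  filter_upwards [h] with ω hω
  rw [centeredLoss, hω]
  simp_rw [h1, sub_mul, Finset.sum_sub_distrib]
  rfl

/-- Conditioning on a training set subtracts exactly the means of the `φ a`, so the square
integrated over the test point first is a variance with the training sets frozen; Fubini does the
rest. -/
theorem lossStability_sum_mul (hφm : ∀ a, Measurable (φ a)) (hψm : ∀ a, Measurable (ψ a))
    (hφ : ∀ a, MemLp (φ a) 2 P) (hψ : ∀ a, MemLp (ψ a) 2 (Measure.pi fun _ => P)) :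
    Integrable (fun q : 𝒵 × (Fin n → 𝒵) =>
      Var[fun z₀ => ∑ a, (ψ a q.2 - ψ a (replaceFirst q.1 q.2)) * φ a z₀; P])
      (P.prod (Measure.pi fun _ => P)) ∧
    lossStability P (fun z₀ z => ∑ a, φ a z₀ * ψ a z) =
      ∫ q : 𝒵 × (Fin n → 𝒵),
        Var[fun z₀ => ∑ a, (ψ a q.2 - ψ a (replaceFirst q.1 q.2)) * φ a z₀; P]
        ∂(P.prod (Measure.pi fun _ => P)) := by
  have hφi := fun a => (hφ a).integrable one_le_two
  have hψi := fun a => (hψ a).integrable one_le_two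
  have hsnd : MeasurePreserving (Prod.snd : 𝒵 × (Fin n → 𝒵) → _)
    (P.prod (Measure.pi fun _ => P)) (Measure.pi fun _ => P) := measurePreserving_snd
  have h1 := centeredLoss_sum_mul P hφm hψm hφi hψi hsnd
  have h2 := centeredLoss_sum_mul P hφm hψm hφi hψi (measurePreserving_replaceFirst P)
  have hc : ∀ a, MemLp (fun z₀ => φ a z₀ - ∫ z, φ a z ∂P) 2 P := fun a =>
    (hφ a).sub (memLp_const _)
  let f : 𝒵 × 𝒵 × (Fin n → 𝒵) → ℝ := fun ω => ∑ a, (φ a ω.1 - ∫ z₀, φ a z₀ ∂P) *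
    (ψ a ω.2.2 - ψ a (replaceFirst ω.2.1 ω.2.2))
  have hf : MemLp f 2 (iidLaw P n) := by
    have h := (memLp_sum_mul_comp P hc hψ hsnd).sub
      (memLp_sum_mul_comp P hc hψ (measurePreserving_replaceFirst P))
    convert h using 1
    ext ω
    simp only [f, mul_sub, Finset.sum_sub_distrib]
    rfl
  have hvar : ∀ q : 𝒵 × (Fin n → 𝒵), ∫ z₀, f (z₀, q) ^ 2 ∂P =
      Var[fun z₀ => ∑ a, (ψ a q.2 - ψ a (replaceFirst q.1 q.2)) * φ a z₀; P] := fun q => by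
    rw [variance_eq_integral
      (Finset.measurable_fun_sum _ fun a _ => (hφm a).const_mul _).aemeasurable,
      integral_finsetSum _ fun a _ => (hφi a).const_mul _]
    simp_rw [integral_const_mul]
    refine integral_congr_ae (Eventually.of_forall fun z₀ => ?_)
    simp only [f]
    rw [← Finset.sum_sub_distrib]
    congr 1
    exact Finset.sum_congr rfl fun a _ => by ring
  have hfi := hf.integrable_sq
  rw [iidLaw] at hfi
  constructor
  · have h := hfi.integral_prod_right
    simp_rw [hvar] at h
    exact h
  · have h3 : lossStability P (fun z₀ z => ∑ a, φ a z₀ * ψ a z) = ∫ ω, f ω ^ 2 ∂(iidLaw P n) := by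
      refine integral_congr_ae ?_
      filter_upwards [h1, h2] with ω hω1 hω2
      change (centeredLoss P _ (fun ω => Prod.snd ω.2) ω -
        centeredLoss P _ (fun ω => replaceFirst ω.2.1 ω.2.2) ω) ^ 2 = _
      rw [hω1, hω2, ← Finset.sum_sub_distrib]
      simp only [f]
      congr 1
      exact Finset.sum_congr rfl fun a _ => by ring
    rw [h3, iidLaw, integral_prod_symm _ hfi]
    simp_rw [hvar]

end FiniteRank

theorem variance_sum_mul {Ω κ : Type*} [Fintype κ] [MeasurableSpace Ω] {P : Measure Ω}
    [IsFiniteMeasure P] {φ : κ → Ω → ℝ} (hφ : ∀ a, MemLp (φ a) 2 P) (c : κ → ℝ) :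
    Var[fun ω => ∑ a, c a * φ a ω; P] = ∑ a, ∑ b, c a * c b * cov[φ a, φ b; P] := by
  rw [variance_fun_sum fun a => (hφ a).const_mul (c a)]
  refine Finset.sum_congr rfl fun a _ => Finset.sum_congr rfl fun b _ => ?_
  rw [covariance_const_mul_left, covariance_const_mul_right]
  ring

/-! ### The loss of the comparison of two linear rules -/

section Model

variable {p : ℕ}

/-- The monomials in the test point that make up a difference of squared error losses. -/
def lossMonomial (p : ℕ) : Fin p ⊕ Fin p × Fin p → DataPoint p → ℝ
  | .inl i => fun q => 2 * q.2 * q.1 i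
  | .inr ij => fun q => q.1 ij.1 * q.1 ij.2

/-- The coefficients of `sqLoss b₁ - sqLoss b₂` with respect to `lossMonomial`. -/
def lossCoeff (b₁ b₂ : Fin p → ℝ) : Fin p ⊕ Fin p × Fin p → ℝ
  | .inl i => b₂ i - b₁ i
  | .inr ij => b₁ ij.1 * b₁ ij.2 - b₂ ij.1 * b₂ ij.2

theorem sqLoss_sub_sqLoss (b₁ b₂ : Fin p → ℝ) (q : DataPoint p) :
    sqLoss b₁ q - sqLoss b₂ q = ∑ a, lossMonomial p a q * lossCoeff b₁ b₂ a := by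
  have hsq : ∀ b : Fin p → ℝ, (q.1 ⬝ᵥ b) ^ 2 = ∑ i, ∑ j, q.1 i * q.1 j * (b i * b j) := by
    intro b
    rw [sq, dotProduct, Finset.sum_mul_sum]
    exact Finset.sum_congr rfl fun i _ => Finset.sum_congr rfl fun j _ => by ring
  have hlin : ∀ b : Fin p → ℝ, 2 * q.2 * (q.1 ⬝ᵥ b) = ∑ i, 2 * q.2 * q.1 i * b i := by
    intro b
    rw [dotProduct, Finset.mul_sum]
    exact Finset.sum_congr rfl fun i _ => by ring
  rw [Fintype.sum_sum_type, Fintype.sum_prod_type]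
  simp only [lossMonomial, lossCoeff, mul_sub, Finset.sum_sub_distrib]
  rw [← hsq, ← hsq, ← hlin, ← hlin, sqLoss, sqLoss]
  ring

theorem measurable_lossMonomial (a : Fin p ⊕ Fin p × Fin p) : Measurable (lossMonomial p a) := by
  rcases a with i | ij <;> simp only [lossMonomial] <;> fun_prop

variable (β : Fin p → ℝ) (τ : ℝ)

/-- Makes products of two functions in `L⁴` square integrable; the loss monomials are such products.
-/
instance holderTriple_four_four_two : ENNReal.HolderTriple 4 4 2 :=
  ⟨by
    rw [← two_mul, show (4 : ENNReal) = 2 * 2 by norm_num,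
      ENNReal.mul_inv (by simp) (by simp), ← mul_assoc, ENNReal.mul_inv_cancel (by simp) (by simp),
      one_mul]⟩

theorem integral_sq_gaussianReal (v : NNReal) : ∫ x, x ^ 2 ∂(gaussianReal 0 v) = v := by
  have h := variance_fun_id_gaussianReal (μ := 0) (v := v)
  rw [variance_eq_integral (by fun_prop), integral_id_gaussianReal] at h
  simpa using h

theorem integral_sq_sum_mul_pi_gaussianReal {ι : Type*} [Fintype ι] (c : ι → ℝ) :
    ∫ x : ι → ℝ, (∑ i, c i * x i) ^ 2 ∂(Measure.pi fun _ => gaussianReal 0 1) = ∑ i, c i ^ 2 := by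
  have h := integral_map (μ := Measure.pi fun _ : ι => gaussianReal 0 1)
    (φ := fun x : ι → ℝ => ∑ i, c i * x i) (f := fun x : ℝ => x ^ 2)
    (by fun_prop : Measurable _).aemeasurable (by fun_prop)
  rw [← h, map_sum_mul_pi_gaussianReal, integral_sq_gaussianReal, one_mul, NNReal.coe_sum]
  exact Finset.sum_congr rfl fun i _ => Real.coe_toNNReal _ (sq_nonneg _)

theorem memLp_gaussianReal_coord {ι : Type*} [Fintype ι] (v : NNReal) (i : ι) (r : NNReal) :
    MemLp (fun x : ι → ℝ => x i) r (Measure.pi fun _ => gaussianReal 0 v) :=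
  (memLp_id_gaussianReal r).comp_measurePreserving
    (measurePreserving_eval (fun _ : ι => gaussianReal 0 v) i)

theorem memLp_lossMonomial (a : Fin p ⊕ Fin p × Fin p) :
    MemLp (lossMonomial p a) 2 (linearModelLaw β τ) := by
  have hmp := measurePreserving_linearModel β τ
  have hx : ∀ i, MemLp (fun q : (Fin p → ℝ) × ℝ => q.1 i) 4
      ((Measure.pi fun _ : Fin p => gaussianReal 0 1).prod (gaussianReal 0 (τ ^ 2).toNNReal)) :=
    fun i => (memLp_gaussianReal_coord 1 i 4).comp_measurePreserving measurePreserving_fst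
  have he : MemLp (fun q : (Fin p → ℝ) × ℝ => q.2) 4
      ((Measure.pi fun _ : Fin p => gaussianReal 0 1).prod (gaussianReal 0 (τ ^ 2).toNNReal)) :=
    (memLp_id_gaussianReal 4).comp_measurePreserving measurePreserving_snd
  have hy : MemLp (fun q : (Fin p → ℝ) × ℝ => q.1 ⬝ᵥ β + q.2) 4
      ((Measure.pi fun _ : Fin p => gaussianReal 0 1).prod (gaussianReal 0 (τ ^ 2).toNNReal)) :=
    (memLp_finsetSum _ fun i _ => (hx i).mul_const (β i)).add he
  rw [← hmp.map_eq, memLp_map_measure_iff (measurable_lossMonomial a).aestronglyMeasurable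
    hmp.aemeasurable]
  rcases a with i | ij
  · exact (hx i).mul (hy.const_mul 2)
  · exact (hx ij.2).mul (hx ij.1)

/-- The variance of a combination of the loss monomials splits into the contribution of the noise
and that of the regressors. -/
theorem variance_sum_mul_lossMonomial (c : Fin p ⊕ Fin p × Fin p → ℝ) :
    Var[fun q => ∑ a, c a * lossMonomial p a q; linearModelLaw β τ] =
      4 * τ ^ 2 * ∑ i, c (.inl i) ^ 2 +
        Var[fun x : Fin p → ℝ => 2 * (x ⬝ᵥ β) * (∑ i, c (.inl i) * x i) +
          ∑ i, ∑ j, c (.inr (i, j)) * (x i * x j); Measure.pi fun _ => gaussianReal 0 1] := by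
  have hmp := measurePreserving_linearModel β τ
  set μ := Measure.pi fun _ : Fin p => gaussianReal 0 1 with hμ
  set ν := gaussianReal 0 (τ ^ 2).toNNReal with hν
  set u : (Fin p → ℝ) → ℝ := fun x => ∑ i, c (.inl i) * x i with hu
  set R : (Fin p → ℝ) → ℝ := fun x =>
    2 * (x ⬝ᵥ β) * u x + ∑ i, ∑ j, c (.inr (i, j)) * (x i * x j) with hR
  have hx : ∀ i, MemLp (fun x : Fin p → ℝ => x i) 4 μ := fun i => memLp_gaussianReal_coord 1 i 4
  have hu4 : MemLp u 4 μ := memLp_finsetSum _ fun i _ => (hx i).const_mul _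
  have hβ4 : MemLp (fun x => x ⬝ᵥ β) 4 μ := memLp_finsetSum _ fun i _ => (hx i).mul_const _
  have hR2 : MemLp R 2 μ := by
    refine MemLp.add (hu4.mul (hβ4.const_mul 2)) ?_
    exact memLp_finsetSum _ fun i _ => memLp_finsetSum _ fun j _ =>
      ((hx j).mul (hx i)).const_mul _
  have he4 : MemLp (fun e : ℝ => e) 4 ν := memLp_id_gaussianReal 4
  -- `A` is linear in the noise and `B` is free of it; the noise is centered and independent of the
  -- regressors, so the two are uncorrelated.
  let A : (Fin p → ℝ) × ℝ → ℝ := fun q => 2 * u q.1 * q.2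
  let B : (Fin p → ℝ) × ℝ → ℝ := fun q => R q.1
  have hA : MemLp A 2 (μ.prod ν) :=
    (he4.comp_measurePreserving measurePreserving_snd).mul
      ((hu4.const_mul 2).comp_measurePreserving measurePreserving_fst)
  have hB : MemLp B 2 (μ.prod ν) := hR2.comp_measurePreserving measurePreserving_fst
  have hEe : ∫ e, e ∂ν = 0 := integral_id_gaussianReal
  have hEA : ∫ q, A q ∂(μ.prod ν) = 0 := by
    rw [integral_prod_mul (fun x => 2 * u x) (fun e : ℝ => e), hEe, mul_zero]
  have hEAB : ∫ q, (A * B) q ∂(μ.prod ν) = 0 := by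
    have : A * B = fun q => (2 * u q.1 * R q.1) * q.2 := by
      ext q; simp only [A, B, Pi.mul_apply]; ring
    rw [this, integral_prod_mul (fun x => 2 * u x * R x) (fun e : ℝ => e), hEe, mul_zero]
  have hcov : cov[A, B; μ.prod ν] = 0 := by
    rw [covariance_eq_sub hA hB, hEAB, hEA, zero_mul, sub_zero]
  have hvA : Var[A; μ.prod ν] = 4 * τ ^ 2 * ∑ i, c (.inl i) ^ 2 := by
    rw [variance_of_integral_eq_zero hA.1.aemeasurable hEA]
    have : (fun q => A q ^ 2) = fun q => (4 * u q.1 ^ 2) * q.2 ^ 2 := by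
      ext q; simp only [A]; ring
    rw [this, integral_prod_mul (fun x => 4 * u x ^ 2) (fun e : ℝ => e ^ 2), integral_const_mul,
      integral_sq_sum_mul_pi_gaussianReal, integral_sq_gaussianReal,
      Real.coe_toNNReal _ (sq_nonneg _)]
    ring
  have hvB : Var[B; μ.prod ν] = Var[R; μ] := by
    have h := variance_map (μ := μ.prod ν) (Y := Prod.fst) (X := R)
      (by rw [measurePreserving_fst.map_eq]; exact hR2.1.aemeasurable) (by fun_prop)
    rw [measurePreserving_fst.map_eq] at h
    exact h.symm
  rw [← hmp.map_eq, variance_map (Finset.measurable_fun_sum _ fun a _ =>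
    (measurable_lossMonomial a).const_mul _).aemeasurable hmp.aemeasurable]
  have hfun : (fun q => ∑ a, c a * lossMonomial p a q) ∘
      (fun q : (Fin p → ℝ) × ℝ => ((q.1, q.1 ⬝ᵥ β + q.2) : DataPoint p)) = A + B := by
    ext q
    simp only [Function.comp_apply, Fintype.sum_sum_type, Fintype.sum_prod_type, lossMonomial,
      Pi.add_apply, A, B, hR, hu]
    have h1 : ∑ i, c (.inl i) * (2 * (q.1 ⬝ᵥ β + q.2) * q.1 i) =
        2 * (q.1 ⬝ᵥ β + q.2) * ∑ i, c (.inl i) * q.1 i := by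
      rw [Finset.mul_sum]
      exact Finset.sum_congr rfl fun i _ => by ring
    rw [h1]
    ring
  rw [hfun, variance_add hA hB, hcov, hvA, hvB]
  ring

end Model

end

noncomputable section

/-! ### Soft thresholding -/

/-- Soft thresholding of `b` at level `t`. -/
def softThreshold (t b : ℝ) : ℝ := Real.sign b * max (|b| - t) 0

theorem stEstimator_apply {p n : ℕ} (l : ℝ) (z : Fin n → DataPoint p) (i : Fin p) :
    stEstimator l z i = softThreshold (l / n) (olsEstimator z i) := rfl

theorem softThreshold_neg (t b : ℝ) : softThreshold t (-b) = -softThreshold t b := by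
  simp [softThreshold, Real.sign_neg]

theorem softThreshold_zero (b : ℝ) : softThreshold 0 b = b := by
  rw [softThreshold, sub_zero, max_eq_left (abs_nonneg b)]
  rcases lt_trichotomy b 0 with h | h | h
  · rw [Real.sign_of_neg h, abs_of_neg h]; ring
  · simp [h]
  · rw [Real.sign_of_pos h, abs_of_pos h]; ring

theorem abs_real_sign_le_one (b : ℝ) : |Real.sign b| ≤ 1 := by
  rcases Real.sign_apply_eq b with h | h | h <;> simp [h]

/-- The positive part is 1-Lipschitz. The bound is uniform in `b` and valid for thresholds of either
sign. -/
theorem abs_softThreshold_sub_le (t₁ t₂ b : ℝ) :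
    |softThreshold t₁ b - softThreshold t₂ b| ≤ |t₁ - t₂| := by
  rw [softThreshold, softThreshold, ← mul_sub, abs_mul]
  have h1 := abs_max_sub_max_le_abs (|b| - t₁) (|b| - t₂) 0
  have h2 : |b| - t₁ - (|b| - t₂) = -(t₁ - t₂) := by ring
  rw [h2, abs_neg] at h1
  have h3 := abs_real_sign_le_one b
  nlinarith [abs_nonneg (Real.sign b), abs_nonneg (max (|b| - t₁) 0 - max (|b| - t₂) 0)]

theorem softThreshold_sub_of_le {t₁ t₂ b : ℝ} (h₁ : t₁ ≤ |b|) (h₂ : t₂ ≤ |b|) :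
    softThreshold t₁ b - softThreshold t₂ b = Real.sign b * (t₂ - t₁) := by
  rw [softThreshold, softThreshold, max_eq_left (by linarith), max_eq_left (by linarith)]
  ring

theorem measurable_real_sign : Measurable Real.sign := by
  unfold Real.sign
  exact Measurable.ite measurableSet_Iio measurable_const
    (Measurable.ite measurableSet_Ioi measurable_const measurable_const)

theorem measurable_softThreshold (t : ℝ) : Measurable (softThreshold t) :=
  measurable_real_sign.mul (by fun_prop)

section Model

variable {p n : ℕ}

theorem measurable_stEstimator_apply (l : ℝ) (i : Fin p) :
    Measurable fun z : Fin n → DataPoint p => stEstimator l z i :=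
  (measurable_softThreshold _).comp (measurable_olsEstimator_apply i)

theorem abs_stEstimator_sub_le (l₁ l₂ : ℝ) (z : Fin n → DataPoint p) (i : Fin p) :
    |stEstimator l₁ z i - stEstimator l₂ z i| ≤ |l₁ - l₂| / n := by
  refine (abs_softThreshold_sub_le _ _ _).trans_eq ?_
  rw [← sub_div, abs_div, Nat.abs_cast]

theorem abs_stEstimator_sub_olsEstimator_le (l : ℝ) (z : Fin n → DataPoint p) (i : Fin p) :
    |stEstimator l z i - olsEstimator z i| ≤ |l| / n := by
  have h := abs_softThreshold_sub_le (l / n) 0 (olsEstimator z i)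
  rwa [softThreshold_zero, sub_zero, abs_div, Nat.abs_cast] at h

theorem measurable_lossCoeff_stEstimator (l₁ l₂ : ℝ) (a : Fin p ⊕ Fin p × Fin p) :
    Measurable fun z : Fin n → DataPoint p => lossCoeff (stEstimator l₁ z) (stEstimator l₂ z) a := by
  have h1 := measurable_stEstimator_apply (p := p) (n := n) l₁
  have h2 := measurable_stEstimator_apply (p := p) (n := n) l₂
  rcases a with i | ij
  · exact (h2 i).sub (h1 i)
  · exact ((h1 ij.1).mul (h1 ij.2)).sub ((h2 ij.1).mul (h2 ij.2))

theorem stDiffLoss_eq_sum (l₁ l₂ : ℝ) :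
    (stDiffLoss l₁ l₂ : DataPoint p → (Fin n → DataPoint p) → ℝ) =
      fun z₀ z => ∑ a, lossMonomial p a z₀ * lossCoeff (stEstimator l₁ z) (stEstimator l₂ z) a := by
  ext z₀ z
  exact sqLoss_sub_sqLoss _ _ _

variable (β : Fin p → ℝ) (τ : ℝ)

theorem memLp_olsEstimator_sub (hn : 2 * p + 3 ≤ n) (i : Fin p) :
    MemLp (fun z => olsEstimator z i - β i) 2 (Measure.pi fun _ : Fin n => linearModelLaw β τ) :=
  ((exists_integral_sq_olsEstimator_sub_le β τ).choose_spec.2 n hn i).1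

theorem memLp_stEstimator (hn : 2 * p + 3 ≤ n) (l : ℝ) (i : Fin p) :
    MemLp (fun z => stEstimator l z i) 2 (Measure.pi fun _ : Fin n => linearModelLaw β τ) := by
  have h1 := (memLp_olsEstimator_sub β τ hn i).add (memLp_const (β i))
  have h2 : MemLp (fun z : Fin n → DataPoint p => stEstimator l z i - olsEstimator z i) 2
      (Measure.pi fun _ : Fin n => linearModelLaw β τ) :=
    MemLp.of_bound ((measurable_stEstimator_apply l i).sub
      (measurable_olsEstimator_apply i)).aestronglyMeasurable (|l| / n)
      (Eventually.of_forall fun z => abs_stEstimator_sub_olsEstimator_le l z i)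
  convert h2.add h1 using 1
  ext z
  simp

theorem memLp_lossCoeff_stEstimator (hn : 2 * p + 3 ≤ n) (l₁ l₂ : ℝ)
    (a : Fin p ⊕ Fin p × Fin p) :
    MemLp (fun z => lossCoeff (stEstimator l₁ z) (stEstimator l₂ z) a) 2
      (Measure.pi fun _ : Fin n => linearModelLaw β τ) := by
  have h1 := memLp_stEstimator β τ hn l₁
  have h2 := memLp_stEstimator β τ hn l₂
  rcases a with i | ⟨i, j⟩
  · exact (h2 i).sub (h1 i)
  -- A product of two square integrable estimators is a priori only integrable. The increment of the
  -- product is a sum of terms with one bounded factor, the increment of an estimator, so it is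
  -- square integrable.
  · refine MemLp.mono' (((h1 i).norm.add (h2 j).norm).const_mul (|l₁ - l₂| / n))
      (measurable_lossCoeff_stEstimator l₁ l₂ _).aestronglyMeasurable
      (Eventually.of_forall fun z => ?_)
    have e : lossCoeff (stEstimator l₁ z) (stEstimator l₂ z) (.inr (i, j)) =
        stEstimator l₁ z i * (stEstimator l₁ z j - stEstimator l₂ z j) +
          (stEstimator l₁ z i - stEstimator l₂ z i) * stEstimator l₂ z j := by
      simp only [lossCoeff]; ring
    have h3 := abs_stEstimator_sub_le l₁ l₂ z i
    have h4 := abs_stEstimator_sub_le l₁ l₂ z j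
    rw [e, Real.norm_eq_abs]
    refine (abs_add_le _ _).trans ?_
    rw [abs_mul, abs_mul]
    simp only [Pi.add_apply, Real.norm_eq_abs]
    nlinarith [abs_nonneg (stEstimator l₁ z i), abs_nonneg (stEstimator l₂ z j)]

theorem memLp_stDiffLoss (hn : 2 * p + 3 ≤ n) (l₁ l₂ : ℝ) :
    MemLp (fun ω => stDiffLoss l₁ l₂ (testPoint ω) (trainSet ω)) 2
      (iidLaw (linearModelLaw β τ) n) := by
  rw [stDiffLoss_eq_sum]
  have h : MeasurePreserving Prod.snd ((linearModelLaw β τ).prod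
      (Measure.pi fun _ : Fin n => linearModelLaw β τ)) (Measure.pi fun _ => linearModelLaw β τ) :=
    measurePreserving_snd
  exact memLp_sum_mul_comp _ (memLp_lossMonomial β τ) (memLp_lossCoeff_stEstimator β τ hn l₁ l₂) h

theorem lossVariance_stDiffLoss (hn : 2 * p + 3 ≤ n) (l₁ l₂ : ℝ) :
    lossVariance (linearModelLaw β τ) (n := n) (stDiffLoss l₁ l₂) =
      Var[fun z₀ => ∑ a, (∫ z, lossCoeff (stEstimator l₁ z) (stEstimator l₂ z) a
        ∂(Measure.pi fun _ : Fin n => linearModelLaw β τ)) * lossMonomial p a z₀;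
        linearModelLaw β τ] := by
  rw [stDiffLoss_eq_sum]
  exact lossVariance_sum_mul _ measurable_lossMonomial (measurable_lossCoeff_stEstimator l₁ l₂)
    (fun a => (memLp_lossMonomial β τ a).integrable one_le_two)
    (fun a => (memLp_lossCoeff_stEstimator β τ hn l₁ l₂ a).integrable one_le_two)

end Model

/-! ### The limit of the rescaled variance. -/

section Limit

variable {p : ℕ} (β : Fin p → ℝ) (τ : ℝ)

theorem exists_integral_abs_olsEstimator_sub_le :
    ∃ C : ℝ, 0 < C ∧ ∀ n : ℕ, 2 * p + 3 ≤ n → ∀ i : Fin p,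
      ∫ z, |olsEstimator z i - β i| ∂(Measure.pi fun _ : Fin n => linearModelLaw β τ) ≤
        C / √n := by
  obtain ⟨C, hC, h⟩ := exists_integral_sq_olsEstimator_sub_le β τ
  refine ⟨1 + C, by positivity, fun n hn i => ?_⟩
  obtain ⟨hL, hle⟩ := h n hn i
  have hn0 : (0 : ℝ) < n := by
    have : 0 < n := by omega
    exact_mod_cast this
  have hs : 0 < √(n : ℝ) := Real.sqrt_pos.2 hn0
  -- A weighted AM-GM inequality, in place of Cauchy-Schwarz, balanced at the scale `1 / √n`.
  have hpt : ∀ x : ℝ, |x| ≤ 1 / √n + √n * x ^ 2 := fun x => by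
    have h1 : 1 / √(n : ℝ) + √n * x ^ 2 - |x| =
        (1 / √n) * ((√n * |x| - 1 / 2) ^ 2 + 3 / 4) := by
      rw [← sq_abs x]
      field_simp
      ring
    have h2 : 0 ≤ (1 / √(n : ℝ)) * ((√n * |x| - 1 / 2) ^ 2 + 3 / 4) := by positivity
    linarith
  calc ∫ z, |olsEstimator z i - β i| ∂(Measure.pi fun _ : Fin n => linearModelLaw β τ)
      ≤ ∫ z, (1 / √n + √n * (olsEstimator z i - β i) ^ 2)
          ∂(Measure.pi fun _ : Fin n => linearModelLaw β τ) :=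
        integral_mono (hL.integrable one_le_two).abs
          ((integrable_const _).add (hL.integrable_sq.const_mul _)) fun z => hpt _
    _ = 1 / √n + √n * ∫ z, (olsEstimator z i - β i) ^ 2
          ∂(Measure.pi fun _ : Fin n => linearModelLaw β τ) := by
        rw [integral_add (integrable_const _) (hL.integrable_sq.const_mul _), integral_const_mul]
        simp
    _ ≤ 1 / √n + √n * (C / n) := by gcongr
    _ = (1 + C) / √n := by
        rw [add_div]
        congr 1
        rw [mul_div_assoc', div_eq_div_iff hn0.ne' hs.ne', mul_right_comm,
          Real.mul_self_sqrt hn0.le, mul_comm]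

/-- Within `|b₀| / 2` of `b₀`, the point `b` has the sign of `b₀` and lies above both thresholds, so
the difference quotient is exactly the sign. Elsewhere the error is at most `2` while `(b - b₀) ^ 2
≥ b₀ ^ 2 / 4`, whence the constant `8`. -/
theorem abs_softThreshold_sub_div_sub_sign_le {b₀ t₁ t₂ : ℝ} (hb₀ : b₀ ≠ 0) (h₁ : t₁ ≤ |b₀| / 2)
    (h₂ : t₂ ≤ |b₀| / 2) (ht : t₁ ≠ t₂) (b : ℝ) :
    |(t₂ - t₁)⁻¹ * (softThreshold t₁ b - softThreshold t₂ b) - Real.sign b₀| ≤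
      8 / b₀ ^ 2 * (b - b₀) ^ 2 := by
  have hne : t₂ - t₁ ≠ 0 := sub_ne_zero.2 ht.symm
  have hpos : 0 < |b₀| := abs_pos.2 hb₀
  by_cases hb : |b - b₀| < |b₀| / 2
  · have hle : |b₀| / 2 ≤ |b| := by
      have := abs_sub_abs_le_abs_sub b₀ b
      rw [abs_sub_comm] at this
      linarith
    have hsign : Real.sign b = Real.sign b₀ := by
      rcases lt_or_gt_of_ne hb₀ with h | h
      · rw [abs_of_neg h] at hb
        have := (abs_lt.1 hb).2
        rw [Real.sign_of_neg h, Real.sign_of_neg (by linarith)]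
      · rw [abs_of_pos h] at hb
        have := (abs_lt.1 hb).1
        rw [Real.sign_of_pos h, Real.sign_of_pos (by linarith)]
    rw [softThreshold_sub_of_le (h₁.trans hle) (h₂.trans hle), hsign]
    have : (t₂ - t₁)⁻¹ * (Real.sign b₀ * (t₂ - t₁)) - Real.sign b₀ = 0 := by
      field_simp
      ring
    rw [this, abs_zero]
    positivity
  · have h1 : |(t₂ - t₁)⁻¹ * (softThreshold t₁ b - softThreshold t₂ b)| ≤ 1 := by
      rw [abs_mul, abs_inv, inv_mul_le_iff₀ (abs_pos.2 hne), mul_one, abs_sub_comm t₂]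
      exact abs_softThreshold_sub_le _ _ _
    have h2 := abs_real_sign_le_one b₀
    have h3 := abs_sub ((t₂ - t₁)⁻¹ * (softThreshold t₁ b - softThreshold t₂ b)) (Real.sign b₀)
    have h4 : (2 : ℝ) ≤ 8 / b₀ ^ 2 * (b - b₀) ^ 2 := by
      rw [div_mul_eq_mul_div, le_div_iff₀ (by positivity), ← sq_abs b₀, ← sq_abs (b - b₀)]
      nlinarith
    linarith

variable {lam δ : ℕ → ℝ}

theorem tendsto_abs_div_natCast {l : ℕ → ℝ} (hl : l =o[atTop] (fun n : ℕ => (n : ℝ))) :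
    Tendsto (fun n : ℕ => |l n| / n) atTop (𝓝 0) := by
  have h := hl.tendsto_div_nhds_zero.abs
  simpa [abs_div] using h

theorem tendsto_integral_stEstimator_sub (hlam : lam =o[atTop] (fun n : ℕ => (n : ℝ)))
    (hδ : δ =o[atTop] (fun n : ℕ => (n : ℝ))) (hne : ∀ᶠ n : ℕ in atTop, δ n ≠ 0) (i : Fin p) :
    Tendsto (fun n : ℕ => n / δ n * ∫ z, (stEstimator (lam n) z i -
      stEstimator (lam n + δ n) z i) ∂(Measure.pi fun _ : Fin n => linearModelLaw β τ))
      atTop (𝓝 (Real.sign (β i))) := by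
  by_cases hi : β i = 0
  · rw [hi, Real.sign_zero]
    refine tendsto_const_nhds.congr fun n => ?_
    have h := integral_odd_olsEstimator_eq_zero β τ (n := n) hi
      (f := fun b => softThreshold (lam n / n) b - softThreshold ((lam n + δ n) / n) b)
      (fun x => by rw [softThreshold_neg, softThreshold_neg]; ring)
    simp_rw [stEstimator_apply]
    rw [h, mul_zero]
  · obtain ⟨C, hC, h⟩ := exists_integral_sq_olsEstimator_sub_le β τ
    have hhalf : 0 < |β i| / 2 := by positivity
    have h1 := (tendsto_abs_div_natCast hlam).eventually_lt_const hhalf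
    have h2 := (tendsto_abs_div_natCast (hlam.add hδ)).eventually_lt_const hhalf
    have hlim : Tendsto (fun n : ℕ => 8 / β i ^ 2 * (C / n)) atTop (𝓝 0) := by
      simpa using (tendsto_const_div_atTop_nhds_zero_nat C).const_mul (8 / β i ^ 2)
    rw [tendsto_iff_dist_tendsto_zero]
    refine squeeze_zero' (Eventually.of_forall fun _ => dist_nonneg) ?_ hlim
    filter_upwards [h1, h2, hne, eventually_ge_atTop (2 * p + 3)] with n hn1 hn2 hnδ hn
    have hn0 : (0 : ℝ) < n := by
      have : 0 < n := by omega
      exact_mod_cast this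
    obtain ⟨hL, hle⟩ := h n hn i
    set μ := Measure.pi fun _ : Fin n => linearModelLaw β τ with hμ
    have hint : Integrable (fun z : Fin n → DataPoint p => n / δ n * (stEstimator (lam n) z i -
        stEstimator (lam n + δ n) z i)) μ :=
      (((memLp_stEstimator β τ hn _ i).sub (memLp_stEstimator β τ hn _ i)).integrable
        one_le_two).const_mul _
    have hpt : ∀ z : Fin n → DataPoint p, |n / δ n * (stEstimator (lam n) z i -
        stEstimator (lam n + δ n) z i) - Real.sign (β i)| ≤
          8 / β i ^ 2 * (olsEstimator z i - β i) ^ 2 := fun z => by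
      have e : (n : ℝ) / δ n = ((lam n + δ n) / n - lam n / n)⁻¹ := by
        rw [← sub_div, add_sub_cancel_left, inv_div]
      rw [e]
      refine abs_softThreshold_sub_div_sub_sign_le hi ?_ ?_ ?_ _
      · exact (div_le_div_of_nonneg_right (le_abs_self _) hn0.le).trans hn1.le
      · exact (div_le_div_of_nonneg_right (le_abs_self _) hn0.le).trans hn2.le
      · intro heq
        rw [div_left_inj' hn0.ne'] at heq
        exact hnδ (by linarith)
    have e1 : n / δ n * ∫ z, (stEstimator (lam n) z i - stEstimator (lam n + δ n) z i) ∂μ -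
        Real.sign (β i) = ∫ z, (n / δ n * (stEstimator (lam n) z i -
          stEstimator (lam n + δ n) z i) - Real.sign (β i)) ∂μ := by
      rw [integral_sub hint (integrable_const _), integral_const_mul]
      simp
    rw [Real.dist_eq, e1]
    refine abs_integral_le_integral_abs.trans ?_
    refine (integral_mono (hint.sub (integrable_const _)).abs
      (hL.integrable_sq.const_mul _) hpt).trans ?_
    rw [integral_const_mul]
    gcongr

/-- After rescaling, the first factor is at most `1` in absolute value, and the second tends to zero
in `L¹` by consistency. -/
theorem tendsto_integral_stEstimator_sub_mul (hδ : ∀ᶠ n : ℕ in atTop, δ n ≠ 0) {l : ℕ → ℝ}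
    (hl : l =o[atTop] (fun n : ℕ => (n : ℝ))) (i j : Fin p) :
    Tendsto (fun n : ℕ => n / δ n * ∫ z, (stEstimator (lam n) z i -
      stEstimator (lam n + δ n) z i) * (stEstimator (l n) z j - β j)
      ∂(Measure.pi fun _ : Fin n => linearModelLaw β τ)) atTop (𝓝 0) := by
  obtain ⟨C, hC, h⟩ := exists_integral_abs_olsEstimator_sub_le β τ
  have hlim : Tendsto (fun n : ℕ => |l n| / n + C / √n) atTop (𝓝 0) := by
    have h2 : Tendsto (fun n : ℕ => C / √(n : ℝ)) atTop (𝓝 0) :=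
      (Real.tendsto_sqrt_atTop.comp tendsto_natCast_atTop_atTop).const_div_atTop C
    simpa using (tendsto_abs_div_natCast hl).add h2
  refine squeeze_zero_norm' ?_ hlim
  filter_upwards [hδ, eventually_ge_atTop (2 * p + 3)] with n hnδ hn
  have hn0 : (0 : ℝ) < n := by
    have : 0 < n := by omega
    exact_mod_cast this
  set μ := Measure.pi fun _ : Fin n => linearModelLaw β τ with hμ
  have hols := (memLp_olsEstimator_sub β τ hn j).integrable one_le_two
  rw [← integral_const_mul, Real.norm_eq_abs]
  refine abs_integral_le_integral_abs.trans ?_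
  have hpt : ∀ z : Fin n → DataPoint p, |n / δ n * ((stEstimator (lam n) z i -
      stEstimator (lam n + δ n) z i) * (stEstimator (l n) z j - β j))| ≤
        |l n| / n + |olsEstimator z j - β j| := fun z => by
    have h1 := abs_stEstimator_sub_le (lam n) (lam n + δ n) z i
    have h2 := abs_stEstimator_sub_olsEstimator_le (l n) z j
    rw [← mul_assoc, abs_mul]
    have h3 : |n / δ n * (stEstimator (lam n) z i - stEstimator (lam n + δ n) z i)| ≤ 1 := by
      rw [abs_mul, abs_div, Nat.abs_cast, div_mul_eq_mul_div, div_le_one (abs_pos.2 hnδ)]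
      have : |lam n - (lam n + δ n)| = |δ n| := by rw [sub_add_cancel_left, abs_neg]
      rw [this, le_div_iff₀ hn0] at h1
      linarith
    have h4 : |stEstimator (l n) z j - β j| ≤ |l n| / n + |olsEstimator z j - β j| := by
      have := abs_add_le (stEstimator (l n) z j - olsEstimator z j) (olsEstimator z j - β j)
      rw [sub_add_sub_cancel] at this
      linarith
    refine (mul_le_of_le_one_left (abs_nonneg _) h3).trans h4
  refine (integral_mono_of_nonneg (Eventually.of_forall fun _ => abs_nonneg _)
    ((integrable_const _).add hols.abs) (Eventually.of_forall hpt)).trans ?_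
  rw [integral_add' (integrable_const _) hols.abs]
  simp only [integral_const, probReal_univ, smul_eq_mul, one_mul]
  gcongr
  exact h n hn j

/-- The limit of the rescaled mean coefficients of the loss. -/
theorem tendsto_integral_lossCoeff (hlam : lam =o[atTop] (fun n : ℕ => (n : ℝ)))
    (hδ : δ =o[atTop] (fun n : ℕ => (n : ℝ))) (hne : ∀ᶠ n : ℕ in atTop, δ n ≠ 0)
    (a : Fin p ⊕ Fin p × Fin p) :
    Tendsto (fun n : ℕ => n / δ n * ∫ z, lossCoeff (stEstimator (lam n) z)
      (stEstimator (lam n + δ n) z) a ∂(Measure.pi fun _ : Fin n => linearModelLaw β τ)) atTop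
      (𝓝 (Sum.elim (fun i => -Real.sign (β i))
        (fun ij => Real.sign (β ij.1) * β ij.2 + β ij.1 * Real.sign (β ij.2)) a)) := by
  rcases a with i | ⟨i, j⟩
  · refine (tendsto_integral_stEstimator_sub β τ hlam hδ hne i).neg.congr fun n => ?_
    rw [← mul_neg, ← integral_neg]
    simp [lossCoeff]
  -- The increment of the product telescopes into the increment at `i` times `ST(λ)` at `j` plus the
  -- increment at `j` times `ST(λ + δ)` at `i`. The second factors are then centered at `β`.
  · have h1 := tendsto_integral_stEstimator_sub_mul β τ (lam := lam) hne hlam i j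
    have h2 := tendsto_integral_stEstimator_sub_mul β τ (lam := lam) hne (hlam.add hδ) j i
    have h3 := (tendsto_integral_stEstimator_sub β τ hlam hδ hne i).mul_const (β j)
    have h4 := (tendsto_integral_stEstimator_sub β τ hlam hδ hne j).const_mul (β i)
    have h5 := (h1.add h3).add (h2.add h4)
    rw [zero_add, zero_add] at h5
    refine h5.congr' ?_
    filter_upwards [eventually_ge_atTop (2 * p + 3)] with n hn
    have m1 := memLp_stEstimator β τ hn (lam n)
    have m2 := memLp_stEstimator β τ hn (lam n + δ n)
    set μ := Measure.pi fun _ : Fin n => linearModelLaw β τ with hμ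
    have d := fun k => (m1 k).sub (m2 k)
    have i1 : Integrable (fun z => (stEstimator (lam n) z i - stEstimator (lam n + δ n) z i) *
        (stEstimator (lam n) z j - β j)) μ :=
      (d i).integrable_mul ((m1 j).sub (memLp_const _))
    have i2 : Integrable (fun z => (stEstimator (lam n) z j - stEstimator (lam n + δ n) z j) *
        (stEstimator (lam n + δ n) z i - β i)) μ :=
      (d j).integrable_mul ((m2 i).sub (memLp_const _))
    have i3 : Integrable (fun z => (stEstimator (lam n) z i - stEstimator (lam n + δ n) z i) *
        β j) μ := ((d i).integrable one_le_two).mul_const _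
    have i4 : Integrable (fun z => (stEstimator (lam n) z j - stEstimator (lam n + δ n) z j) *
        β i) μ := ((d j).integrable one_le_two).mul_const _
    have e : ∀ z : Fin n → DataPoint p, lossCoeff (stEstimator (lam n) z)
        (stEstimator (lam n + δ n) z) (.inr (i, j)) =
        ((stEstimator (lam n) z i - stEstimator (lam n + δ n) z i) *
          (stEstimator (lam n) z j - β j) +
        (stEstimator (lam n) z i - stEstimator (lam n + δ n) z i) * β j) +
        ((stEstimator (lam n) z j - stEstimator (lam n + δ n) z j) *
          (stEstimator (lam n + δ n) z i - β i) +
        (stEstimator (lam n) z j - stEstimator (lam n + δ n) z j) * β i) := fun z => by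
      simp only [lossCoeff]; ring
    simp_rw [e]
    have i13 : Integrable (fun z => (stEstimator (lam n) z i - stEstimator (lam n + δ n) z i) *
        (stEstimator (lam n) z j - β j) +
        (stEstimator (lam n) z i - stEstimator (lam n + δ n) z i) * β j) μ := i1.add i3
    have i24 : Integrable (fun z => (stEstimator (lam n) z j - stEstimator (lam n + δ n) z j) *
        (stEstimator (lam n + δ n) z i - β i) +
        (stEstimator (lam n) z j - stEstimator (lam n + δ n) z j) * β i) μ := i2.add i4
    rw [integral_add i13 i24, integral_add i1 i3, integral_add i2 i4,
      integral_mul_const, integral_mul_const]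
    ring

/-- The limit of the rescaled variance of the mean loss given the test point. -/
theorem tendsto_lossVariance_stDiffLoss (hlam : lam =o[atTop] (fun n : ℕ => (n : ℝ)))
    (hδ : δ =o[atTop] (fun n : ℕ => (n : ℝ))) (hne : ∀ᶠ n : ℕ in atTop, δ n ≠ 0) :
    Tendsto (fun n : ℕ => (n : ℝ) ^ 2 / δ n ^ 2 *
        lossVariance (linearModelLaw β τ) (n := n) (stDiffLoss (lam n) (lam n + δ n)))
      atTop (𝓝 (4 * τ ^ 2 * hammingNorm β)) := by
  set c : Fin p ⊕ Fin p × Fin p → ℝ := Sum.elim (fun i => -Real.sign (β i))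
    (fun ij => Real.sign (β ij.1) * β ij.2 + β ij.1 * Real.sign (β ij.2)) with hc
  have hlim := tendsto_integral_lossCoeff β τ hlam hδ hne
  -- The variance is a quadratic form in the mean coefficients, so it passes to the limit entrywise.
  have hsum := tendsto_finsetSum Finset.univ fun a _ => tendsto_finsetSum Finset.univ fun b _ =>
    ((hlim a).mul (hlim b)).mul_const cov[lossMonomial p a, lossMonomial p b; linearModelLaw β τ]
  rw [← hc, ← variance_sum_mul (memLp_lossMonomial β τ), variance_sum_mul_lossMonomial] at hsum
  have hval : 4 * τ ^ 2 * ∑ i, c (.inl i) ^ 2 +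
      Var[fun x : Fin p → ℝ => 2 * (x ⬝ᵥ β) * (∑ i, c (.inl i) * x i) +
        ∑ i, ∑ j, c (.inr (i, j)) * (x i * x j); Measure.pi fun _ => gaussianReal 0 1] =
      4 * τ ^ 2 * hammingNorm β := by
    -- At the limiting coefficients the regressor part cancels identically; only the noise
    -- contribution survives.
    have h1 : (fun x : Fin p → ℝ => 2 * (x ⬝ᵥ β) * (∑ i, c (.inl i) * x i) +
        ∑ i, ∑ j, c (.inr (i, j)) * (x i * x j)) = 0 := by
      ext x
      have h2 : ∑ i, ∑ j, c (.inr (i, j)) * (x i * x j) =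
          2 * ((x ⬝ᵥ β) * ∑ i, Real.sign (β i) * x i) := by
        have h3 : ∑ i, ∑ j, c (.inr (i, j)) * (x i * x j) =
            (∑ i, Real.sign (β i) * x i) * (x ⬝ᵥ β) + (x ⬝ᵥ β) * ∑ i, Real.sign (β i) * x i := by
          rw [dotProduct, Finset.sum_mul_sum, Finset.sum_mul_sum, ← Finset.sum_add_distrib]
          refine Finset.sum_congr rfl fun i _ => ?_
          rw [← Finset.sum_add_distrib]
          refine Finset.sum_congr rfl fun j _ => ?_
          simp only [hc, Sum.elim_inr]
          ring
        rw [h3]; ring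
      rw [h2]
      simp only [hc, Sum.elim_inl, neg_mul, Finset.sum_neg_distrib, Pi.zero_apply]
      ring
    rw [h1, variance_zero, add_zero]
    congr 1
    have h4 : ∀ i, c (.inl i) ^ 2 = if β i ≠ 0 then (1 : ℝ) else 0 := fun i => by
      simp only [hc, Sum.elim_inl, neg_sq]
      rcases lt_trichotomy (β i) 0 with h | h | h
      · simp [Real.sign_of_neg h, h.ne]
      · simp [h]
      · simp [Real.sign_of_pos h, h.ne']
    simp_rw [h4]
    rw [Finset.sum_boole, hammingNorm]
  rw [hval] at hsum
  refine hsum.congr' ?_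
  filter_upwards [eventually_ge_atTop (2 * p + 3)] with n hn
  rw [lossVariance_stDiffLoss β τ hn, variance_sum_mul (memLp_lossMonomial β τ), Finset.mul_sum]
  refine Finset.sum_congr rfl fun a _ => ?_
  rw [Finset.mul_sum]
  refine Finset.sum_congr rfl fun b _ => ?_
  ring

end Limit

end

noncomputable section

/-! ### Fluctuations of the least squares estimator on replacing a data point -/

/-- Designs whose Gram matrix is of the order of the number of rows, as far as the `i`-th
coefficient is concerned. -/
def regularDesign {n p : ℕ} (K : ℝ) (i : Fin p) : Set (Fin n → Fin p → ℝ) :=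
  {X | (designGram X).det ≠ 0 ∧ designGram X i i ≤ K * n ∧ ∀ j, (designGram X)⁻¹ j j ≤ K / n}

theorem measurableSet_regularDesign {n p : ℕ} (K : ℝ) (i : Fin p) :
    MeasurableSet (regularDesign (n := n) K i) := by
  refine MeasurableSet.inter ?_ (MeasurableSet.inter ?_ ?_)
  · exact (measurable_matrix_det measurable_designGram_apply (measurableSet_singleton 0)).compl
  · exact measurableSet_le (measurable_designGram_apply i i) measurable_const
  · have : {X : Fin n → Fin p → ℝ | ∀ j, (designGram X)⁻¹ j j ≤ K / n} =
        ⋂ j, {X | (designGram X)⁻¹ j j ≤ K / n} := by ext; simp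
    change MeasurableSet {X : Fin n → Fin p → ℝ | ∀ j, (designGram X)⁻¹ j j ≤ K / n}
    rw [this]
    exact MeasurableSet.iInter fun j =>
      measurableSet_le (measurable_designGram_inv_apply j j) measurable_const

theorem measure_lt_le_of_lintegral_le {Ω : Type*} [MeasurableSpace Ω] {μ : Measure Ω}
    {f : Ω → ℝ} (hf : Measurable f) {A B : ℝ} (hB : 0 < B)
    (h : ∫⁻ ω, ENNReal.ofReal (f ω) ∂μ ≤ ENNReal.ofReal A) :
    μ {ω | B < f ω} ≤ ENNReal.ofReal (A / B) := by
  have h1 := meas_ge_le_lintegral_div (μ := μ) hf.ennreal_ofReal.aemeasurable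
    (ε := ENNReal.ofReal B) (by simpa using hB) ENNReal.ofReal_ne_top
  rw [ENNReal.ofReal_div_of_pos hB]
  refine le_trans (measure_mono fun ω hω => ?_) (h1.trans (ENNReal.div_le_div_right h _))
  exact ENNReal.ofReal_le_ofReal (le_of_lt hω)

theorem lintegral_designGram_diag {n p : ℕ} (i : Fin p) :
    ∫⁻ X, ENNReal.ofReal (designGram X i i) ∂(gaussianDesign n p) = ENNReal.ofReal n := by
  have h : ∀ X : Fin n → Fin p → ℝ, ENNReal.ofReal (designGram X i i) =
      ∑ k, ENNReal.ofReal (X k i ^ 2) := fun X => by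
    rw [designGram_apply, ENNReal.ofReal_sum_of_nonneg fun k _ => mul_self_nonneg _]
    simp_rw [sq]
  simp_rw [h]
  rw [lintegral_finsetSum _ fun k _ => by fun_prop]
  have h2 : ∀ k, ∫⁻ X : Fin n → Fin p → ℝ, ENNReal.ofReal (X k i ^ 2) ∂(gaussianDesign n p) = 1 :=
    fun k => by
      have hm : MeasurePreserving (fun X : Fin n → Fin p → ℝ => X k i) (gaussianDesign n p)
          (gaussianReal 0 1) :=
        (measurePreserving_eval (fun _ : Fin p => gaussianReal 0 1) i).comp
          (measurePreserving_eval (fun _ : Fin n => Measure.pi fun _ : Fin p => gaussianReal 0 1) k)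
      rw [hm.lintegral_comp (f := fun x => ENNReal.ofReal (x ^ 2)) (by fun_prop),
        lintegral_sq_gaussianReal]
      rfl
  simp [h2]

theorem exists_le_measure_regularDesign (p : ℕ) :
    ∃ K : ℝ, 1 ≤ K ∧ ∀ n : ℕ, 2 * p + 3 ≤ n → ∀ i : Fin p,
      ENNReal.ofReal (1 / 2) ≤ gaussianDesign n p (regularDesign K i) := by
  obtain ⟨C, hC, h⟩ := exists_lintegral_designGram_inv_diag_le p
  -- By Markov's inequality the exceptional events have total probability at most `1 / K + p C / K`,
  -- which is `1 / 2` for this `K`.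
  set K : ℝ := 2 * (1 + p * C) with hK
  have hpC : 0 ≤ p * C := by positivity
  have hK1 : 1 ≤ K := by linarith
  refine ⟨K, hK1, fun n hn i => ?_⟩
  have hn0 : (0 : ℝ) < n := by
    have : 0 < n := by omega
    exact_mod_cast this
  have hcompl : gaussianDesign n p (regularDesign K i)ᶜ ≤ ENNReal.ofReal (1 / 2) := by
    have hsub : (regularDesign K i)ᶜ ⊆ {X : Fin n → Fin p → ℝ | ¬ (designGram X).det ≠ 0} ∪
        ({X | K * n < designGram X i i} ∪ ⋃ j, {X | K / n < (designGram X)⁻¹ j j}) := by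
      intro X hX
      by_contra h0
      simp only [Set.mem_union, Set.mem_ofPred_eq, Set.mem_iUnion, not_or, not_not, not_lt,
        not_exists] at h0
      exact hX ⟨h0.1, h0.2.1, h0.2.2⟩
    refine (measure_mono hsub).trans ((measure_union_le _ _).trans ?_)
    have h0 : gaussianDesign n p {X | ¬ (designGram X).det ≠ 0} = 0 :=
      ae_designGram_det_ne_zero (by omega)
    rw [h0, zero_add]
    refine (measure_union_le _ _).trans ?_
    have h1 : gaussianDesign n p {X | K * n < designGram X i i} ≤ ENNReal.ofReal (1 / K) := by
      refine (measure_lt_le_of_lintegral_le (measurable_designGram_apply i i) (by positivity)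
        (lintegral_designGram_diag i).le).trans_eq ?_
      congr 1
      field_simp
    have h2 : gaussianDesign n p (⋃ j, {X | K / n < (designGram X)⁻¹ j j}) ≤
        ENNReal.ofReal (p * (C / K)) := by
      refine (measure_iUnion_fintype_le _ _).trans ((Finset.sum_le_sum fun j _ =>
        measure_lt_le_of_lintegral_le (measurable_designGram_inv_apply j j) (by positivity)
          (h n hn j)).trans_eq ?_)
      rw [Finset.sum_const, Finset.card_univ, Fintype.card_fin, nsmul_eq_mul,
        ENNReal.ofReal_mul (by positivity), ENNReal.ofReal_natCast]
      congr 2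
      field_simp
    refine (add_le_add h1 h2).trans ?_
    rw [← ENNReal.ofReal_add (by positivity) (by positivity)]
    refine ENNReal.ofReal_le_ofReal (le_of_eq ?_)
    rw [hK]
    field_simp
  have hadd := prob_add_prob_compl (μ := gaussianDesign n p) (measurableSet_regularDesign K i)
  have h12 : ENNReal.ofReal (1 / 2) + ENNReal.ofReal (1 / 2) = 1 := by
    rw [← ENNReal.ofReal_add (by norm_num) (by norm_num)]; norm_num
  by_contra hlt
  rw [not_le] at hlt
  have := ENNReal.add_lt_add_of_lt_of_le (ne_top_of_le_ne_top ENNReal.ofReal_ne_top hcompl)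
    hlt hcompl
  rw [hadd, h12] at this
  exact lt_irrefl _ this

/-- The centered Gaussian density decreases on the positive half-line, so on the interval it is
smallest at the right endpoint. -/
theorem le_gaussianReal_Icc {a d : ℝ} (ha : 0 ≤ a) (hd : 0 ≤ d) {v : NNReal} (hv : v ≠ 0) :
    ENNReal.ofReal (d * gaussianPDFReal 0 v (a + d)) ≤ gaussianReal 0 v (Set.Icc a (a + d)) := by
  rw [gaussianReal_apply _ hv]
  have h : ∫⁻ _ in Set.Icc a (a + d), ENNReal.ofReal (gaussianPDFReal 0 v (a + d)) ≤
      ∫⁻ x in Set.Icc a (a + d), gaussianPDF 0 v x := by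
    refine setLIntegral_mono' measurableSet_Icc fun x hx => ENNReal.ofReal_le_ofReal ?_
    rw [gaussianPDFReal, gaussianPDFReal]
    have h1 : 0 ≤ x := ha.trans hx.1
    gcongr
    · simpa using hx.2
  refine le_trans (le_of_eq ?_) h
  rw [setLIntegral_const, Real.volume_Icc, add_sub_cancel_left, mul_comm d,
    ENNReal.ofReal_mul (gaussianPDFReal_nonneg _ _ _)]

/-- With variance within a factor `K` of `τ² / n`, the density at a point of size `O(1 / √n)` is at
least of order `√n`; multiplied by a length of order `1 / n` it gives `1 / √n`. -/
theorem le_mul_gaussianPDFReal {τ K D M d x n : ℝ} (hτ : 0 < τ) (hK : 1 ≤ K) (hD : 0 < D)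
    (hn : 0 < n) (hd : D / n ≤ d) (hx : x ^ 2 * n ≤ M) {v : NNReal}
    (hv₁ : τ ^ 2 / (K * n) ≤ v) (hv₂ : (v : ℝ) ≤ τ ^ 2 * K / n) :
    D * (√(2 * Real.pi * (τ ^ 2 * K)))⁻¹ * Real.exp (-(M * K / (2 * τ ^ 2))) / √n ≤
      d * gaussianPDFReal 0 v x := by
  have hv0 : (0 : ℝ) < v := lt_of_lt_of_le (by positivity) hv₁
  have hsn : 0 < √n := Real.sqrt_pos.2 hn
  rw [gaussianPDFReal, sub_zero]
  have h1 : (√(2 * Real.pi * (τ ^ 2 * K)))⁻¹ * √n ≤ (√(2 * Real.pi * v))⁻¹ := by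
    rw [← inv_inv (√n), ← mul_inv]
    refine inv_anti₀ (by positivity) ?_
    rw [← Real.sqrt_inv, ← Real.sqrt_mul (by positivity)]
    refine Real.sqrt_le_sqrt ?_
    rw [mul_assoc (2 * Real.pi), ← div_eq_mul_inv]
    gcongr
  have h2 : Real.exp (-(M * K / (2 * τ ^ 2))) ≤ Real.exp (-x ^ 2 / (2 * v)) := by
    refine Real.exp_le_exp.2 ?_
    rw [neg_div, neg_le_neg_iff, div_le_div_iff₀ (by positivity) (by positivity)]
    rw [div_le_iff₀ (by positivity)] at hv₁
    have h3 : 0 ≤ x ^ 2 := sq_nonneg x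
    calc x ^ 2 * (2 * τ ^ 2) ≤ x ^ 2 * (2 * (v * (K * n))) := by gcongr
      _ = (x ^ 2 * n) * K * (2 * v) := by ring
      _ ≤ M * K * (2 * v) := by gcongr
  calc D * (√(2 * Real.pi * (τ ^ 2 * K)))⁻¹ * Real.exp (-(M * K / (2 * τ ^ 2))) / √n
      = D / n * ((√(2 * Real.pi * (τ ^ 2 * K)))⁻¹ * √n * Real.exp (-(M * K / (2 * τ ^ 2)))) := by
        have : 1 / √n = √n / n := by
          rw [div_eq_div_iff hsn.ne' hn.ne', Real.mul_self_sqrt hn.le, one_mul]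
        rw [div_eq_mul_one_div, this]
        ring
    _ ≤ d * ((√(2 * Real.pi * v))⁻¹ * Real.exp (-x ^ 2 / (2 * v))) := by
        have hd0 : 0 ≤ d := le_trans (by positivity) hd
        gcongr

variable {p : ℕ} (β : Fin p → ℝ) {τ : ℝ}

/-- A vanishing coefficient of the least squares estimator falls into a short interval with
probability of the order `√n` times its length. -/
theorem exists_le_measure_olsEstimator_mem_Icc (hτ : 0 < τ) {K : ℝ} (hK : 1 ≤ K)
    (hreg : ∀ n : ℕ, 2 * p + 3 ≤ n → ∀ i : Fin p,
      ENNReal.ofReal (1 / 2) ≤ gaussianDesign n p (regularDesign K i))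
    {D : ℝ} (hD : 0 < D) (M : ℝ) :
    ∃ c : ℝ, 0 < c ∧ ∀ n : ℕ, 2 * p + 3 ≤ n → ∀ i : Fin p, β i = 0 → ∀ a d : ℝ, 0 ≤ a →
      D / n ≤ d → (a + d) ^ 2 * n ≤ M →
      ENNReal.ofReal (c / √n) ≤ (Measure.pi fun _ : Fin n => linearModelLaw β τ)
        {z | olsEstimator z i ∈ Set.Icc a (a + d) ∧ (fun k => (z k).1) ∈ regularDesign K i} := by
  set c₀ := D * (√(2 * Real.pi * (τ ^ 2 * K)))⁻¹ * Real.exp (-(M * K / (2 * τ ^ 2))) with hc₀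
  have hc₀pos : 0 < c₀ := by positivity
  -- `c₀ / √n` bounds the conditional probability given a regular design, and `1 / 2` the
  -- probability of such a design.
  refine ⟨c₀ * (1 / 2), by positivity, fun n hn i hi a d ha hd haM => ?_⟩
  have hn0 : (0 : ℝ) < n := by
    have : 0 < n := by omega
    exact_mod_cast this
  have hd0 : 0 ≤ d := le_trans (by positivity) hd
  have hmp := measurePreserving_linearModelData β τ n
  have hS : MeasurableSet {z : Fin n → DataPoint p | olsEstimator z i ∈ Set.Icc a (a + d) ∧
      (fun k => (z k).1) ∈ regularDesign K i} :=
    ((measurable_olsEstimator_apply i) measurableSet_Icc).inter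
      ((by fun_prop : Measurable fun (z : Fin n → DataPoint p) k => (z k).1)
        (measurableSet_regularDesign K i))
  rw [← hmp.measure_preimage hS.nullMeasurableSet,
    Measure.prod_apply (hmp.measurable hS)]
  have hpt : ∀ X : Fin n → Fin p → ℝ,
      (regularDesign K i).indicator (fun _ => ENNReal.ofReal (c₀ / √n)) X ≤
        (Measure.pi fun _ : Fin n => gaussianReal 0 (τ ^ 2).toNNReal) (Prod.mk X ⁻¹'
          (linearModelData β ⁻¹' {z | olsEstimator z i ∈ Set.Icc a (a + d) ∧
            (fun k => (z k).1) ∈ regularDesign K i})) := by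
    intro X
    by_cases hX : X ∈ regularDesign K i
    · rw [Set.indicator_of_mem hX]
      have hset : (Prod.mk X ⁻¹' (linearModelData β ⁻¹' {z | olsEstimator z i ∈ Set.Icc a (a + d) ∧
            (fun k => (z k).1) ∈ regularDesign K i})) =
          (fun e : Fin n → ℝ => ∑ k, olsMap X i k * e k) ⁻¹' Set.Icc a (a + d) := by
        ext e
        simp only [Set.mem_preimage, Set.mem_ofPred_eq]
        have h1 := olsEstimator_linearModelData β hX.1 e i
        rw [hi, sub_zero] at h1
        rw [h1]
        exact and_iff_left hX
      have hmeas : Measurable fun e : Fin n → ℝ => ∑ k, olsMap X i k * e k := by fun_prop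
      rw [hset, ← Measure.map_apply hmeas measurableSet_Icc, map_olsMap_gaussianReal]
      have h1 := one_le_designGram_diag_mul_inv_diag X hX.1 i
      have hinv0 := designGram_inv_diag_nonneg X i
      have hinv : 1 / (K * n) ≤ (designGram X)⁻¹ i i := by
        rw [div_le_iff₀ (by positivity)]
        nlinarith [hX.2.1]
      have hinv' : 0 < (designGram X)⁻¹ i i := lt_of_lt_of_le (by positivity) hinv
      have hv : (((τ ^ 2).toNNReal * ((designGram X)⁻¹ i i).toNNReal : NNReal) : ℝ) =
          τ ^ 2 * (designGram X)⁻¹ i i := by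
        rw [NNReal.coe_mul, Real.coe_toNNReal _ (sq_nonneg _), Real.coe_toNNReal _ hinv0]
      have hv0 : (τ ^ 2).toNNReal * ((designGram X)⁻¹ i i).toNNReal ≠ 0 := by
        rw [← NNReal.coe_ne_zero, hv]
        positivity
      refine le_trans (ENNReal.ofReal_le_ofReal ?_) (le_gaussianReal_Icc ha hd0 hv0)
      refine le_mul_gaussianPDFReal hτ hK hD hn0 hd haM ?_ ?_
      · rw [hv]
        calc τ ^ 2 / (K * n) = τ ^ 2 * (1 / (K * n)) := by ring
          _ ≤ _ := by gcongr
      · rw [hv, mul_div_assoc]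
        exact mul_le_mul_of_nonneg_left (hX.2.2 i) (sq_nonneg τ)
    · rw [Set.indicator_of_notMem hX]
      exact zero_le
  refine le_trans ?_ (lintegral_mono hpt)
  rw [lintegral_indicator_const (measurableSet_regularDesign K i), mul_div_right_comm,
    ENNReal.ofReal_mul (by positivity)]
  gcongr
  exact hreg n hn i

/-- Chebyshev and a union bound. The rate `1 / n` is negligible against the `1 / √n` of the window
event, so the two can be intersected. -/
theorem exists_measure_olsEstimator_sub_gt_le (τ : ℝ) :
    ∃ C : ℝ, 0 < C ∧ ∀ n : ℕ, 2 * p + 3 ≤ n →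
      (Measure.pi fun _ : Fin n => linearModelLaw β τ)
        {z | ¬ ∀ j, |olsEstimator z j - β j| ≤ 1} ≤ ENNReal.ofReal (C / n) := by
  obtain ⟨C, hC, h⟩ := exists_integral_sq_olsEstimator_sub_le β τ
  refine ⟨p * C + 1, by positivity, fun n hn => ?_⟩
  have hn0 : (0 : ℝ) < n := by
    have : 0 < n := by omega
    exact_mod_cast this
  have hsub : {z : Fin n → DataPoint p | ¬ ∀ j, |olsEstimator z j - β j| ≤ 1} ⊆
      ⋃ j, {z | 1 < (olsEstimator z j - β j) ^ 2} := by
    intro z hz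
    simp only [Set.mem_ofPred_eq, not_forall, not_le] at hz
    obtain ⟨j, hj⟩ := hz
    refine Set.mem_iUnion.2 ⟨j, ?_⟩
    rw [Set.mem_ofPred_eq, ← sq_abs]
    nlinarith
  refine (measure_mono hsub).trans ((measure_iUnion_fintype_le _ _).trans ?_)
  have h1 : ∀ j, (Measure.pi fun _ : Fin n => linearModelLaw β τ)
      {z | 1 < (olsEstimator z j - β j) ^ 2} ≤ ENNReal.ofReal (C / n) := fun j => by
    have hm : Measurable fun z : Fin n → DataPoint p => (olsEstimator z j - β j) ^ 2 :=
      ((measurable_olsEstimator_apply j).sub_const _).pow_const 2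
    have h2 := measure_lt_le_of_lintegral_le (A := C / n) hm one_pos (by
      rw [← ofReal_integral_eq_lintegral_ofReal (h n hn j).1.integrable_sq
        (Eventually.of_forall fun z => sq_nonneg _)]
      exact ENNReal.ofReal_le_ofReal (h n hn j).2)
    rwa [div_one] at h2
  refine (Finset.sum_le_sum fun j _ => h1 j).trans ?_
  rw [Finset.sum_const, Finset.card_univ, Fintype.card_fin, nsmul_eq_mul, ← ENNReal.ofReal_natCast,
    ← ENNReal.ofReal_mul (by positivity)]
  refine ENNReal.ofReal_le_ofReal ?_
  rw [mul_div_assoc']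
  gcongr
  linarith

/-- The normalized form `v·x / ‖v‖` is standard Gaussian for every `v`, so the half-space has a
probability independent of `v`. Truncating the coordinates at a large `R` costs at most half of it.
It is applied to `v` a row of the inverse Gram matrix. -/
theorem exists_le_measure_dotProduct_ge (p : ℕ) :
    ∃ R κ : ℝ, 0 < R ∧ 0 < κ ∧ ∀ v : Fin p → ℝ, v ≠ 0 →
      ENNReal.ofReal κ ≤ (Measure.pi fun _ : Fin p => gaussianReal 0 1)
        {x | √(∑ j, v j ^ 2) ≤ ∑ j, v j * x j ∧ ∀ j, |x j| ≤ R} := by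
  have hopen : 0 < gaussianReal 0 1 (Set.Ici 1) := by
    rw [pos_iff_ne_zero]
    intro h0
    have h1 := gaussianReal_absolutelyContinuous' 0 (one_ne_zero : (1 : NNReal) ≠ 0) h0
    simp at h1
  set κ₀ := (gaussianReal 0 1 (Set.Ici 1)).toReal with hκ₀
  have hκ₀pos : 0 < κ₀ := ENNReal.toReal_pos hopen.ne' (measure_ne_top _ _)
  have hκ₀' : gaussianReal 0 1 (Set.Ici 1) = ENNReal.ofReal κ₀ :=
    (ENNReal.ofReal_toReal (measure_ne_top _ _)).symm
  set R₂ : ℝ := 2 * p / κ₀ + 1 with hR₂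
  have hR₂pos : 0 < R₂ := by positivity
  refine ⟨√R₂, κ₀ / 2, Real.sqrt_pos.2 hR₂pos, by positivity, fun v hv => ?_⟩
  set μ := Measure.pi fun _ : Fin p => gaussianReal 0 1 with hμ
  set ρ := √(∑ j, v j ^ 2) with hρ
  have hsum : 0 < ∑ j, v j ^ 2 := by
    obtain ⟨j, hj⟩ := Function.ne_iff.1 hv
    refine Finset.sum_pos' (fun _ _ => sq_nonneg _) ⟨j, Finset.mem_univ _, ?_⟩
    have : v j ≠ 0 := hj
    positivity
  have hρpos : 0 < ρ := Real.sqrt_pos.2 hsum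
  have h1 : μ {x | ρ ≤ ∑ j, v j * x j} = ENNReal.ofReal κ₀ := by
    have hmeas : Measurable fun x : Fin p → ℝ => ∑ j, v j * x j := by fun_prop
    have e1 : {x : Fin p → ℝ | ρ ≤ ∑ j, v j * x j} =
        (fun x => ∑ j, v j * x j) ⁻¹' Set.Ici ρ := rfl
    rw [e1, ← Measure.map_apply hmeas measurableSet_Ici, map_sum_mul_pi_gaussianReal, ← hκ₀']
    have e2 : (gaussianReal 0 1).map (ρ * ·) =
        gaussianReal 0 (1 * ∑ k, (v k ^ 2).toNNReal) := by
      rw [gaussianReal_map_const_mul, mul_zero, mul_comm]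
      congr 2
      ext
      rw [NNReal.coe_sum]
      simp only [Real.coe_toNNReal _ (sq_nonneg _)]
      exact Real.sq_sqrt hsum.le
    rw [← e2, Measure.map_apply (by fun_prop) measurableSet_Ici]
    congr 1
    ext x
    simp [le_mul_iff_one_le_right hρpos]
  have h2 : μ (⋃ j, {x | R₂ < x j ^ 2}) ≤ ENNReal.ofReal (κ₀ / 2) := by
    refine (measure_iUnion_fintype_le _ _).trans ?_
    have h3 : ∀ j, μ {x | R₂ < x j ^ 2} ≤ ENNReal.ofReal (1 / R₂) := fun j => by
      refine measure_lt_le_of_lintegral_le (by fun_prop) hR₂pos ?_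
      rw [(measurePreserving_eval (fun _ : Fin p => gaussianReal 0 1) j).lintegral_comp
        (f := fun x => ENNReal.ofReal (x ^ 2)) (by fun_prop), lintegral_sq_gaussianReal]
      simp
    refine (Finset.sum_le_sum fun j _ => h3 j).trans ?_
    rw [Finset.sum_const, Finset.card_univ, Fintype.card_fin, nsmul_eq_mul,
      ← ENNReal.ofReal_natCast, ← ENNReal.ofReal_mul (by positivity)]
    refine ENNReal.ofReal_le_ofReal ?_
    rw [mul_one_div, div_le_iff₀ hR₂pos, hR₂, mul_add, mul_one]
    have : κ₀ / 2 * (2 * p / κ₀) = p := by field_simp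
    rw [this]
    linarith
  have hsub : {x : Fin p → ℝ | ρ ≤ ∑ j, v j * x j} ⊆
      {x | ρ ≤ ∑ j, v j * x j ∧ ∀ j, |x j| ≤ √R₂} ∪ ⋃ j, {x | R₂ < x j ^ 2} := by
    intro x hx
    by_cases hR : ∀ j, |x j| ≤ √R₂
    · exact Or.inl ⟨hx, hR⟩
    · push Not at hR
      obtain ⟨j, hj⟩ := hR
      refine Or.inr (Set.mem_iUnion.2 ⟨j, ?_⟩)
      rw [Set.mem_ofPred_eq, ← sq_abs]
      exact (Real.sqrt_lt' (lt_of_le_of_lt (Real.sqrt_nonneg _) hj)).1 hj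
  have h3 := (measure_mono hsub).trans (measure_union_le (μ := μ) _ _)
  rw [h1] at h3
  have h4 : ENNReal.ofReal κ₀ = ENNReal.ofReal (κ₀ / 2) + ENNReal.ofReal (κ₀ / 2) := by
    rw [← ENNReal.ofReal_add (by positivity) (by positivity), add_halves]
  rw [h4] at h3
  exact (ENNReal.add_le_add_iff_right ENNReal.ofReal_ne_top).1
    (h3.trans (add_le_add le_rfl h2))

end

noncomputable section

/-! ### The effect of one additional data point on the least squares estimator. -/

section Perturbation

variable {p m : ℕ} {β : Fin p → ℝ} {K R D d : ℝ} {i : Fin p} {w : Fin m → DataPoint p}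

theorem inv_le_designGram_inv_diag {X : Fin m → Fin p → ℝ} (hm : 1 ≤ m) (hK : 1 ≤ K)
    (hX : X ∈ regularDesign K i) : (K * m)⁻¹ ≤ (designGram X)⁻¹ i i := by
  have hm0 : (0 : ℝ) < m := by exact_mod_cast hm
  have h1 := one_le_designGram_diag_mul_inv_diag X hX.1 i
  have h2 := designGram_inv_diag_nonneg X i
  rw [inv_eq_one_div, div_le_iff₀ (by positivity)]
  nlinarith [hX.2.1]

theorem inv_le_inv_mulVec_apply {X : Fin m → Fin p → ℝ} (hm : 1 ≤ m) (hK : 1 ≤ K)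
    (hX : X ∈ regularDesign K i) {x : Fin p → ℝ}
    (hx : √(∑ j, (designGram X)⁻¹ i j ^ 2) ≤ ∑ j, (designGram X)⁻¹ i j * x j) :
    (K * m)⁻¹ ≤ ((designGram X)⁻¹ *ᵥ x) i := by
  refine (inv_le_designGram_inv_diag hm hK hX).trans (le_trans ?_ hx)
  refine Real.le_sqrt_of_sq_le ?_
  exact Finset.single_le_sum (f := fun j => (designGram X)⁻¹ i j ^ 2) (fun j _ => sq_nonneg _)
    (Finset.mem_univ i)

theorem dotProduct_inv_mulVec_le_of_regularDesign {X : Fin m → Fin p → ℝ} (hm : 1 ≤ m)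
    (hK : 1 ≤ K) (hX : X ∈ regularDesign K i) {x : Fin p → ℝ} (hx : ∀ j, |x j| ≤ R) :
    x ⬝ᵥ (designGram X)⁻¹ *ᵥ x ≤ p ^ 2 * R ^ 2 * K := by
  have hm0 : (1 : ℝ) ≤ m := by exact_mod_cast hm
  have h1 : ∑ j, x j ^ 2 ≤ p * R ^ 2 := by
    refine (Finset.sum_le_sum (g := fun _ => R ^ 2) fun j _ => ?_).trans_eq (by simp)
    rw [← sq_abs]
    exact pow_le_pow_left₀ (abs_nonneg _) (hx j) 2
  have h2 : ∑ j, (designGram X)⁻¹ j j ≤ p * K := by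
    refine (Finset.sum_le_sum (g := fun _ => K) fun j _ => ?_).trans_eq (by simp)
    exact (hX.2.2 j).trans (div_le_self (by linarith) hm0)
  refine (dotProduct_inv_mulVec_le X x).trans ((mul_le_mul h1 h2
    (Finset.sum_nonneg fun j _ => designGram_inv_diag_nonneg X j) (by positivity)).trans_eq ?_)
  ring

theorem abs_dotProduct_le {x y : Fin p → ℝ} (hx : ∀ j, |x j| ≤ R) (hy : ∀ j, |y j| ≤ 1) :
    |x ⬝ᵥ y| ≤ p * R := by
  refine (Finset.abs_sum_le_sum_abs _ _).trans
    ((Finset.sum_le_sum (g := fun _ => R) fun j _ => ?_).trans_eq (by simp))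
  rw [abs_mul]
  nlinarith [abs_nonneg (x j), abs_nonneg (y j), hx j, hy j]

/-- A data point with regressors in the direction of the `i`-th row of the inverse Gram matrix and
large noise moves the `i`-th coefficient of the least squares estimator. -/
theorem le_abs_olsEstimator_cons_sub (hm : 1 ≤ m) (hK : 1 ≤ K) (hd : m * d ≤ D)
    (hD : 0 ≤ D)
    (hX : (fun k => (w k).1) ∈ regularDesign K i) (hw : ∀ j, |olsEstimator w j - β j| ≤ 1)
    {x : Fin p → ℝ} (hxR : ∀ j, |x j| ≤ R)
    (hx : √(∑ j, (designGram fun k => (w k).1)⁻¹ i j ^ 2) ≤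
      ∑ j, (designGram fun k => (w k).1)⁻¹ i j * x j) {e : ℝ} :
    (p * R + K * D * (1 + p ^ 2 * R ^ 2 * K) ≤ e →
      olsEstimator w i + d ≤
        olsEstimator (Fin.cons (x, x ⬝ᵥ β + e) w : Fin (m + 1) → DataPoint p) i) ∧
    (e ≤ -(p * R + K * D * (1 + p ^ 2 * R ^ 2 * K)) →
      olsEstimator (Fin.cons (x, x ⬝ᵥ β + e) w : Fin (m + 1) → DataPoint p) i ≤
        olsEstimator w i - d) := by
  have hm0 : (0 : ℝ) < m := by exact_mod_cast hm
  have hA := inv_le_inv_mulVec_apply hm hK hX hx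
  have hQ0 := dotProduct_inv_mulVec_nonneg (fun k => (w k).1) x
  have hQ := dotProduct_inv_mulVec_le_of_regularDesign hm hK hX hxR
  have hr := abs_le.1 (abs_dotProduct_le hxR hw)
  rw [olsEstimator_cons _ hX.1]
  set A := ((designGram fun k => (w k).1)⁻¹ *ᵥ x) i with hAdef
  set Q := x ⬝ᵥ (designGram fun k => (w k).1)⁻¹ *ᵥ x with hQdef
  set L := 1 + p ^ 2 * R ^ 2 * K with hL
  have hres : x ⬝ᵥ β + e - x ⬝ᵥ olsEstimator w = e - x ⬝ᵥ (fun j => olsEstimator w j - β j) := by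
    have : (fun j => olsEstimator w j - β j) = olsEstimator w - β := rfl
    rw [this, dotProduct_sub]
    ring
  have hd' : d ≤ D / m := by rwa [le_div_iff₀ hm0, mul_comm]
  have hKm : 0 < (K * m)⁻¹ := by positivity
  -- The update is leverage times residual over `1 + Q`. As `A ≥ 1 / (K m)` and `1 + Q ≤ L`, a
  -- residual of `K D L` moves the coordinate by at least `D / m ≥ d`.
  have hmain : ∀ r, K * D * L ≤ r → d ≤ A * r / (1 + Q) := by
    intro r hr
    refine hd'.trans ?_
    rw [le_div_iff₀ (by linarith)]
    calc D / m * (1 + Q) ≤ D / m * L := by gcongr; linarith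
      _ = (K * m)⁻¹ * (K * D * L) := by field_simp
      _ ≤ A * r := by
        refine mul_le_mul hA hr (mul_nonneg (by positivity) (by linarith)) (by linarith)
  simp only [hres]
  constructor
  · intro he
    have := hmain (e - x ⬝ᵥ fun j => olsEstimator w j - β j) (by linarith [hr.2])
    linarith
  · intro he
    have := hmain (-(e - x ⬝ᵥ fun j => olsEstimator w j - β j)) (by linarith [hr.1])
    rw [mul_neg, neg_div] at this
    linarith

end Perturbation

theorem gaussianReal_pos_of_volume_ne_zero {v : NNReal} (hv : v ≠ 0) {s : Set ℝ}
    (hs : volume s ≠ 0) : 0 < gaussianReal 0 v s :=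
  pos_iff_ne_zero.2 fun h => hs (gaussianReal_absolutelyContinuous' 0 hv h)

variable {p : ℕ} (β : Fin p → ℝ) {τ : ℝ}

/-- The regressor event and the tail of the noise are independent, and both have probabilities
bounded below uniformly in `m` and `w`. The tail `e ≥ e₀` gives the upward move, the tail `e ≤ -e₀`
the downward one. -/
theorem exists_le_measure_olsEstimator_cons (hτ : 0 < τ) {K : ℝ} (hK : 1 ≤ K) {D : ℝ}
    (hD : 0 ≤ D) :
    ∃ c : ℝ, 0 < c ∧ ∀ m : ℕ, 1 ≤ m → ∀ (i : Fin p) (w : Fin m → DataPoint p) (d : ℝ),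
      m * d ≤ D → (fun k => (w k).1) ∈ regularDesign K i →
      (∀ j, |olsEstimator w j - β j| ≤ 1) →
      ENNReal.ofReal c ≤ linearModelLaw β τ {z₀ | olsEstimator w i + d ≤
        olsEstimator (Fin.cons z₀ w : Fin (m + 1) → DataPoint p) i} ∧
      ENNReal.ofReal c ≤ linearModelLaw β τ {z₀ |
        olsEstimator (Fin.cons z₀ w : Fin (m + 1) → DataPoint p) i ≤ olsEstimator w i - d} := by
  obtain ⟨R, κ, hR, hκ, h⟩ := exists_le_measure_dotProduct_ge p
  set e₀ := p * R + K * D * (1 + p ^ 2 * R ^ 2 * K) with he₀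
  set v := (τ ^ 2).toNNReal with hvdef
  have hv : v ≠ 0 := (Real.toNNReal_pos.2 (by positivity)).ne'
  have h1 := gaussianReal_pos_of_volume_ne_zero hv (s := Set.Ici e₀) (by simp)
  have h2 := gaussianReal_pos_of_volume_ne_zero hv (s := Set.Iic (-e₀)) (by simp)
  set η := min (gaussianReal 0 v (Set.Ici e₀)).toReal (gaussianReal 0 v (Set.Iic (-e₀))).toReal
    with hη
  have hηpos : 0 < η := lt_min (ENNReal.toReal_pos h1.ne' (measure_ne_top _ _))
    (ENNReal.toReal_pos h2.ne' (measure_ne_top _ _))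
  have hη₁ : ENNReal.ofReal η ≤ gaussianReal 0 v (Set.Ici e₀) :=
    ENNReal.ofReal_le_of_le_toReal (min_le_left _ _)
  have hη₂ : ENNReal.ofReal η ≤ gaussianReal 0 v (Set.Iic (-e₀)) :=
    ENNReal.ofReal_le_of_le_toReal (min_le_right _ _)
  refine ⟨κ * η, by positivity, fun m hm i w d hd hX hw => ?_⟩
  have hmp := measurePreserving_linearModel β τ
  have hmeas : Measurable fun z₀ : DataPoint p =>
      olsEstimator (Fin.cons z₀ w : Fin (m + 1) → DataPoint p) i := by
    refine (measurable_olsEstimator_apply i).comp (measurable_pi_lambda _ fun k => ?_)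
    refine Fin.cases ?_ (fun k => ?_) k
    · simpa using measurable_id'
    · simp
  have hm0 : (0 : ℝ) < m := by exact_mod_cast hm
  have hrow : (fun j => (designGram fun k => (w k).1)⁻¹ i j) ≠ 0 := by
    intro h0
    have h3 := inv_le_designGram_inv_diag hm hK hX
    have h4 : (designGram fun k => (w k).1)⁻¹ i i = 0 := congrFun h0 i
    rw [h4] at h3
    have : 0 < (K * m)⁻¹ := by positivity
    linarith
  have hS := h _ hrow
  rw [ENNReal.ofReal_mul hκ.le]
  constructor
  · rw [← hmp.measure_preimage (measurableSet_le measurable_const hmeas).nullMeasurableSet]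
    refine (mul_le_mul' hS hη₁).trans ?_
    rw [← Measure.prod_prod]
    refine measure_mono fun q hq => ?_
    exact (le_abs_olsEstimator_cons_sub hm hK hd hD hX hw hq.1.2 hq.1.1).1 hq.2
  · rw [← hmp.measure_preimage (measurableSet_le hmeas measurable_const).nullMeasurableSet]
    refine (mul_le_mul' hS hη₂).trans ?_
    rw [← Measure.prod_prod]
    refine measure_mono fun q hq => ?_
    exact (le_abs_olsEstimator_cons_sub hm hK hd hD hX hw hq.1.2 hq.1.1).2 hq.2

theorem replaceFirst_cons {𝒵 : Type*} {m : ℕ} (z' z₁ : 𝒵) (w : Fin m → 𝒵) :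
    replaceFirst z' (Fin.cons z₁ w : Fin (m + 1) → 𝒵) = Fin.cons z' w := by
  ext k
  refine Fin.cases ?_ (fun k => ?_) k <;> simp [replaceFirst]

theorem measurable_replaceFirst {𝒵 : Type*} [MeasurableSpace 𝒵] {n : ℕ} :
    Measurable fun q : 𝒵 × (Fin n → 𝒵) => replaceFirst q.1 q.2 := by
  refine measurable_pi_lambda _ fun k => ?_
  by_cases hk : (k : ℕ) = 0
  · simpa [replaceFirst, hk] using measurable_fst
  · simp only [replaceFirst, hk, if_false]
    fun_prop

theorem measurePreserving_cons {𝒵 : Type*} [MeasurableSpace 𝒵] (P : Measure 𝒵)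
    [SigmaFinite P] (m : ℕ) :
    MeasurePreserving (fun q : 𝒵 × (Fin m → 𝒵) => (Fin.cons q.1 q.2 : Fin (m + 1) → 𝒵))
      (P.prod (Measure.pi fun _ => P)) (Measure.pi fun _ => P) := by
  convert (measurePreserving_piFinSuccAbove (fun _ : Fin (m + 1) => P) 0).symm using 1
  ext q k
  simp [MeasurableEquiv.piFinSuccAbove, Fin.insertNthEquiv]

/-- Replacing the first data point moves a vanishing coefficient of the least squares estimator
across an interval of length of the order `1 / n` with probability of the order `1 / √n`. -/
theorem exists_le_measure_olsEstimator_replaceFirst (hτ : 0 < τ) {D₁ D₂ : ℝ} (hD₁ : 0 < D₁)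
    (hD₂ : 0 < D₂) (M : ℝ) :
    ∃ (c : ℝ) (N : ℕ), 0 < c ∧ ∀ m : ℕ, N ≤ m → ∀ i : Fin p, β i = 0 → ∀ a d : ℝ, 0 ≤ a →
      D₁ / m ≤ d → d ≤ D₂ / m → (a + d) ^ 2 * m ≤ M →
      ENNReal.ofReal (c / √m) ≤
        ((linearModelLaw β τ).prod (Measure.pi fun _ : Fin (m + 1) => linearModelLaw β τ))
          {q | olsEstimator q.2 i ≤ a ∧ a + d ≤ olsEstimator (replaceFirst q.1 q.2) i} := by
  obtain ⟨K, hK, hreg⟩ := exists_le_measure_regularDesign p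
  obtain ⟨c₁, hc₁, h₁⟩ := exists_le_measure_olsEstimator_mem_Icc β hτ hK hreg hD₁ M
  obtain ⟨C, hC, h₂⟩ := exists_measure_olsEstimator_sub_gt_le β τ
  obtain ⟨c₃, hc₃, h₃⟩ := exists_le_measure_olsEstimator_cons β hτ hK hD₂.le
  -- From here on `C / m` is at most half of `c₁ / √m`.
  have hev : ∀ᶠ m : ℕ in atTop, 2 * C / c₁ ≤ √(m : ℝ) :=
    (Real.tendsto_sqrt_atTop.comp tendsto_natCast_atTop_atTop).eventually_ge_atTop _
  obtain ⟨N, hN⟩ := (hev.and (eventually_ge_atTop (2 * p + 3))).exists_forall_of_atTop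
  -- One factor `c₃` for each of the two versions of the first point, and `c₁ / 2` for the event on
  -- the remaining points.
  refine ⟨c₃ * c₃ * (c₁ / 2), N, by positivity, fun m hm i hi a d ha hd₁ hd₂ haM => ?_⟩
  obtain ⟨hCm, hpm⟩ := hN m hm
  have hm1 : 1 ≤ m := by omega
  have hm0 : (0 : ℝ) < m := by exact_mod_cast hm1
  have hsm : 0 < √(m : ℝ) := Real.sqrt_pos.2 hm0
  set P := linearModelLaw β τ with hP
  set B : Set (Fin m → DataPoint p) := {w | (olsEstimator w i ∈ Set.Icc a (a + d) ∧
    (fun k => (w k).1) ∈ regularDesign K i) ∧ ∀ j, |olsEstimator w j - β j| ≤ 1} with hB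
  have hBm : MeasurableSet B := by
    refine MeasurableSet.inter (((measurable_olsEstimator_apply i) measurableSet_Icc).inter
      ((by fun_prop : Measurable fun (z : Fin m → DataPoint p) k => (z k).1)
        (measurableSet_regularDesign K i))) ?_
    have : {w : Fin m → DataPoint p | ∀ j, |olsEstimator w j - β j| ≤ 1} =
      ⋂ j, {w | |olsEstimator w j - β j| ≤ 1} := by ext; simp
    change MeasurableSet {w : Fin m → DataPoint p | ∀ j, |olsEstimator w j - β j| ≤ 1}
    rw [this]
    exact MeasurableSet.iInter fun j => measurableSet_le
      (continuous_abs.measurable.comp ((measurable_olsEstimator_apply j).sub_const _))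
      measurable_const
  have hBle : ENNReal.ofReal (c₁ / 2 / √m) ≤ (Measure.pi fun _ : Fin m => P) B := by
    have e1 := h₁ m hpm i hi a d ha hd₁ haM
    have e2 := h₂ m hpm
    have e3 : ENNReal.ofReal (c₁ / √m) ≤ (Measure.pi fun _ : Fin m => P) B +
        ENNReal.ofReal (C / m) := by
      refine (e1.trans (measure_mono ?_)).trans
        ((measure_union_le B _).trans (add_le_add le_rfl e2))
      intro w hw
      by_cases hb : ∀ j, |olsEstimator w j - β j| ≤ 1
      · exact Or.inl ⟨hw, hb⟩
      · exact Or.inr hb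
    have e4 : C / m ≤ c₁ / 2 / √m := by
      rw [div_le_div_iff₀ hm0 hsm]
      rw [div_le_iff₀ hc₁] at hCm
      have : (m : ℝ) = √m * √m := (Real.mul_self_sqrt hm0.le).symm
      nlinarith
    have e5 : ENNReal.ofReal (c₁ / √m) = ENNReal.ofReal (c₁ / 2 / √m) +
        ENNReal.ofReal (c₁ / 2 / √m) := by
      rw [← ENNReal.ofReal_add (by positivity) (by positivity)]
      congr 1
      ring
    rw [e5] at e3
    exact (ENNReal.add_le_add_iff_right ENNReal.ofReal_ne_top).1
      (e3.trans (add_le_add le_rfl (ENNReal.ofReal_le_ofReal e4)))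
  set E : Set (DataPoint p × (Fin (m + 1) → DataPoint p)) :=
    {q | olsEstimator q.2 i ≤ a ∧ a + d ≤ olsEstimator (replaceFirst q.1 q.2) i} with hE
  have hEm : MeasurableSet E :=
    (measurableSet_le ((measurable_olsEstimator_apply i).comp measurable_snd)
      measurable_const).inter (measurableSet_le measurable_const
        ((measurable_olsEstimator_apply i).comp measurable_replaceFirst))
  -- The replacement and the first point are grouped together, so that one can condition on the
  -- remaining points.
  have hmp : MeasurePreserving (fun q : (DataPoint p × DataPoint p) × (Fin m → DataPoint p) =>
      (q.1.1, (Fin.cons q.1.2 q.2 : Fin (m + 1) → DataPoint p)))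
      ((P.prod P).prod (Measure.pi fun _ => P)) (P.prod (Measure.pi fun _ => P)) :=
    ((MeasurePreserving.id P).prod (measurePreserving_cons P m)).comp
      (measurePreserving_prodAssoc P P (Measure.pi fun _ => P))
  rw [← hmp.measure_preimage hEm.nullMeasurableSet,
    Measure.prod_apply_symm (hmp.measurable hEm)]
  have hpt : ∀ w : Fin m → DataPoint p,
      B.indicator (fun _ => ENNReal.ofReal (c₃ * c₃)) w ≤
        (P.prod P) ((fun q => (q, w)) ⁻¹' ((fun q : (DataPoint p × DataPoint p) ×
          (Fin m → DataPoint p) =>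
            (q.1.1, (Fin.cons q.1.2 q.2 : Fin (m + 1) → DataPoint p))) ⁻¹' E)) := by
    intro w
    by_cases hw : w ∈ B
    · rw [Set.indicator_of_mem hw]
      have hmd : m * d ≤ D₂ := by rwa [le_div_iff₀ hm0, mul_comm] at hd₂
      -- The common points put the coordinate in `[a, a + d]`; the replacement raises it by `d`, to
      -- at least `a + d`, and the original first point lowers it by `d`, to at most `a`.
      obtain ⟨e1, e2⟩ := h₃ m hm1 i w d hmd hw.1.2 hw.2
      rw [ENNReal.ofReal_mul hc₃.le]
      refine (mul_le_mul' e1 e2).trans ?_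
      rw [← Measure.prod_prod]
      refine measure_mono fun q hq => ?_
      obtain ⟨hq1, hq2⟩ := hq
      have hb := hw.1.1
      simp only [hE, Set.mem_preimage, Set.mem_ofPred_eq, replaceFirst_cons] at hq1 hq2 ⊢
      exact ⟨by linarith [hb.2], by linarith [hb.1]⟩
    · rw [Set.indicator_of_notMem hw]
      exact zero_le
  refine le_trans ?_ (lintegral_mono hpt)
  rw [lintegral_indicator_const hBm, mul_div_assoc, ENNReal.ofReal_mul (by positivity)]
  gcongr

end

noncomputable section

/-! ### Relative instability -/

section SoftThreshold

variable {t₁ t₂ b b' : ℝ}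

/-- For `b < 0` the higher threshold moves the value up towards zero, and for `0 < b ≤ t₁` both
values vanish. The positive part of `t₁` accounts for negative thresholds. -/
theorem softThreshold_sub_nonpos (ht : t₁ ≤ t₂) (hb : b ≤ max t₁ 0) :
    softThreshold t₁ b - softThreshold t₂ b ≤ 0 := by
  have hle : max (|b| - t₂) 0 ≤ max (|b| - t₁) 0 := max_le_max (by linarith) le_rfl
  rw [softThreshold, softThreshold, ← mul_sub]
  rcases lt_trichotomy b 0 with h | h | h
  · rw [Real.sign_of_neg h]
    linarith
  · simp [h]
  · have h1 : b ≤ t₁ := by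
      rcases le_max_iff.1 hb with h1 | h1
      · exact h1
      · exact absurd h (not_lt.2 h1)
    rw [abs_of_pos h, max_eq_right (by linarith), max_eq_right (by linarith)]
    simp

theorem softThreshold_sub_eq (ht : t₁ < t₂) (hb : max t₁ 0 + (t₂ - t₁) ≤ b) :
    softThreshold t₁ b - softThreshold t₂ b = t₂ - t₁ := by
  have h1 := le_max_left t₁ 0
  have h2 := le_max_right t₁ 0
  have hb0 : 0 < b := by linarith
  rw [softThreshold_sub_of_le (by rw [abs_of_pos hb0]; linarith)
    (by rw [abs_of_pos hb0]; linarith), Real.sign_of_pos hb0, one_mul]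

/-- Below the window the increment is nonpositive and above it equals `t₂ - t₁`, so a crossing
changes it by at least `t₂ - t₁`. -/
theorem sq_le_sq_softThreshold_sub (ht : t₁ < t₂) (hb : b ≤ max t₁ 0)
    (hb' : max t₁ 0 + (t₂ - t₁) ≤ b') :
    (t₂ - t₁) ^ 2 ≤
      (softThreshold t₁ b - softThreshold t₂ b - (softThreshold t₁ b' - softThreshold t₂ b')) ^ 2 := by
  have h1 := softThreshold_sub_nonpos ht.le hb
  rw [softThreshold_sub_eq ht hb']
  nlinarith

/-- The hypothesis excludes `b = 0` with `t < 0`, where `Real.sign 0 = 0` kills a positive factor.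
-/
theorem sq_softThreshold (t b : ℝ) (h : t ≤ 0 → b ≠ 0) :
    softThreshold t b ^ 2 = max (|b| - t) 0 ^ 2 := by
  rw [softThreshold, mul_pow]
  by_cases hb : b = 0
  · have ht : 0 < t := by
      by_contra h0
      exact h (not_lt.1 h0) hb
    rw [hb, abs_zero, max_eq_right (by linarith)]
    ring
  · rcases lt_or_gt_of_ne hb with h0 | h0
    · rw [Real.sign_of_neg h0]; ring
    · rw [Real.sign_of_pos h0]; ring

theorem sq_softThreshold_le (ht : t₁ ≤ t₂) (b : ℝ) :
    softThreshold t₂ b ^ 2 ≤ softThreshold t₁ b ^ 2 := by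
  by_cases hb : b = 0
  · simp [softThreshold, hb]
  · rw [sq_softThreshold t₁ b fun _ => hb, sq_softThreshold t₂ b fun _ => hb]
    exact pow_le_pow_left₀ (le_max_right _ _) (max_le_max (by linarith) le_rfl) 2

theorem sq_softThreshold_lt (ht : t₁ < t₂) (hb : max t₁ 0 + (t₂ - t₁) ≤ b) :
    softThreshold t₂ b ^ 2 < softThreshold t₁ b ^ 2 := by
  have h1 := le_max_left t₁ 0
  have h2 := le_max_right t₁ 0
  have hb0 : 0 < b := by linarith
  rw [sq_softThreshold t₁ b fun _ => hb0.ne', sq_softThreshold t₂ b fun _ => hb0.ne',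
    abs_of_pos hb0, max_eq_left (by linarith), max_eq_left (by linarith)]
  exact pow_lt_pow_left₀ (by linarith) (by linarith) two_ne_zero

end SoftThreshold

variable {p : ℕ} (β : Fin p → ℝ) {τ : ℝ}

/-- The event that replacing the first data point moves the `i`-th coefficient of the least squares
estimator across the interval on which soft thresholding at `t₁` and at `t₂` differ by less
than `|t₂ - t₁|`. -/
def crossingEvent {n p : ℕ} (t₁ t₂ : ℝ) (i : Fin p) :
    Set (DataPoint p × (Fin n → DataPoint p)) :=
  {q | olsEstimator q.2 i ≤ max (min t₁ t₂) 0 ∧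
    max (min t₁ t₂) 0 + |t₂ - t₁| ≤ olsEstimator (replaceFirst q.1 q.2) i}

/-- Of the variance only the noise contribution of coordinate `i` is kept. On the crossing event it
is at least `4 τ²` times the squared threshold difference, and Markov's inequality concludes. -/
theorem le_lossStability_stDiffLoss (τ : ℝ) {n : ℕ} (hn : 2 * p + 3 ≤ n) {l₁ l₂ : ℝ} (hne : l₁ ≠ l₂)
    (i : Fin p) :
    4 * τ ^ 2 * ((l₂ / n - l₁ / n) ^ 2 *
      ((linearModelLaw β τ).prod (Measure.pi fun _ : Fin n => linearModelLaw β τ)).real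
        (crossingEvent (l₁ / n) (l₂ / n) i)) ≤
      lossStability (linearModelLaw β τ) (n := n) (stDiffLoss l₁ l₂) := by
  have hn0 : (0 : ℝ) < n := by
    have : 0 < n := by omega
    exact_mod_cast this
  set μ := (linearModelLaw β τ).prod (Measure.pi fun _ : Fin n => linearModelLaw β τ) with hμ
  obtain ⟨hint, heq⟩ := lossStability_sum_mul (linearModelLaw β τ) measurable_lossMonomial
    (measurable_lossCoeff_stEstimator l₁ l₂) (memLp_lossMonomial β τ)
    (memLp_lossCoeff_stEstimator β τ hn l₁ l₂)
  rw [stDiffLoss_eq_sum, heq]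
  refine le_trans ?_ (mul_meas_ge_le_integral_of_nonneg
    (Eventually.of_forall fun q => variance_nonneg _ _) hint (4 * τ ^ 2 * (l₂ / n - l₁ / n) ^ 2))
  rw [← mul_assoc]
  refine mul_le_mul_of_nonneg_left (measureReal_mono fun q hq => ?_) (by positivity)
  rw [Set.mem_ofPred_eq, variance_sum_mul_lossMonomial]
  refine le_trans ?_ (le_add_of_nonneg_right (variance_nonneg _ _))
  refine mul_le_mul_of_nonneg_left (le_trans ?_ (Finset.single_le_sum
    (f := fun j => (lossCoeff (stEstimator l₁ q.2) (stEstimator l₂ q.2) (.inl j) -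
      lossCoeff (stEstimator l₁ (replaceFirst q.1 q.2))
        (stEstimator l₂ (replaceFirst q.1 q.2)) (.inl j)) ^ 2)
    (fun j _ => sq_nonneg _) (Finset.mem_univ i))) (by positivity)
  simp only [lossCoeff, stEstimator_apply]
  obtain ⟨hq1, hq2⟩ := hq
  rcases lt_or_gt_of_ne hne with hlt | hlt
  · have ht : l₁ / n < l₂ / n := by gcongr
    rw [min_eq_left ht.le] at hq1 hq2
    rw [abs_of_pos (by linarith)] at hq2
    have h := sq_le_sq_softThreshold_sub ht hq1 hq2
    refine h.trans_eq ?_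
    ring
  · have ht : l₂ / n < l₁ / n := by gcongr
    rw [min_eq_right ht.le] at hq1 hq2
    rw [abs_of_neg (by linarith), neg_sub] at hq2
    have h := sq_le_sq_softThreshold_sub ht hq1 hq2
    rw [← neg_sq, neg_sub]
    refine h.trans_eq ?_
    ring

instance isOpenPosMeasure_gaussianReal {v : NNReal} [hv : NeZero v] (m : ℝ) :
    (gaussianReal m v).IsOpenPosMeasure :=
  (gaussianReal_absolutelyContinuous' m hv.ne).isOpenPosMeasure

/-- A form of zero variance is almost surely constant, hence constant everywhere by continuity and
full support; its values at `eᵢ` and `0` then give `M i i = 0`. -/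
theorem variance_quadratic_pos {M : Fin p → Fin p → ℝ} {i : Fin p} (hM : M i i ≠ 0) :
    0 < Var[fun x : Fin p → ℝ => ∑ j, ∑ k, M j k * (x j * x k);
      Measure.pi fun _ => gaussianReal 0 1] := by
  set μ := Measure.pi fun _ : Fin p => gaussianReal 0 1 with hμ
  set f : (Fin p → ℝ) → ℝ := fun x => ∑ j, ∑ k, M j k * (x j * x k) with hf
  have hx : ∀ j, MemLp (fun x : Fin p → ℝ => x j) 4 μ := fun j => memLp_gaussianReal_coord 1 j 4
  have hf2 : MemLp f 2 μ := memLp_finsetSum _ fun j _ => memLp_finsetSum _ fun k _ =>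
    ((hx k).mul (hx j)).const_mul _
  refine lt_of_le_of_ne (variance_nonneg _ _) fun h0 => hM ?_
  have hae := ae_eq_integral_of_variance_eq_zero hf2 h0.symm
  have hcont : Continuous f := by fun_prop
  have hEq : f = fun _ => ∫ x, f x ∂μ := (hcont.ae_eq_iff_eq μ continuous_const).1 hae
  have h1 : f (Pi.single i 1) = f 0 := by rw [hEq]
  have h2 : f (Pi.single i 1) = M i i := by
    simp [hf, Pi.single_apply]
  rw [← h2, h1]
  simp [hf]

/-- Raising the threshold never increases the square of the estimator, and strictly decreases it on
the given event. This yields a nonzero diagonal coefficient of the mean loss when `β = 0`. -/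
theorem integral_sq_stEstimator_sub_pos (τ : ℝ) {n : ℕ} (hn : 2 * p + 3 ≤ n) {l₁ l₂ : ℝ}
    (hlt : l₁ < l₂) {i : Fin p}
    (hpos : (Measure.pi fun _ : Fin n => linearModelLaw β τ)
      {z | max (l₁ / n) 0 + (l₂ / n - l₁ / n) ≤ olsEstimator z i} ≠ 0) :
    0 < ∫ z, (stEstimator l₁ z i ^ 2 - stEstimator l₂ z i ^ 2)
      ∂(Measure.pi fun _ : Fin n => linearModelLaw β τ) := by
  have hn0 : (0 : ℝ) < n := by
    have : 0 < n := by omega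
    exact_mod_cast this
  have ht : l₁ / n < l₂ / n := by gcongr
  rw [integral_pos_iff_support_of_nonneg
    (f := fun z => stEstimator l₁ z i ^ 2 - stEstimator l₂ z i ^ 2)
    (fun z => sub_nonneg.2 (sq_softThreshold_le ht.le _))
    ((memLp_stEstimator β τ hn l₁ i).integrable_sq.sub
      (memLp_stEstimator β τ hn l₂ i).integrable_sq)]
  refine (pos_iff_ne_zero.2 hpos).trans_le (measure_mono fun z hz => ?_)
  exact (sub_pos.2 (sq_softThreshold_lt ht hz)).ne'

/-- Without signal the variance of the comparison of two soft-thresholding estimators is positive,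
though it is of smaller order than with signal. -/
theorem lossVariance_stDiffLoss_pos_of_zero (τ : ℝ) {n : ℕ} (hn : 2 * p + 3 ≤ n) {l₁ l₂ : ℝ}
    (hne : l₁ ≠ l₂) {i : Fin p}
    (hpos : (Measure.pi fun _ : Fin n => linearModelLaw (0 : Fin p → ℝ) τ)
      {z | max (min (l₁ / n) (l₂ / n)) 0 + |l₂ / n - l₁ / n| ≤ olsEstimator z i} ≠ 0) :
    0 < lossVariance (linearModelLaw (0 : Fin p → ℝ) τ) (n := n) (stDiffLoss l₁ l₂) := by
  have hn0 : (0 : ℝ) < n := by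
    have : 0 < n := by omega
    exact_mod_cast this
  rw [lossVariance_stDiffLoss 0 τ hn, variance_sum_mul_lossMonomial]
  simp only [dotProduct_zero, mul_zero, zero_mul, zero_add]
  refine add_pos_of_nonneg_of_pos
    (mul_nonneg (by positivity) (Finset.sum_nonneg fun _ _ => sq_nonneg _))
    (variance_quadratic_pos (M := fun j k => ∫ z, lossCoeff (stEstimator l₁ z) (stEstimator l₂ z)
        (.inr (j, k)) ∂(Measure.pi fun _ : Fin n => linearModelLaw (0 : Fin p → ℝ) τ)) (i := i) ?_)
  simp only [lossCoeff, ← sq]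
  rcases lt_or_gt_of_ne hne with hlt | hlt
  · have ht : l₁ / n < l₂ / n := by gcongr
    rw [min_eq_left ht.le, abs_of_pos (by linarith)] at hpos
    exact (integral_sq_stEstimator_sub_pos 0 τ hn hlt hpos).ne'
  · have ht : l₂ / n < l₁ / n := by gcongr
    rw [min_eq_right ht.le, abs_of_neg (by linarith), neg_sub] at hpos
    have h := integral_sq_stEstimator_sub_pos 0 τ hn hlt hpos
    simp_rw [← neg_sub (stEstimator l₂ _ _ ^ 2)]
    rw [integral_neg]
    exact (neg_neg_of_pos h).ne

variable {lam δ : ℕ → ℝ}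

theorem exists_le_abs_of_isTheta_one (hδ : δ =Θ[atTop] (fun _ : ℕ => (1 : ℝ))) :
    ∃ D₁ D₂ : ℝ, 0 < D₁ ∧ 0 < D₂ ∧ ∀ᶠ n : ℕ in atTop, D₁ ≤ |δ n| ∧ |δ n| ≤ D₂ := by
  obtain ⟨c₂, hc₂, h₂⟩ := hδ.1.exists_pos
  obtain ⟨c₁, hc₁, h₁⟩ := hδ.2.exists_pos
  refine ⟨c₁⁻¹, c₂, by positivity, hc₂, ?_⟩
  filter_upwards [h₁.bound, h₂.bound] with n e1 e2
  rw [norm_one, Real.norm_eq_abs] at e1 e2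
  refine ⟨?_, by linarith⟩
  rw [inv_eq_one_div, div_le_iff₀ hc₁]
  linarith

theorem exists_le_measure_crossingEvent (hτ : 0 < τ)
    (hlam : lam =O[atTop] (fun n : ℕ => √(n : ℝ)))
    (hδ : δ =Θ[atTop] (fun _ : ℕ => (1 : ℝ))) :
    ∃ c : ℝ, 0 < c ∧ ∀ᶠ n : ℕ in atTop, ∀ i : Fin p, β i = 0 →
      ENNReal.ofReal (c / √n) ≤
        ((linearModelLaw β τ).prod (Measure.pi fun _ : Fin n => linearModelLaw β τ))
          (crossingEvent (lam n / n) ((lam n + δ n) / n) i) := by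
  obtain ⟨D₁, D₂, hD₁, hD₂, hD⟩ := exists_le_abs_of_isTheta_one hδ
  obtain ⟨L, hL, hlamL⟩ := hlam.exists_pos
  -- This will be used with `m = n - 1` common points: `D₁ / 2` absorbs the passage from `m` to `n ≤
  -- 2 m`. The right end of the window is at most `(L + D₂) / √n`, which explains `(L + D₂) ^ 2`.
  obtain ⟨c, N, hc, h⟩ := exists_le_measure_olsEstimator_replaceFirst β hτ (D₁ := D₁ / 2)
    (by positivity) hD₂ ((L + D₂) ^ 2)
  refine ⟨c, hc, ?_⟩
  filter_upwards [hD, hlamL.bound, eventually_ge_atTop (N + 2)] with n hDn hLn hn i hi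
  obtain ⟨m, rfl⟩ : ∃ m, n = m + 1 := ⟨n - 1, by omega⟩
  have hm0 : (1 : ℝ) ≤ m := by
    have : 1 ≤ m := by omega
    exact_mod_cast this
  have hn0 : (0 : ℝ) < ((m + 1 : ℕ) : ℝ) := by positivity
  have hmn : ((m + 1 : ℕ) : ℝ) = m + 1 := by push_cast; rfl
  rw [Real.norm_eq_abs, Real.norm_eq_abs, abs_of_nonneg (Real.sqrt_nonneg _)] at hLn
  set n : ℕ := m + 1
  have hdiff : (lam n + δ n) / n - lam n / n = δ n / n := by ring
  have habs : |(lam n + δ n) / n - lam n / n| = |δ n| / n := by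
    rw [hdiff, abs_div, Nat.abs_cast]
  have hle1 : max (min (lam n / n) ((lam n + δ n) / n)) 0 ≤ |lam n| / n := by
    refine max_le ((min_le_left _ _).trans ?_) (by positivity)
    gcongr
    exact le_abs_self _
  have hsn1 : 1 ≤ √(n : ℝ) := Real.one_le_sqrt.2 (by rw [hmn]; linarith)
  have key := h m (by omega) i hi (max (min (lam n / n) ((lam n + δ n) / n)) 0) (|δ n| / n)
    (le_max_right _ _) ?_ ?_ ?_
  · rw [crossingEvent, habs]
    refine le_trans (ENNReal.ofReal_le_ofReal ?_) key
    gcongr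
    exact Nat.le_succ m
  · rw [div_div, div_le_div_iff₀ (by positivity) hn0, hmn]
    have := hDn.1
    nlinarith
  · have : (m : ℝ) ≤ n := by rw [hmn]; linarith
    gcongr
    exact hDn.2
  · have h1 : max (min (lam n / n) ((lam n + δ n) / n)) 0 + |δ n| / n ≤
        (L + D₂) * √n / n := by
      refine (add_le_add hle1 le_rfl).trans ?_
      rw [← add_div]
      gcongr
      nlinarith [hDn.2]
    have h0 : 0 ≤ max (min (lam n / n) ((lam n + δ n) / n)) 0 + |δ n| / n := by positivity
    have hmle : (m : ℝ) ≤ n := by rw [hmn]; linarith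
    calc (max (min (lam n / n) ((lam n + δ n) / n)) 0 + |δ n| / n) ^ 2 * m
        ≤ ((L + D₂) * √n / n) ^ 2 * n := by gcongr
      _ = (L + D₂) ^ 2 := by
        rw [div_pow, mul_pow, Real.sq_sqrt hn0.le]
        field_simp

theorem exists_le_lossStability_stDiffLoss (hτ : 0 < τ) (hβ : hammingNorm β < p)
    (hlam : lam =O[atTop] (fun n : ℕ => √(n : ℝ)))
    (hδ : δ =Θ[atTop] (fun _ : ℕ => (1 : ℝ))) :
    ∃ c : ℝ, 0 < c ∧ ∀ᶠ n : ℕ in atTop, c / ((n : ℝ) ^ 2 * √n) ≤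
      lossStability (linearModelLaw β τ) (n := n) (stDiffLoss (lam n) (lam n + δ n)) := by
  obtain ⟨i, hi⟩ : ∃ i, β i = 0 := by
    by_contra! h
    have : hammingNorm β = p := by simp [hammingNorm, h]
    omega
  obtain ⟨D₁, D₂, hD₁, hD₂, hD⟩ := exists_le_abs_of_isTheta_one hδ
  obtain ⟨c, hc, h⟩ := exists_le_measure_crossingEvent β hτ hlam hδ
  refine ⟨4 * τ ^ 2 * (D₁ ^ 2 * c), by positivity, ?_⟩
  filter_upwards [h, hD, eventually_ge_atTop (2 * p + 3)] with n hn hDn hpn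
  have hn0 : (0 : ℝ) < n := by
    have : 0 < n := by omega
    exact_mod_cast this
  have hsn : 0 < √(n : ℝ) := Real.sqrt_pos.2 hn0
  have hne : lam n ≠ lam n + δ n := by
    intro h0
    have h1 : δ n = 0 := by linarith
    rw [h1, abs_zero] at hDn
    linarith [hDn.1]
  refine le_trans ?_ (le_lossStability_stDiffLoss β τ hpn hne i)
  have hdiff : (lam n + δ n) / n - lam n / n = δ n / n := by ring
  have hreal : c / √n ≤ ((linearModelLaw β τ).prod
      (Measure.pi fun _ : Fin n => linearModelLaw β τ)).real
        (crossingEvent (lam n / n) ((lam n + δ n) / n) i) :=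
    (ENNReal.ofReal_le_iff_le_toReal (measure_ne_top _ _)).1 (hn i hi)
  rw [hdiff]
  calc 4 * τ ^ 2 * (D₁ ^ 2 * c) / ((n : ℝ) ^ 2 * √n)
      = 4 * τ ^ 2 * ((D₁ / n) ^ 2 * (c / √n)) := by field_simp
    _ ≤ 4 * τ ^ 2 * ((δ n / n) ^ 2 * _) := by
        refine mul_le_mul_of_nonneg_left (mul_le_mul ?_ hreal (by positivity) (sq_nonneg _))
          (by positivity)
        rw [div_pow, div_pow, ← sq_abs (δ n)]
        have := hDn.1
        gcongr

/-- The lower bound on `r` divides by `σ²`, and division by zero would give `r = 0`. For `β ≠ 0`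
positivity follows from the positive limit; for `β = 0` the limit is zero and positivity is shown at
each large `n`. -/
theorem eventually_lossVariance_stDiffLoss_pos (hτ : 0 < τ) (hβ : hammingNorm β < p)
    (hlam : lam =O[atTop] (fun n : ℕ => √(n : ℝ)))
    (hδ : δ =Θ[atTop] (fun _ : ℕ => (1 : ℝ)))
    (hlim : Tendsto (fun n : ℕ => (n : ℝ) ^ 2 / δ n ^ 2 *
        lossVariance (linearModelLaw β τ) (n := n) (stDiffLoss (lam n) (lam n + δ n)))
      atTop (𝓝 (4 * τ ^ 2 * hammingNorm β))) :
    ∀ᶠ n : ℕ in atTop, 0 < lossVariance (linearModelLaw β τ) (n := n)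
      (stDiffLoss (lam n) (lam n + δ n)) := by
  by_cases hβ0 : β = 0
  · subst hβ0
    have hp : 0 < p := lt_of_le_of_lt (Nat.zero_le _) hβ
    obtain ⟨D₁, D₂, hD₁, hD₂, hD⟩ := exists_le_abs_of_isTheta_one hδ
    obtain ⟨c, hc, h⟩ := exists_le_measure_crossingEvent (0 : Fin p → ℝ) hτ hlam hδ
    filter_upwards [h, hD, eventually_ge_atTop (2 * p + 3)] with n hn hDn hpn
    have hn0 : (0 : ℝ) < n := by
      have : 0 < n := by omega
      exact_mod_cast this
    have hsn : 0 < √(n : ℝ) := Real.sqrt_pos.2 hn0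
    have hne : lam n ≠ lam n + δ n := by
      intro h0
      have h1 : δ n = 0 := by linarith
      rw [h1, abs_zero] at hDn
      linarith [hDn.1]
    refine lossVariance_stDiffLoss_pos_of_zero τ hpn hne (i := ⟨0, hp⟩) (ne_of_gt ?_)
    have hm : MeasurableSet {z : Fin n → DataPoint p | max (min (lam n / n) ((lam n + δ n) / n)) 0 +
        |(lam n + δ n) / n - lam n / n| ≤ olsEstimator z ⟨0, hp⟩} :=
      measurableSet_le measurable_const (measurable_olsEstimator_apply _)
    rw [← (measurePreserving_replaceFirst (linearModelLaw (0 : Fin p → ℝ) τ)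
      (n := n)).measure_preimage hm.nullMeasurableSet]
    refine lt_of_lt_of_le ?_ ((hn ⟨0, hp⟩ rfl).trans (measure_mono fun q hq => hq.2))
    exact ENNReal.ofReal_pos.2 (by positivity)
  · have hpos : (0 : ℝ) < 4 * τ ^ 2 * hammingNorm β := by
      have : (0 : ℝ) < hammingNorm β := by exact_mod_cast hammingNorm_pos_iff.2 hβ0
      positivity
    filter_upwards [hlim.eventually (lt_mem_nhds hpos)] with n hn
    exact pos_of_mul_pos_right hn (by positivity)

theorem theorem2 (p : ℕ) (β : Fin p → ℝ) (τ : ℝ) (hτ : 0 < τ) (lam δ : ℕ → ℝ) :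
    -- for all large `n` the loss is square integrable, so `σ²` and `γ` are finite
    (∀ᶠ n : ℕ in atTop,
      MemLp (fun ω => stDiffLoss (lam n) (lam n + δ n) (testPoint ω) (trainSet ω)) 2
        (iidLaw (linearModelLaw β τ) n)) ∧
    -- the limit of `σ²` in the general regime, without sparsity
    (lam =o[atTop] (fun n : ℕ => (n : ℝ)) → δ =o[atTop] (fun n : ℕ => (n : ℝ)) →
      (∀ᶠ n : ℕ in atTop, δ n ≠ 0) →
      Tendsto (fun n : ℕ => (n : ℝ) ^ 2 / δ n ^ 2 *
          lossVariance (linearModelLaw β τ) (n := n) (stDiffLoss (lam n) (lam n + δ n)))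
        atTop (𝓝 (4 * τ ^ 2 * hammingNorm β))) ∧
    -- relative instability
    (hammingNorm β < p →
      lam =O[atTop] (fun n : ℕ => √(n : ℝ)) → (fun _ : ℕ => (1 : ℝ)) =o[atTop] lam →
      δ =Θ[atTop] (fun _ : ℕ => (1 : ℝ)) →
      Tendsto (fun n : ℕ => (n : ℝ) ^ 2 / δ n ^ 2 *
          lossVariance (linearModelLaw β τ) (n := n) (stDiffLoss (lam n) (lam n + δ n)))
        atTop (𝓝 (4 * τ ^ 2 * hammingNorm β)) ∧
      (fun n : ℕ => 1 / ((n : ℝ) ^ 2 * √(n : ℝ))) =O[atTop]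
        (fun n : ℕ =>
          lossStability (linearModelLaw β τ) (n := n) (stDiffLoss (lam n) (lam n + δ n))) ∧
      (fun n : ℕ => √(n : ℝ)) =O[atTop]
        (fun n : ℕ =>
          relLossStability (linearModelLaw β τ) (n := n) (stDiffLoss (lam n) (lam n + δ n))) ∧
      ¬ RelLossStabilityCondition (linearModelLaw β τ)
          (fun n => stDiffLoss (lam n) (lam n + δ n))) := by
  refine ⟨?_, tendsto_lossVariance_stDiffLoss β τ, fun hβ hlam _ hδ => ?_⟩
  · filter_upwards [eventually_ge_atTop (2 * p + 3)] with n hn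
    exact memLp_stDiffLoss β τ hn _ _
  have hnat : Tendsto (fun n : ℕ => (n : ℝ)) atTop atTop := tendsto_natCast_atTop_atTop
  have hsqrt : Tendsto (fun n : ℕ => √(n : ℝ)) atTop atTop :=
    Real.tendsto_sqrt_atTop.comp hnat
  have hone : (fun _ : ℕ => (1 : ℝ)) =o[atTop] fun n : ℕ => √(n : ℝ) :=
    (isLittleO_const_left.2 (Or.inr (tendsto_norm_atTop_atTop.comp hsqrt)))
  have hsq : (fun n : ℕ => √(n : ℝ)) =o[atTop] fun n : ℕ => (n : ℝ) := by
    have h := hone.mul_isBigO (isBigO_refl (fun n : ℕ => √(n : ℝ)) atTop)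
    simpa [Real.mul_self_sqrt] using h
  obtain ⟨D₁, D₂, hD₁, hD₂, hD⟩ := exists_le_abs_of_isTheta_one hδ
  have hne : ∀ᶠ n : ℕ in atTop, δ n ≠ 0 := by
    filter_upwards [hD] with n hn h0
    rw [h0, abs_zero] at hn
    linarith [hn.1]
  have hlim := tendsto_lossVariance_stDiffLoss β τ (hlam.trans_isLittleO hsq)
    (hδ.1.trans_isLittleO (hone.trans hsq)) hne
  obtain ⟨c, hc, hγ⟩ := exists_le_lossStability_stDiffLoss β hτ hβ hlam hδ
  have hr : (fun n : ℕ => √(n : ℝ)) =O[atTop] (fun n : ℕ =>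
      relLossStability (linearModelLaw β τ) (n := n) (stDiffLoss (lam n) (lam n + δ n))) := by
    -- Strictly above the limit of `n² σ² / δ²`, hence an eventual upper bound, and positive even
    -- for `β = 0`.
    set C := 4 * τ ^ 2 * (hammingNorm β : ℝ) + 1 with hC
    have hCpos : 0 < C := by positivity
    refine IsBigO.of_bound (C * D₂ ^ 2 / c) ?_
    filter_upwards [hγ, hD, hne, eventually_gt_atTop 0,
      hlim.eventually (gt_mem_nhds (lt_add_one (4 * τ ^ 2 * (hammingNorm β : ℝ)))),
      eventually_lossVariance_stDiffLoss_pos β hτ hβ hlam hδ hlim]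
      with n hγn hDn hnen hn hup hpos
    have hn0 : (0 : ℝ) < n := by exact_mod_cast hn
    have hsn : 0 < √(n : ℝ) := Real.sqrt_pos.2 hn0
    rw [Real.norm_eq_abs, Real.norm_eq_abs, abs_of_pos hsn, relLossStability]
    refine le_trans ?_ (mul_le_mul_of_nonneg_left (le_abs_self _) (by positivity))
    set γ := lossStability (linearModelLaw β τ) (n := n) (stDiffLoss (lam n) (lam n + δ n))
    set V := lossVariance (linearModelLaw β τ) (n := n) (stDiffLoss (lam n) (lam n + δ n))
    have hV : V ≤ C * D₂ ^ 2 / n ^ 2 := by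
      rw [div_mul_eq_mul_div, div_lt_iff₀ (by positivity)] at hup
      rw [le_div_iff₀ (by positivity), mul_comm]
      refine hup.le.trans ?_
      rw [← sq_abs (δ n)]
      have := hDn.2
      gcongr
    have h1 : √(n : ℝ) = n / √n := by
      rw [eq_div_iff hsn.ne', Real.mul_self_sqrt hn0.le]
    calc √(n : ℝ) = C * D₂ ^ 2 / c * (n * (c / ((n : ℝ) ^ 2 * √n)) / (C * D₂ ^ 2 / n ^ 2)) := by
          rw [h1]
          field_simp
          exact (Real.sq_sqrt hn0.le).symm
      _ ≤ C * D₂ ^ 2 / c * (n * γ / V) := by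
          have hγ0 : 0 ≤ γ := le_trans (by positivity) hγn
          gcongr
  refine ⟨hlim, ?_, hr, fun hcond => ?_⟩
  · refine IsBigO.of_bound c⁻¹ ?_
    filter_upwards [hγ] with n hn
    rw [Real.norm_eq_abs, Real.norm_eq_abs, abs_of_nonneg (by positivity), inv_mul_eq_div,
      le_div_iff₀ hc, one_div_mul_eq_div]
    exact hn.trans (le_abs_self _)
  -- Stability would give `√n = O(r)` with `r = o(1)` and `1 = o(√n)`, so `√n = o(√n)`, which is
  -- absurd.
  · have h := (hr.trans_isLittleO hcond).trans hone
    obtain ⟨n, hn, hlt⟩ := ((h.bound one_half_pos).and (eventually_gt_atTop 0)).exists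
    have hn0 : (0 : ℝ) < n := by exact_mod_cast hlt
    have hsn : 0 < √(n : ℝ) := Real.sqrt_pos.2 hn0
    rw [Real.norm_eq_abs, abs_of_pos hsn] at hn
    linarith

end
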